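/- **Problem 1-UF-WS.** An instance consists of a number $I$ of satellites and a number $K\ge 1$ of snapshots; for every snapshot $k\in\{1,\dots,K\}$, a set of directed arcs between satellites, each with a non-negative rational capacity $p_{uv}$ (a bi-directional link is a pair of opposite arcs, whose capacities may differ); a server satellite $s$; a set $\mathcal C$ of client satellites; a model size $q\in\mathbb Q$, $q>0$; and a rational weight $w_c\ge 0$ for every $c\in\mathcal C$. The time-varying graph $\mathcal G=(\mathcal V,\mathcal A)$ has the nodes $(i,k)$, the copy of satellite $i$ in snapshot $k$. Its arcs are the arcs $((i,k),(j,k))$ of the snapshots, with the given capacities, and the caching arcs $((i,k),(i,k+1))$, $1\le k<K$, with capacity $q|\mathcal C|$. A feasible routing chooses, for every client $c\in\mathcal C$, one simple directed path in $\mathcal G$ from $(s,1)$ to $(c,k_c)$ for some snapshot $k_c\in\{1,\dots,K\}$ (the arrival snapshot of $c$), such that for every arc $(u,v)\in\mathcal A$, $q$ times the number of clients whose path uses $(u,v)$ is at most $p_{uv}$. (Each client has its own data flow, and the whole model travels on one path: unicast with unsplittable flow.) The objective, to be minimized over all feasible routings, is $\sum_{c\in\mathcal C}w_ck_c$. **Theorem.**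 1-UF-WS is solvable in polynomial time: there is an algorithm (a program of a random-access machine over the integers with logarithmic cost) and a polynomial $P$ such that, on every instance of binary encoding length $L$ (rationals given by numerator and denominator), the algorithm halts with cost at most $P(L)$ and outputs a feasible routing that minimizes $\sum_{c\in\mathcal C}w_ck_c$ over all feasible routings or, if there is no feasible routing, reports that there is none. -/

import Mathlib

/-! ### Random-access machines with logarithmic cost

The machine model is the random-access machine over integers with the logarithmic cost criterion,
with structured control flow.  A program is a finite term, so it mentions finitely many registers,
finitely many arrays and finitely many constants. -/

namespace RAM

/-- The memory: integer registers, and arrays of integer cells. -/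
structure Memory where
  reg : ℕ → ℤ
  arr : ℕ → ℤ → ℤ

/-- Arithmetic expressions. `reg x` is the content of register `x`, and `get a e` is the content of
the cell of array `a` whose index is the value of `e` (indirect addressing). -/
inductive Expr where
  | const (n : ℤ)
  | reg (x : ℕ)
  | get (a : ℕ) (e : Expr)
  | add (e f : Expr)
  | sub (e f : Expr)
  | mul (e f : Expr)
  | div (e f : Expr)
  | lt (e f : Expr)
  | eq (e f : Expr)

/-- The value of an expression; comparisons have the value `1` (true) or `0` (false). -/
def Expr.eval (m : Memory) : Expr → ℤ
  | .const n => n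
  | .reg x => m.reg x
  | .get a e => m.arr a (e.eval m)
  | .add e f => e.eval m + f.eval m
  | .sub e f => e.eval m - f.eval m
  | .mul e f => e.eval m * f.eval m
  | .div e f => e.eval m / f.eval m
  | .lt e f => if e.eval m < f.eval m then 1 else 0
  | .eq e f => if e.eval m = f.eval m then 1 else 0

/-- The number of bits of an integer. -/
def bits (n : ℤ) : ℕ := Nat.size n.natAbs

/-- Logarithmic cost of evaluating an expression: every operation, every access to a register and
every access to an array cell is charged one plus the bit length of its value, in addition to the
cost of evaluating its arguments.  So an operation pays for the bits of its operands (or of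
the address) and of its result. -/
def Expr.cost (m : Memory) : Expr → ℕ
  | .const n => 1 + bits n
  | .reg x => 1 + bits (m.reg x)
  | .get a e => e.cost m + 1 + bits (m.arr a (e.eval m))
  | .add e f => e.cost m + f.cost m + 1 + bits (e.eval m + f.eval m)
  | .sub e f => e.cost m + f.cost m + 1 + bits (e.eval m - f.eval m)
  | .mul e f => e.cost m + f.cost m + 1 + bits (e.eval m * f.eval m)
  | .div e f => e.cost m + f.cost m + 1 + bits (e.eval m / f.eval m)
  | .lt e f => e.cost m + f.cost m + 2
  | .eq e f => e.cost m + f.cost m + 2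

/-- Programs. -/
inductive Prog where
  | skip
  /-- write the value of `e` into register `x` -/
  | assign (x : ℕ) (e : Expr)
  /-- write the value of `e` into the cell of array `a` with index the value of `i` -/
  | store (a : ℕ) (i e : Expr)
  | seq (c d : Prog)
  /-- run `c` if the value of `e` is non-zero, and `d` otherwise -/
  | ite (e : Expr) (c d : Prog)
  /-- run `c` as long as the value of `e` is non-zero -/
  | loop (e : Expr) (c : Prog)

/-- The memory after writing `v` into register `x`. -/
def Memory.setReg (m : Memory) (x : ℕ) (v : ℤ) : Memory :=
  { m with reg := Function.update m.reg x v }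

/-- The memory after writing `v` into cell `i` of array `a`. -/
def Memory.setCell (m : Memory) (a : ℕ) (i v : ℤ) : Memory :=
  { m with arr := Function.update m.arr a (Function.update (m.arr a) i v) }

/-- `Runs c m t m'`: started in memory `m`, the program `c` halts in memory `m'`,
at total logarithmic cost `t`. -/
inductive Runs : Prog → Memory → ℕ → Memory → Prop where
  | skip (m : Memory) : Runs .skip m 1 m
  | assign (m : Memory) (x : ℕ) (e : Expr) :
      Runs (.assign x e) m (1 + e.cost m) (m.setReg x (e.eval m))
  | store (m : Memory) (a : ℕ) (i e : Expr) :
      Runs (.store a i e) m (1 + i.cost m + e.cost m) (m.setCell a (i.eval m) (e.eval m))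
  | seq {c d : Prog} {m m' m'' : Memory} {t t' : ℕ} :
      Runs c m t m' → Runs d m' t' m'' → Runs (.seq c d) m (t + t') m''
  | ite_true {e : Expr} {c d : Prog} {m m' : Memory} {t : ℕ} :
      e.eval m ≠ 0 → Runs c m t m' → Runs (.ite e c d) m (1 + e.cost m + t) m'
  | ite_false {e : Expr} {c d : Prog} {m m' : Memory} {t : ℕ} :
      e.eval m = 0 → Runs d m t m' → Runs (.ite e c d) m (1 + e.cost m + t) m'
  | loop_stop {e : Expr} {c : Prog} {m : Memory} :
      e.eval m = 0 → Runs (.loop e c) m (1 + e.cost m) m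
  | loop_step {e : Expr} {c : Prog} {m m' m'' : Memory} {t t' : ℕ} :
      e.eval m ≠ 0 → Runs c m t m' → Runs (.loop e c) m' t' m'' →
        Runs (.loop e c) m (1 + e.cost m + t + t') m''

/-- The initial memory on input `l`: the length of `l` is in register `0`, the entries of `l` are
in the cells `0, 1, 2, …` of array `0`, and everything else is zero. -/
def input (l : List ℕ) : Memory where
  reg := fun x => if x = 0 then (l.length : ℤ) else 0
  arr := fun a i => if a = 0 ∧ 0 ≤ i then ((l.getD i.toNat 0 : ℕ) : ℤ) else 0

/-- The memory `m` presents the output `l`: the length of `l` is in register `0`, and the entries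
of `l` are in the cells `0, 1, 2, …` of array `1`. -/
def HasOutput (m : Memory) (l : List ℕ) : Prop :=
  m.reg 0 = l.length ∧ ∀ (j : ℕ) (h : j < l.length), m.arr 1 j = (l[j] : ℕ)

/-- The number of bits of a list of natural numbers written in binary, with one separator per
entry. -/
def bitLength (l : List ℕ) : ℕ := (l.map fun n => Nat.size n + 1).sum

/-- The search problem "given `a`, find some `b` with `R a b`" is solvable in polynomial time, with
respect to encodings of the instances and of the answers by lists of natural numbers in binary: one
program outputs a correct answer on every instance, and the cost of the run together with the bit
length of the output is bounded by a polynomial in the bit length of the instance. -/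
def PolyTimeSolvable {α : Type} {β : α → Type} (enc : α → List ℕ) (encAns : ∀ a, β a → List ℕ)
    (R : ∀ a, β a → Prop) : Prop :=
  ∃ (prog : Prog) (p : Polynomial ℕ), ∀ a : α, ∃ (b : β a) (t : ℕ) (m : Memory),
    R a b ∧ Runs prog (input (enc a)) t m ∧ HasOutput m (encAns a b) ∧
      t + bitLength (encAns a b) ≤ p.eval (bitLength (enc a))

end RAM

/-! ### The problem 1-UF-WS -/

/-- An instance of 1-UF-WS: distribution of one federated-learning model by unicast with
unsplittable flow over a time-varying graph.  Satellites are `0, …, numSat - 1` and snapshots are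
`0, …, numSnap - 1`, so that the index `k` here is the snapshot with number `k + 1`. -/
structure UFWS where
  /-- number of satellites -/
  numSat : ℕ
  /-- number of snapshots -/
  numSnap : ℕ
  numSnap_pos : 0 < numSnap
  /-- `cap k i j` is the capacity of the arc from satellite `i` to satellite `j` in snapshot `k`,
  and `none` if there is no such arc. A bi-directional link consists of two arcs, whose capacities
  may differ. -/
  cap : Fin numSnap → Fin numSat → Fin numSat → Option NNRat
  /-- the server -/
  server : Fin numSat
  /-- the set of clients -/
  clients : Finset (Fin numSat)
  /-- the size of the model -/
  size : NNRat
  size_pos : 0 < size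
  /-- the weights; only those of clients matter -/
  weight : Fin numSat → NNRat

namespace UFWS

/-- A node of the time-varying graph: the copy of a satellite in a snapshot. -/
abbrev Node (P : UFWS) : Type := Fin P.numSnap × Fin P.numSat

/-- The arcs of the time-varying graph with their capacities: the intra-snapshot arcs, and the
inter-snapshot arcs between consecutive copies of the same satellite, which model caching and have
the capacity `q |C|`. The value is `none` if there is no arc from `u` to `v`. -/
def arcCap (P : UFWS) (u v : P.Node) : Option NNRat :=
  if u.1 = v.1 then P.cap u.1 u.2 v.2
  else if u.2 = v.2 ∧ (u.1 : ℕ) + 1 = v.1 then some (P.size * P.clients.card)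
  else none

/-- The source: the server in the first snapshot. -/
def source (P : UFWS) : P.Node := (⟨0, P.numSnap_pos⟩, P.server)

/-- `r` is a (simple, directed) path in the time-varying graph that leads from the source to the
copy of satellite `c` in some snapshot. -/
def IsRoute (P : UFWS) (c : Fin P.numSat) (r : List P.Node) : Prop :=
  r.head? = some P.source ∧ (∃ k, r.getLast? = some (k, c)) ∧ r.Nodup ∧
    r.IsChain fun u v => (P.arcCap u v).isSome

/-- A routing assigns a list of nodes to every satellite: to a client its path, and the empty list
to a satellite that is not a client. -/
abbrev Routing (P : UFWS) : Type := Fin P.numSat → List P.Node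

/-- The total amount of data that a routing sends over the arc from `u` to `v`: the size of the
model times the number of clients whose path uses the arc. -/
def load (P : UFWS) (r : P.Routing) (u v : P.Node) : NNRat :=
  P.size * (P.clients.filter fun c => (u, v) ∈ (r c).zip (r c).tail).card

/-- Every client gets the entire model on a single path, and the capacities are respected. -/
def IsFeasible (P : UFWS) (r : P.Routing) : Prop :=
  (∀ c ∈ P.clients, P.IsRoute c (r c)) ∧ (∀ c ∉ P.clients, r c = []) ∧
    ∀ u v p, P.arcCap u v = some p → P.load r u v ≤ p

/-- The number (in `1, …, K`) of the snapshot in which a path ends. -/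
def arrival (P : UFWS) (r : List P.Node) : ℕ :=
  match r.getLast? with
  | some v => (v.1 : ℕ) + 1
  | none => 0

/-- The weighted sum of the arrival snapshot numbers over the clients. -/
def objective (P : UFWS) (r : P.Routing) : NNRat :=
  ∑ c ∈ P.clients, P.weight c * P.arrival (r c)

/-- A routing that is feasible and minimizes the objective over all feasible routings. -/
def IsOptimal (P : UFWS) (r : P.Routing) : Prop :=
  P.IsFeasible r ∧ ∀ r', P.IsFeasible r' → P.objective r ≤ P.objective r'

/-- The correct answers: `none` if no routing is feasible, or else an optimal routing. -/
def IsAnswer (P : UFWS) : Option P.Routing → Prop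
  | none => ∀ r, ¬ P.IsFeasible r
  | some r => P.IsOptimal r

/-- A non-negative rational is written as numerator and denominator. -/
def encodeRat (x : NNRat) : List ℕ := [x.num, x.den]

/-- An instance is written as the numbers of satellites and of snapshots, the server, the model
size, a bit and a weight for every satellite, and the capacity matrices of the snapshots
(where `0, 0` stands for a missing arc). -/
def encode (P : UFWS) : List ℕ :=
  [P.numSat, P.numSnap, P.server] ++ encodeRat P.size ++
  ((List.finRange P.numSat).flatMap fun i =>
    if i ∈ P.clients then 1 :: encodeRat (P.weight i) else [0, 0, 0]) ++
  ((List.finRange P.numSnap).flatMap fun k => (List.finRange P.numSat).flatMap fun i =>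
    (List.finRange P.numSat).flatMap fun j =>
      match P.cap k i j with
      | some x => encodeRat x
      | none => [0, 0])

/-- An answer is written as `0` if there is no feasible routing, and otherwise as `1` followed, for
every satellite, by the number of nodes of its path and the nodes themselves. -/
def encodeAnswer (P : UFWS) : Option P.Routing → List ℕ
  | none => [0]
  | some r => 1 :: (List.finRange P.numSat).flatMap fun i =>
      (r i).length :: (r i).flatMap fun v => [(v.1 : ℕ), (v.2 : ℕ)]

end UFWS

/-!
Since every client needs one copy of the model, the whole problem is a single-commodity flow problem
with integral flows. Measured in copies of the model, the capacity of an arc is `⌊p / q⌋`. The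
network has one node for every node of the time-varying graph, a sink for every client `c` that is
entered from all copies of `c`, at cost `w_c k` from the copy in snapshot `k` (scaled to an integer
by the product of the denominators of the weights), and a super source that is joined to the server
at cost zero and to all other nodes at the cost `bigCost`, which exceeds the objective value of
every routing. A flow that sends one unit to each sink decomposes into simple paths, and these are a
routing unless an artificial arc is used, while a routing is such a flow of cost equal to its
objective value. So a flow of minimum cost either yields an optimal routing
(`UFWS.IsDecomposition.exists_isOptimal`) or, when it uses an artificial arc, shows that there is
none (`UFWS.IsOptimalResidual.not_isFeasible`).

The flow is computed by successive shortest paths: one augmentation per client, along a shortest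
path for the reduced costs, found by Dijkstra's algorithm on the matrix of all arc lengths. The
invariant is that the potentials make all residual reduced costs non-negative
(`RAM.ResidualInv.augment`), which implies optimality by complementary slackness
(`RAM.ResidualInv.cost_le`). The artificial arcs guarantee that an augmenting path always exists.
A flow is represented by its residual capacities, so pushing flow along a path adds a signed
indicator (`RAM.pathFlow`). The same program for shortest paths, run on the support of the flow,
splits off one path for every client (`RAM.DecompInv.step`).

For the cost of the machine it suffices to bound the number of elementary steps. In every product of
the program the right factor is a polynomial in entries of the input, so that one step lengthens
the numbers in memory by at most a fixed multiple of the bit length of the input, and the logarithmic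
cost is polynomial in the number of steps (`RAM.Steps.runs`). The step bounds are
derived with a program logic for total correctness (`RAM.Wp`).
-/

/-! ### Step counts, bit growth and program logic for the random-access machine -/

namespace RAM

/-- `Steps c m s m'`: started in `m`, the program `c` halts in `m'` after `s` elementary steps
(unit cost). -/
inductive Steps : Prog → Memory → ℕ → Memory → Prop where
  | skip (m : Memory) : Steps .skip m 1 m
  | assign (m : Memory) (x : ℕ) (e : Expr) : Steps (.assign x e) m 1 (m.setReg x (e.eval m))
  | store (m : Memory) (a : ℕ) (i e : Expr) :
      Steps (.store a i e) m 1 (m.setCell a (i.eval m) (e.eval m))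
  | seq {c d : Prog} {m m' m'' : Memory} {s s' : ℕ} :
      Steps c m s m' → Steps d m' s' m'' → Steps (.seq c d) m (s + s') m''
  | ite_true {e : Expr} {c d : Prog} {m m' : Memory} {s : ℕ} :
      e.eval m ≠ 0 → Steps c m s m' → Steps (.ite e c d) m (1 + s) m'
  | ite_false {e : Expr} {c d : Prog} {m m' : Memory} {s : ℕ} :
      e.eval m = 0 → Steps d m s m' → Steps (.ite e c d) m (1 + s) m'
  | loop_exit {e : Expr} {c : Prog} {m : Memory} : e.eval m = 0 → Steps (.loop e c) m 1 m
  | loop_step {e : Expr} {c : Prog} {m m' m'' : Memory} {s s' : ℕ} :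
      e.eval m ≠ 0 → Steps c m s m' → Steps (.loop e c) m' s' m'' →
        Steps (.loop e c) m (1 + s + s') m''

/-- An expression whose value has a bit length bounded in terms of the entries of the input array
`0` alone. -/
def Expr.InputBounded : Expr → Bool
  | .const _ => true
  | .get a _ => a == 0
  | .add e f => e.InputBounded && f.InputBounded
  | .mul e f => e.InputBounded && f.InputBounded
  | _ => false

/-- In every product the right factor is input-bounded, so that evaluating the expression
lengthens the numbers only by a multiple of the input length. -/
def Expr.Tame : Expr → Bool
  | .const _ => true
  | .reg _ => true
  | .get _ e => e.Tame
  | .mul e f => e.Tame && f.Tame && f.InputBounded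
  | .add e f => e.Tame && f.Tame
  | .sub e f => e.Tame && f.Tame
  | .div e f => e.Tame && f.Tame
  | .lt e f => e.Tame && f.Tame
  | .eq e f => e.Tame && f.Tame

/-- The size of an expression, counting its constants with their bit lengths. -/
def Expr.weight : Expr → ℕ
  | .const n => 1 + bits n
  | .reg _ => 1
  | .get _ e => 1 + e.weight
  | .mul e f => e.weight + f.weight + 1
  | .add e f => e.weight + f.weight + 1
  | .sub e f => e.weight + f.weight + 1
  | .div e f => e.weight + f.weight + 1
  | .lt e f => e.weight + f.weight + 1
  | .eq e f => e.weight + f.weight + 1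

/-- All expressions of the program are tame and the input array `0` is never written. -/
def Prog.Tame : Prog → Bool
  | .skip => true
  | .assign _ e => e.Tame
  | .store a i e => i.Tame && e.Tame && a != 0
  | .seq c d => c.Tame && d.Tame
  | .ite e c d => e.Tame && c.Tame && d.Tame
  | .loop e c => e.Tame && c.Tame

/-- The total size of the expressions of a program. -/
def Prog.weight : Prog → ℕ
  | .skip => 1
  | .assign _ e => 1 + e.weight
  | .store _ i e => 1 + i.weight + e.weight
  | .seq c d => c.weight + d.weight
  | .ite e c d => 1 + e.weight + c.weight + d.weight
  | .loop e c => 1 + e.weight + c.weight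

/-- All numbers in the memory have at most `B` bits, those in the input array at most `b` bits. -/
structure Memory.BitBounded (m : Memory) (b B : ℕ) : Prop where
  reg : ∀ x, bits (m.reg x) ≤ B
  arr : ∀ a i, bits (m.arr a i) ≤ B
  inp : ∀ i, bits (m.arr 0 i) ≤ b

theorem bits_le_iff {n : ℤ} {k : ℕ} : bits n ≤ k ↔ n.natAbs < 2 ^ k := Nat.size_le

theorem lt_two_pow_bits (n : ℤ) : n.natAbs < 2 ^ bits n := Nat.lt_size_self _

theorem bits_add_le (x y : ℤ) : bits (x + y) ≤ max (bits x) (bits y) + 1 := by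
  rw [bits_le_iff, pow_succ]
  have hx := (lt_two_pow_bits x).trans_le
    (Nat.pow_le_pow_right two_pos (le_max_left (bits x) (bits y)))
  have hy := (lt_two_pow_bits y).trans_le
    (Nat.pow_le_pow_right two_pos (le_max_right (bits x) (bits y)))
  have := Int.natAbs_add_le x y
  omega

theorem bits_neg (x : ℤ) : bits (-x) = bits x := by simp [bits]

theorem bits_sub_le (x y : ℤ) : bits (x - y) ≤ max (bits x) (bits y) + 1 := by
  simpa [sub_eq_add_neg, bits_neg] using bits_add_le x (-y)

theorem bits_mul_le (x y : ℤ) : bits (x * y) ≤ bits x + bits y := by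
  rw [bits_le_iff, pow_add, Int.natAbs_mul]
  exact Nat.mul_lt_mul'' (lt_two_pow_bits x) (lt_two_pow_bits y)

theorem bits_div_le (x y : ℤ) : bits (x / y) ≤ bits x :=
  Nat.size_le_size (Int.natAbs_ediv_le_natAbs x y)

theorem Expr.bits_eval_le_of_inputBounded {m : Memory} {b B : ℕ} (hm : m.BitBounded b B) :
    ∀ {e : Expr}, e.InputBounded → bits (e.eval m) ≤ e.weight * (b + 1)
  | .const n, _ => by simp only [eval, weight]; nlinarith
  | .get a e, h => by
      simp only [InputBounded, beq_iff_eq] at h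
      subst h
      have := hm.inp (e.eval m)
      simp only [eval, weight]; nlinarith
  | .add e f, h => by
      simp only [InputBounded, Bool.and_eq_true] at h
      have h1 := bits_eval_le_of_inputBounded hm h.1
      have h2 := bits_eval_le_of_inputBounded hm h.2
      have h3 := bits_add_le (e.eval m) (f.eval m)
      simp only [eval, weight]
      have : (e.weight + f.weight + 1) * (b + 1)
        = e.weight * (b + 1) + f.weight * (b + 1) + (b + 1) := by ring
      omega
  | .mul e f, h => by
      simp only [InputBounded, Bool.and_eq_true] at h
      have h1 := bits_eval_le_of_inputBounded hm h.1
      have h2 := bits_eval_le_of_inputBounded hm h.2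
      have h3 := bits_mul_le (e.eval m) (f.eval m)
      simp only [eval, weight]
      have : (e.weight + f.weight + 1) * (b + 1)
        = e.weight * (b + 1) + f.weight * (b + 1) + (b + 1) := by ring
      omega

theorem bits_ite_one_zero_le (p : Prop) [Decidable p] : bits (if p then 1 else 0) ≤ 1 := by
  split_ifs <;> simp [bits]

theorem Expr.bits_eval_le {m : Memory} {b B : ℕ} (hm : m.BitBounded b B) :
    ∀ {e : Expr}, e.Tame → bits (e.eval m) ≤ B + e.weight * (b + 1)
  | .const n, _ => by simp only [eval, weight]; nlinarith
  | .reg x, _ => (hm.reg x).trans (Nat.le_add_right _ _)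
  | .get a e, _ => (hm.arr a _).trans (Nat.le_add_right _ _)
  | .add e f, h => by
      simp only [Tame, Bool.and_eq_true] at h
      have h1 := bits_eval_le hm h.1
      have h2 := bits_eval_le hm h.2
      have h3 := bits_add_le (e.eval m) (f.eval m)
      simp only [eval, weight]
      have : (e.weight + f.weight + 1) * (b + 1)
        = e.weight * (b + 1) + f.weight * (b + 1) + (b + 1) := by ring
      omega
  | .sub e f, h => by
      simp only [Tame, Bool.and_eq_true] at h
      have h1 := bits_eval_le hm h.1
      have h2 := bits_eval_le hm h.2
      have h3 := bits_sub_le (e.eval m) (f.eval m)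
      simp only [eval, weight]
      have : (e.weight + f.weight + 1) * (b + 1)
        = e.weight * (b + 1) + f.weight * (b + 1) + (b + 1) := by ring
      omega
  | .mul e f, h => by
      simp only [Tame, Bool.and_eq_true] at h
      have h1 := bits_eval_le hm h.1.1
      have h2 := bits_eval_le_of_inputBounded hm h.2
      have h3 := bits_mul_le (e.eval m) (f.eval m)
      simp only [eval, weight]
      have : (e.weight + f.weight + 1) * (b + 1)
        = e.weight * (b + 1) + f.weight * (b + 1) + (b + 1) := by ring
      omega
  | .div e f, h => by
      simp only [Tame, Bool.and_eq_true] at h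
      have h1 := bits_eval_le hm h.1
      have h3 := bits_div_le (e.eval m) (f.eval m)
      simp only [eval, weight]
      have : (e.weight + f.weight + 1) * (b + 1)
        = e.weight * (b + 1) + f.weight * (b + 1) + (b + 1) := by ring
      omega
  | .lt e f, _ => by
      have := bits_ite_one_zero_le (e.eval m < f.eval m)
      simp only [eval, weight]; nlinarith
  | .eq e f, _ => by
      have := bits_ite_one_zero_le (e.eval m = f.eval m)
      simp only [eval, weight]; nlinarith

theorem Expr.cost_le {m : Memory} {b B w : ℕ} (hm : m.BitBounded b B) :
    ∀ {e : Expr}, e.Tame → e.weight ≤ w → e.cost m ≤ e.weight * (B + w * (b + 1) + 2) := by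
  intro e he hw
  have key : ∀ {e : Expr}, e.Tame → e.weight ≤ w → bits (e.eval m) ≤ B + w * (b + 1) :=
    fun he hw => (bits_eval_le hm he).trans (by gcongr)
  have hb := key he hw
  induction e with
  | const n => simp only [cost, weight, eval] at *; nlinarith
  | reg x => simp only [cost, weight, eval] at *; omega
  | get a e ih =>
      simp only [Tame, cost, weight, eval] at *
      have := ih he (by omega) (key he (by omega))
      rw [add_mul]; omega
  | add e f ihe ihf | sub e f ihe ihf | div e f ihe ihf | lt e f ihe ihf | eq e f ihe ihf =>
      simp only [Tame, Bool.and_eq_true, cost, weight, eval] at *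
      have h1 := ihe he.1 (by omega) (key he.1 (by omega))
      have h2 := ihf he.2 (by omega) (key he.2 (by omega))
      rw [add_mul, add_mul]; omega
  | mul e f ihe ihf =>
      simp only [Tame, Bool.and_eq_true, cost, weight, eval] at *
      have h1 := ihe he.1.1 (by omega) (key he.1.1 (by omega))
      have h2 := ihf he.1.2 (by omega) (key he.1.2 (by omega))
      rw [add_mul, add_mul]; omega

theorem Memory.BitBounded.mono {m : Memory} {b B B' : ℕ} (h : m.BitBounded b B) (hB : B ≤ B') :
    m.BitBounded b B' :=
  ⟨fun x => (h.reg x).trans hB, fun a i => (h.arr a i).trans hB, h.inp⟩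

theorem Memory.BitBounded.setReg {m : Memory} {b B : ℕ} (h : m.BitBounded b B) {x : ℕ} {v : ℤ}
    (hv : bits v ≤ B) : (m.setReg x v).BitBounded b B := by
  refine ⟨fun y => ?_, h.arr, h.inp⟩
  by_cases hy : y = x
  · subst hy; simpa [Memory.setReg] using hv
  · simpa [Memory.setReg, hy] using h.reg y

theorem Memory.BitBounded.setCell {m : Memory} {b B : ℕ} (h : m.BitBounded b B) {a : ℕ} {i v : ℤ}
    (ha : a ≠ 0) (hv : bits v ≤ B) : (m.setCell a i v).BitBounded b B := by
  refine ⟨h.reg, fun c j => ?_, fun j => ?_⟩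
  · by_cases hc : c = a
    · subst hc
      by_cases hj : j = i
      · subst hj; simpa [Memory.setCell] using hv
      · simpa [Memory.setCell, hj] using h.arr c j
    · simpa [Memory.setCell, hc] using h.arr c j
  · simpa [Memory.setCell, ha.symm] using h.inp j

/-- A tame program lengthens the numbers in memory by a bounded amount in every step, so its
logarithmic cost is polynomial in its number of steps and the input length. -/
theorem Steps.runs {c : Prog} {m m' : Memory} {s : ℕ} (h : Steps c m s m') {b w : ℕ} :
    ∀ {B : ℕ}, c.Tame → c.weight ≤ w → m.BitBounded b B →
      m'.BitBounded b (B + s * (w * (b + 1))) ∧ ∀ Z, B + s * (w * (b + 1)) ≤ Z →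
        ∃ t, Runs c m t m' ∧ t ≤ s * (w * (Z + w * (b + 1) + 2)) := by
  have hcost : ∀ {e : Expr} {m : Memory} {B Z : ℕ}, e.Tame → e.weight ≤ w → m.BitBounded b B →
      B ≤ Z → e.cost m ≤ e.weight * (Z + w * (b + 1) + 2) := fun he hw hm hZ =>
    (Expr.cost_le hm he hw).trans (by gcongr)
  have hval : ∀ {e : Expr} {m : Memory} {B : ℕ}, e.Tame → e.weight ≤ w → m.BitBounded b B →
      bits (e.eval m) ≤ B + 1 * (w * (b + 1)) := fun he hw hm =>
    (Expr.bits_eval_le hm he).trans (by rw [one_mul]; gcongr)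
  -- one elementary step is paid for by the weights of its expressions
  have hstep : ∀ {k Z : ℕ}, 1 + k ≤ w →
      1 + k * (Z + w * (b + 1) + 2) ≤ w * (Z + w * (b + 1) + 2) := by
    intro k Z hk
    calc 1 + k * (Z + w * (b + 1) + 2) ≤ (1 + k) * (Z + w * (b + 1) + 2) := by
          rw [add_mul]; omega
      _ ≤ _ := by gcongr
  induction h with
  | skip m =>
      intro B _ hw hm
      refine ⟨hm.mono (Nat.le_add_right _ _), fun Z _ => ⟨1, Runs.skip m, ?_⟩⟩
      have := hstep (k := 0) (Z := Z) (by simpa [Prog.weight] using hw)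
      omega
  | assign m x e =>
      intro B hc hw hm
      simp only [Prog.Tame, Prog.weight] at hc hw
      refine ⟨(hm.mono (Nat.le_add_right _ _)).setReg (hval hc (by omega) hm),
        fun Z hZ => ⟨_, Runs.assign m x e, ?_⟩⟩
      have h1 := hcost (Z := Z) hc (by omega) hm (by omega)
      have := hstep (k := e.weight) (Z := Z) hw
      omega
  | store m a i e =>
      intro B hc hw hm
      simp only [Prog.Tame, Prog.weight, Bool.and_eq_true, bne_iff_ne, ne_eq] at hc hw
      refine ⟨(hm.mono (Nat.le_add_right _ _)).setCell hc.2 (hval hc.1.2 (by omega) hm),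
        fun Z hZ => ⟨_, Runs.store m a i e, ?_⟩⟩
      have h1 := hcost (Z := Z) hc.1.1 (by omega) hm (by omega)
      have h2 := hcost (Z := Z) hc.1.2 (by omega) hm (by omega)
      have := hstep (k := i.weight + e.weight) (Z := Z) (by omega)
      rw [add_mul] at this
      omega
  | @seq c d m m' m'' s s' _ _ ih1 ih2 =>
      intro B hc hw hm
      simp only [Prog.Tame, Prog.weight, Bool.and_eq_true] at hc hw
      obtain ⟨hm1, h1⟩ := ih1 hc.1 (by omega) hm
      obtain ⟨hm2, h2⟩ := ih2 hc.2 (by omega) hm1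
      have e1 : B + (s + s') * (w * (b + 1)) = B + s * (w * (b + 1)) + s' * (w * (b + 1)) := by
        ring
      rw [e1]
      refine ⟨hm2, fun Z hZ => ?_⟩
      obtain ⟨t1, r1, b1⟩ := h1 Z (by omega)
      obtain ⟨t2, r2, b2⟩ := h2 Z hZ
      exact ⟨_, r1.seq r2, by rw [add_mul]; omega⟩
  | @ite_true e c d m m' s he _ ih =>
      intro B hc hw hm
      simp only [Prog.Tame, Prog.weight, Bool.and_eq_true] at hc hw
      obtain ⟨hm1, h1⟩ := ih hc.1.2 (by omega) hm
      rw [add_mul 1 s]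
      refine ⟨hm1.mono (by omega), fun Z hZ => ?_⟩
      obtain ⟨t1, r1, b1⟩ := h1 Z (by omega)
      refine ⟨_, Runs.ite_true he r1, ?_⟩
      have h1 := hcost (Z := Z) hc.1.1 (by omega) hm (by omega)
      have := hstep (k := e.weight) (Z := Z) (by omega)
      rw [add_mul]; omega
  | @ite_false e c d m m' s he _ ih =>
      intro B hc hw hm
      simp only [Prog.Tame, Prog.weight, Bool.and_eq_true] at hc hw
      obtain ⟨hm1, h1⟩ := ih hc.2 (by omega) hm
      rw [add_mul 1 s]
      refine ⟨hm1.mono (by omega), fun Z hZ => ?_⟩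
      obtain ⟨t1, r1, b1⟩ := h1 Z (by omega)
      refine ⟨_, Runs.ite_false he r1, ?_⟩
      have h1 := hcost (Z := Z) hc.1.1 (by omega) hm (by omega)
      have := hstep (k := e.weight) (Z := Z) (by omega)
      rw [add_mul]; omega
  | @loop_exit e c m he =>
      intro B hc hw hm
      simp only [Prog.Tame, Prog.weight, Bool.and_eq_true] at hc hw
      refine ⟨hm.mono (Nat.le_add_right _ _), fun Z hZ => ⟨_, Runs.loop_stop he, ?_⟩⟩
      have h1 := hcost (Z := Z) hc.1 (by omega) hm (by omega)
      have := hstep (k := e.weight) (Z := Z) (by omega)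
      omega
  | @loop_step e c m m' m'' s s' he _ _ ih1 ih2 =>
      intro B hc hw hm
      have hc' := hc
      have hw' := hw
      simp only [Prog.Tame, Prog.weight, Bool.and_eq_true] at hc hw
      obtain ⟨hm1, h1⟩ := ih1 hc.2 (by omega) hm
      obtain ⟨hm2, h2⟩ := ih2 hc' hw' hm1
      have e1 : B + (1 + s + s') * (w * (b + 1))
          = B + s * (w * (b + 1)) + s' * (w * (b + 1)) + w * (b + 1) := by ring
      rw [e1]
      refine ⟨hm2.mono (by omega), fun Z hZ => ?_⟩
      obtain ⟨t1, r1, b1⟩ := h1 Z (by omega)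
      obtain ⟨t2, r2, b2⟩ := h2 Z (by omega)
      refine ⟨_, Runs.loop_step he r1 r2, ?_⟩
      have h1 := hcost (Z := Z) hc.1 (by omega) hm (by omega)
      have := hstep (k := e.weight) (Z := Z) (by omega)
      rw [add_mul, add_mul]; omega

/-- The registers that a program may write. -/
def Prog.regs : Prog → List ℕ
  | .skip => []
  | .assign x _ => [x]
  | .store _ _ _ => []
  | .seq c d => c.regs ++ d.regs
  | .ite _ c d => c.regs ++ d.regs
  | .loop _ c => c.regs

/-- The arrays that a program may write. -/
def Prog.arrs : Prog → List ℕ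
  | .skip => []
  | .assign _ _ => []
  | .store a _ _ => [a]
  | .seq c d => c.arrs ++ d.arrs
  | .ite _ c d => c.arrs ++ d.arrs
  | .loop _ c => c.arrs

/-- Two memories agree outside the registers in `X` and the arrays in `Y`. -/
structure Agree (X Y : List ℕ) (m m' : Memory) : Prop where
  reg : ∀ x, x ∉ X → m'.reg x = m.reg x
  arr : ∀ a, a ∉ Y → m'.arr a = m.arr a

theorem Agree.refl (X Y : List ℕ) (m : Memory) : Agree X Y m m := ⟨fun _ _ => rfl, fun _ _ => rfl⟩

theorem Agree.trans {X Y : List ℕ} {m m' m'' : Memory} (h : Agree X Y m m')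
    (h' : Agree X Y m' m'') : Agree X Y m m'' :=
  ⟨fun x hx => (h'.reg x hx).trans (h.reg x hx), fun a ha => (h'.arr a ha).trans (h.arr a ha)⟩

theorem Agree.mono {X X' Y Y' : List ℕ} {m m' : Memory} (h : Agree X Y m m') (hX : X ⊆ X')
    (hY : Y ⊆ Y') : Agree X' Y' m m' :=
  ⟨fun x hx => h.reg x fun h' => hx (hX h'), fun a ha => h.arr a fun h' => ha (hY h')⟩

@[simp] theorem Memory.reg_setReg (m : Memory) (x y : ℕ) (v : ℤ) :
    (m.setReg x v).reg y = if y = x then v else m.reg y := by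
  simp [Memory.setReg, Function.update_apply]

@[simp] theorem Memory.arr_setReg (m : Memory) (x : ℕ) (v : ℤ) : (m.setReg x v).arr = m.arr := rfl

@[simp] theorem Memory.reg_setCell (m : Memory) (a : ℕ) (i v : ℤ) :
    (m.setCell a i v).reg = m.reg := rfl

@[simp] theorem Memory.arr_setCell (m : Memory) (a b : ℕ) (i v : ℤ) :
    (m.setCell a i v).arr b = if b = a then Function.update (m.arr b) i v else m.arr b := by
  by_cases h : b = a
  · subst h; simp [Memory.setCell]
  · simp [Memory.setCell, h]

theorem Steps.agree {c : Prog} {m m' : Memory} {s : ℕ} (h : Steps c m s m') :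
    Agree c.regs c.arrs m m' := by
  induction h with
  | skip m => exact Agree.refl _ _ _
  | assign m x e => exact ⟨fun y hy => by simp_all [Prog.regs], fun a _ => rfl⟩
  | store m a i e => exact ⟨fun y _ => rfl, fun b hb => by simp_all [Prog.arrs]⟩
  | seq _ _ ih1 ih2 =>
      exact (ih1.mono (by simp [Prog.regs]) (by simp [Prog.arrs])).trans
        (ih2.mono (by simp [Prog.regs]) (by simp [Prog.arrs]))
  | ite_true _ _ ih => exact ih.mono (by simp [Prog.regs]) (by simp [Prog.arrs])
  | ite_false _ _ ih => exact ih.mono (by simp [Prog.regs]) (by simp [Prog.arrs])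
  | loop_exit _ => exact Agree.refl _ _ _
  | loop_step _ _ _ ih1 ih2 => exact Agree.trans ih1 ih2

/-- Total correctness with a step bound: started in `m`, the program `c` halts within `T` steps in
a memory that satisfies `Q`. -/
def Wp (c : Prog) (T : ℕ) (m : Memory) (Q : Memory → Prop) : Prop :=
  ∃ s m', Steps c m s m' ∧ s ≤ T ∧ Q m'

namespace Wp

variable {c d : Prog} {T T' : ℕ} {m : Memory} {Q Q' : Memory → Prop} {e i : Expr} {x a : ℕ}

theorem mono (h : Wp c T m Q) (hT : T ≤ T') (hQ : ∀ m', Agree c.regs c.arrs m m' → Q m' → Q' m') :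
    Wp c T' m Q' := by
  obtain ⟨s, m', h1, h2, h3⟩ := h
  exact ⟨s, m', h1, h2.trans hT, hQ m' h1.agree h3⟩

theorem skip (h : Q m) : Wp .skip 1 m Q := ⟨1, m, .skip m, le_rfl, h⟩

theorem assign (h : Q (m.setReg x (e.eval m))) : Wp (.assign x e) 1 m Q :=
  ⟨1, _, .assign m x e, le_rfl, h⟩

theorem store (h : Q (m.setCell a (i.eval m) (e.eval m))) : Wp (.store a i e) 1 m Q :=
  ⟨1, _, .store m a i e, le_rfl, h⟩

theorem seq (h : Wp c T m fun m' => Agree c.regs c.arrs m m' → Wp d T' m' Q) :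
    Wp (.seq c d) (T + T') m Q := by
  obtain ⟨s, m', h1, h2, h3⟩ := h
  obtain ⟨s', m'', h1', h2', h3'⟩ := h3 h1.agree
  exact ⟨s + s', m'', h1.seq h1', by omega, h3'⟩

theorem assign_seq (h : Wp d T (m.setReg x (e.eval m)) Q) :
    Wp (.seq (.assign x e) d) (T + 1) m Q := by
  obtain ⟨s, m', h1, h2, h3⟩ := h
  exact ⟨1 + s, m', (Steps.assign m x e).seq h1, by omega, h3⟩

theorem store_seq (h : Wp d T (m.setCell a (i.eval m) (e.eval m)) Q) :
    Wp (.seq (.store a i e) d) (T + 1) m Q := by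
  obtain ⟨s, m', h1, h2, h3⟩ := h
  exact ⟨1 + s, m', (Steps.store m a i e).seq h1, by omega, h3⟩

theorem ite (h1 : e.eval m ≠ 0 → Wp c T m Q) (h2 : e.eval m = 0 → Wp d T m Q) :
    Wp (.ite e c d) (T + 1) m Q := by
  by_cases h : e.eval m = 0
  · obtain ⟨s, m', k1, k2, k3⟩ := h2 h
    exact ⟨1 + s, m', .ite_false h k1, by omega, k3⟩
  · obtain ⟨s, m', k1, k2, k3⟩ := h1 h
    exact ⟨1 + s, m', .ite_true h k1, by omega, k3⟩

theorem loop_exit (h : e.eval m = 0) (hQ : Q m) : Wp (.loop e c) 1 m Q :=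
  ⟨1, m, .loop_exit h, le_rfl, hQ⟩

theorem loop_step (h : e.eval m ≠ 0) (hc : Wp c T m fun m' => Wp (.loop e c) T' m' Q) :
    Wp (.loop e c) (T + T' + 1) m Q := by
  obtain ⟨s, m', h1, h2, s', m'', h1', h2', h3'⟩ := hc
  exact ⟨1 + s + s', m'', .loop_step h h1 h1', by omega, h3'⟩

end Wp

/-- The loop `for x = 0, 1, …, e - 1 do c`. -/
def Prog.forLoop (x : ℕ) (e : Expr) (c : Prog) : Prog :=
  .seq (.assign x (.const 0)) (.loop (.lt (.reg x) e)
    (.seq c (.assign x (.add (.reg x) (.const 1)))))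

/-- The invariant rule for counting loops: the invariant may not mention the loop variable, and the
bound may depend only on what the body does not write. -/
theorem Wp.forLoop {c : Prog} {T n x : ℕ} {e : Expr} {m : Memory} {Q : Memory → Prop}
    (I : ℕ → Memory → Prop) (hx : x ∉ c.regs) (hI : ∀ i m v, I i m → I i (m.setReg x v))
    (he : ∀ m', Agree (x :: c.regs) c.arrs m m' → e.eval m' = n) (h0 : I 0 m)
    (hs : ∀ i < n, ∀ m', Agree (x :: c.regs) c.arrs m m' → m'.reg x = i → I i m' →
      Wp c T m' (I (i + 1)))
    (hQ : ∀ m', Agree (x :: c.regs) c.arrs m m' → I n m' → Q m') :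
    Wp (.forLoop x e c) (n * (T + 2) + 2) m Q := by
  have hset : ∀ (m' : Memory) v, Agree (x :: c.regs) c.arrs m m' →
      Agree (x :: c.regs) c.arrs m (m'.setReg x v) := fun m' v h =>
    ⟨fun y hy => by simpa [show y ≠ x from fun h' => hy (by simp [h'])] using h.reg y hy, h.arr⟩
  have main : ∀ k i m', i + k = n → Agree (x :: c.regs) c.arrs m m' → m'.reg x = i → I i m' →
      Wp (.loop (.lt (.reg x) e) (.seq c (.assign x (.add (.reg x) (.const 1)))))
        (k * (T + 2) + 1) m' Q := by
    intro k
    induction k with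
    | zero =>
        intro i m' hi ha hr h
        obtain rfl : i = n := by omega
        refine (loop_exit ?_ (hQ m' ha h)).mono (by omega) (fun _ _ h => h)
        simp [Expr.eval, he m' ha, hr]
    | succ k ih =>
        intro i m' hi ha hr h
        have hlt : i < n := by omega
        refine (loop_step (T := T + 1) (T' := k * (T + 2) + 1) ?_ ?_).mono (by
          rw [add_mul]; omega) (fun _ _ h => h)
        · simp [Expr.eval, he m' ha, hr, hlt]
        · refine seq ((hs i hlt m' ha hr h).mono le_rfl ?_)
          intro m'' ha' h' _
          refine assign ?_
          have hr' : m''.reg x = i := (ha'.reg x hx).trans hr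
          refine ih (i + 1) _ (by omega) (hset _ _ (ha.trans (ha'.mono (by simp) (by simp)))) ?_
            (hI _ _ _ h')
          simp [Expr.eval, hr']
  refine (assign_seq (main n 0 _ (by omega) (hset _ _ (Agree.refl _ _ _)) ?_ (hI _ _ _ h0)))
  simp [Expr.eval]

end RAM

/-! ### Shortest-path trees by Dijkstra's algorithm on a dense matrix -/

namespace RAM

infixr:30 " ⨾ " => Prog.seq

instance : Add Expr := ⟨Expr.add⟩
instance : Sub Expr := ⟨Expr.sub⟩
instance : Mul Expr := ⟨Expr.mul⟩
instance : Div Expr := ⟨Expr.div⟩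

namespace Expr

@[simp] theorem eval_const (m : Memory) (n : ℤ) : (Expr.const n).eval m = n := rfl
@[simp] theorem eval_reg (m : Memory) (x : ℕ) : (Expr.reg x).eval m = m.reg x := rfl
@[simp] theorem eval_get (m : Memory) (a : ℕ) (e : Expr) :
    (Expr.get a e).eval m = m.arr a (e.eval m) := rfl
@[simp] theorem eval_add (m : Memory) (e f : Expr) : (e + f).eval m = e.eval m + f.eval m := rfl
@[simp] theorem eval_sub (m : Memory) (e f : Expr) : (e - f).eval m = e.eval m - f.eval m := rfl
@[simp] theorem eval_mul (m : Memory) (e f : Expr) : (e * f).eval m = e.eval m * f.eval m := rfl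
@[simp] theorem eval_div (m : Memory) (e f : Expr) : (e / f).eval m = e.eval m / f.eval m := rfl
@[simp] theorem eval_lt (m : Memory) (e f : Expr) :
    (Expr.lt e f).eval m = if e.eval m < f.eval m then 1 else 0 := rfl
@[simp] theorem eval_eq (m : Memory) (e f : Expr) :
    (Expr.eq e f).eval m = if e.eval m = f.eval m then 1 else 0 := rfl

theorem eval_lt_ne_zero {m : Memory} {e f : Expr} :
    (Expr.lt e f).eval m ≠ 0 ↔ e.eval m < f.eval m := by simp

theorem eval_lt_eq_zero {m : Memory} {e f : Expr} :
    (Expr.lt e f).eval m = 0 ↔ f.eval m ≤ e.eval m := by simp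

theorem eval_eq_ne_zero {m : Memory} {e f : Expr} :
    (Expr.eq e f).eval m ≠ 0 ↔ e.eval m = f.eval m := by simp

theorem eval_eq_eq_zero {m : Memory} {e f : Expr} :
    (Expr.eq e f).eval m = 0 ↔ e.eval m ≠ f.eval m := by simp

end Expr

/- Registers: number of clients, common denominator, big cost, loop variables (client, satellite,
snapshot, row, column, round), selected node, root of the tree, current node of the trace, output
position, start of the current route. -/
notation "rCount" => (1 : ℕ)
notation "rDenom" => (2 : ℕ)
notation "rBig" => (3 : ℕ)
notation "rClient" => (4 : ℕ)
notation "rSat" => (5 : ℕ)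
notation "rSnap" => (6 : ℕ)
notation "rRow" => (7 : ℕ)
notation "rCol" => (8 : ℕ)
notation "rRound" => (9 : ℕ)
notation "rNode" => (10 : ℕ)
notation "rRoot" => (11 : ℕ)
notation "rCur" => (12 : ℕ)
notation "rPos" => (13 : ℕ)
notation "rStart" => (14 : ℕ)

/- Arrays: output, capacities, costs, residual capacities, arc lengths, potentials, distances,
predecessors, stamps, accumulated weights. -/
notation "aOut" => (1 : ℕ)
notation "aCap" => (2 : ℕ)
notation "aCost" => (3 : ℕ)
notation "aRes" => (4 : ℕ)
notation "aLen" => (5 : ℕ)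
notation "aPot" => (6 : ℕ)
notation "aDist" => (7 : ℕ)
notation "aPred" => (8 : ℕ)
notation "aStamp" => (9 : ℕ)
notation "aWeight" => (10 : ℕ)

/-- The number of satellites, read from the input. -/
def satE : Expr := .get 0 (.const 0)
/-- The number of snapshots, read from the input. -/
def snapE : Expr := .get 0 (.const 1)
/-- The index of the super source. -/
def superE : Expr := (snapE + .const 1) * satE
/-- The number of nodes of the flow network. -/
def nodesE : Expr := superE + .const 1

/-- The entry of the square matrix stored in array `a` in the row `u` and the column `v`. -/
def entry (a : ℕ) (u v : Expr) : Expr := .get a (u * nodesE + v)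

/-- Writes an entry of the square matrix stored in array `a`. -/
def setEntry (a : ℕ) (u v e : Expr) : Prog := .store a (u * nodesE + v) e

/-- The number of nodes of the flow network, as determined by the input array. -/
def Memory.nodes (m : Memory) : ℤ := (m.arr 0 1 + 1) * m.arr 0 0 + 1

@[simp] theorem eval_satE (m : Memory) : satE.eval m = m.arr 0 0 := rfl
@[simp] theorem eval_snapE (m : Memory) : snapE.eval m = m.arr 0 1 := rfl
@[simp] theorem eval_superE (m : Memory) : superE.eval m = (m.arr 0 1 + 1) * m.arr 0 0 := rfl
@[simp] theorem eval_nodesE (m : Memory) : nodesE.eval m = m.nodes := rfl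
@[simp] theorem nodes_setReg (m : Memory) (x : ℕ) (v : ℤ) : (m.setReg x v).nodes = m.nodes := rfl

theorem nodes_setCell (m : Memory) {a : ℕ} (h : a ≠ 0) (i v : ℤ) :
    (m.setCell a i v).nodes = m.nodes := by
  simp [Memory.nodes, h.symm]

theorem Agree.nodes {X Y : List ℕ} {m m' : Memory} (h : Agree X Y m m') (hY : 0 ∉ Y) :
    m'.nodes = m.nodes := by
  simp [Memory.nodes, h.arr 0 hY]

/-- The square matrix of size `N` that is stored row by row in `f`. -/
def mat (N : ℤ) (f : ℤ → ℤ) (u v : ℤ) : ℤ := f (u * N + v)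

theorem index_inj {N u v u' v' : ℤ} (hv : 0 ≤ v) (hvN : v < N) (hv' : 0 ≤ v') (hvN' : v' < N) :
    u * N + v = u' * N + v' ↔ u = u' ∧ v = v' := by
  constructor
  · intro h
    have h1 : (u * N + v) / N = u := by
      rw [add_comm, Int.add_mul_ediv_right _ _ (by omega), Int.ediv_eq_zero_of_lt hv hvN, zero_add]
    have h2 : (u' * N + v') / N = u' := by
      rw [add_comm, Int.add_mul_ediv_right _ _ (by omega), Int.ediv_eq_zero_of_lt hv' hvN',
        zero_add]
    have : u = u' := by rw [← h1, h, h2]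
    subst this
    exact ⟨rfl, by omega⟩
  · rintro ⟨rfl, rfl⟩; rfl

theorem mat_update {N : ℤ} {f : ℤ → ℤ} {u v a b x : ℤ} (hv : 0 ≤ v) (hvN : v < N) (hb : 0 ≤ b)
    (hbN : b < N) : mat N (Function.update f (u * N + v) x) a b =
      if a = u ∧ b = v then x else mat N f a b := by
  simp only [mat, Function.update_apply, index_inj hb hbN hv hvN]

/-- `D` and `P` are the distances and the predecessors of a tree of shortest paths from `root` for
the arc lengths `A` on the complete digraph with the nodes `0, …, N - 1`. The stamps `S` increase
from the predecessor of a node to the node, which makes the predecessors a tree. -/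
structure ShortestTree (N : ℕ) (A : ℤ → ℤ → ℤ) (root : ℤ) (D P S : ℤ → ℤ) : Prop where
  dist_root : D root = 0
  dist_nonneg : ∀ v : ℤ, 0 ≤ v → v < N → 0 ≤ D v
  relaxed : ∀ u v : ℤ, 0 ≤ u → u < N → 0 ≤ v → v < N → D v ≤ D u + A u v
  pred_nonneg : ∀ v : ℤ, 0 ≤ v → v < N → v ≠ root → 0 ≤ P v
  pred_lt : ∀ v : ℤ, 0 ≤ v → v < N → v ≠ root → P v < N
  dist_eq : ∀ v : ℤ, 0 ≤ v → v < N → v ≠ root → D v = D (P v) + A (P v) v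
  stamp_nonneg : ∀ v : ℤ, 0 ≤ v → v < N → 0 ≤ S v
  stamp_lt : ∀ v : ℤ, 0 ≤ v → v < N → v ≠ root → S (P v) < S v

/-- The invariant of Dijkstra's algorithm when `i` nodes besides the root have been settled:
`S v` is `0` if `v` has not been settled, and otherwise tells when it was. -/
structure DijkstraInv (N : ℕ) (A : ℤ → ℤ → ℤ) (root : ℤ) (i : ℕ) (D P S : ℤ → ℤ) : Prop where
  card : ((Finset.Ico (0 : ℤ) N).filter fun v => 0 < S v).card = i + 1
  stamp_nonneg : ∀ v : ℤ, 0 ≤ v → v < N → 0 ≤ S v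
  stamp_le : ∀ v : ℤ, 0 ≤ v → v < N → S v ≤ i + 1
  stamp_root : 0 < S root
  dist_root : D root = 0
  dist_nonneg : ∀ v : ℤ, 0 ≤ v → v < N → 0 ≤ D v
  relaxed : ∀ u v : ℤ, 0 ≤ u → u < N → 0 ≤ v → v < N → 0 < S u → D v ≤ D u + A u v
  settled_le : ∀ u v : ℤ, 0 ≤ u → u < N → 0 ≤ v → v < N → 0 < S u → S v = 0 → D u ≤ D v
  pred_nonneg : ∀ v : ℤ, 0 ≤ v → v < N → v ≠ root → 0 ≤ P v
  pred_lt : ∀ v : ℤ, 0 ≤ v → v < N → v ≠ root → P v < N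
  stamp_pred : ∀ v : ℤ, 0 ≤ v → v < N → v ≠ root → 0 < S (P v)
  dist_eq : ∀ v : ℤ, 0 ≤ v → v < N → v ≠ root → D v = D (P v) + A (P v) v
  stamp_lt : ∀ v : ℤ, 0 ≤ v → v < N → v ≠ root → 0 < S v → S (P v) < S v

variable {N : ℕ} {A : ℤ → ℤ → ℤ} {root : ℤ} {D P S : ℤ → ℤ} {i : ℕ}

theorem DijkstraInv.exists_unsettled (h : DijkstraInv N A root i D P S) (hi : i + 1 < N) :
    ∃ v : ℤ, 0 ≤ v ∧ v < N ∧ S v = 0 := by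
  by_contra! hc
  have : (Finset.Ico (0 : ℤ) N).filter (fun v => 0 < S v) = Finset.Ico (0 : ℤ) N := by
    refine Finset.filter_true_of_mem fun v hv => ?_
    rw [Finset.mem_Ico] at hv
    exact lt_of_le_of_ne (h.stamp_nonneg v hv.1 hv.2) (hc v hv.1 hv.2).symm
  have h1 := h.card
  rw [this, Int.card_Ico] at h1
  omega

theorem DijkstraInv.shortestTree (h : DijkstraInv N A root (N - 1) D P S) (hN : 0 < N) :
    ShortestTree N A root D P S := by
  have hall : ∀ v : ℤ, 0 ≤ v → v < N → 0 < S v := by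
    have : (Finset.Ico (0 : ℤ) N).filter (fun v => 0 < S v) = Finset.Ico (0 : ℤ) N := by
      refine Finset.eq_of_subset_of_card_le (Finset.filter_subset _ _) ?_
      rw [h.card, Int.card_Ico]; omega
    intro v h0 h1
    have hv : v ∈ Finset.Ico (0 : ℤ) N := by simp [h0, h1]
    rw [← this] at hv
    exact (Finset.mem_filter.1 hv).2
  exact ⟨h.dist_root, h.dist_nonneg, fun u v a b c d => h.relaxed u v a b c d (hall u a b),
    h.pred_nonneg, h.pred_lt, h.dist_eq, h.stamp_nonneg,
    fun v a b c => h.stamp_lt v a b c (hall v a b)⟩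

/-- The distances after relaxing the arcs from `x` to the nodes below `i`. -/
def relaxDist (A : ℤ → ℤ → ℤ) (D : ℤ → ℤ) (x i : ℤ) (v : ℤ) : ℤ :=
  if 0 ≤ v ∧ v < i ∧ D x + A x v < D v then D x + A x v else D v

/-- The predecessors after relaxing the arcs from `x` to the nodes below `i`. -/
def relaxPred (A : ℤ → ℤ → ℤ) (D P : ℤ → ℤ) (x i : ℤ) (v : ℤ) : ℤ :=
  if 0 ≤ v ∧ v < i ∧ D x + A x v < D v then x else P v

theorem DijkstraInv.init (hr : 0 ≤ root) (hrN : root < N)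
    (hA : ∀ u v : ℤ, 0 ≤ u → u < N → 0 ≤ v → v < N → 0 ≤ A u v)
    (hD : ∀ v : ℤ, 0 ≤ v → v < N → D v = if v = root then 0 else A root v)
    (hP : ∀ v : ℤ, 0 ≤ v → v < N → P v = root)
    (hS : ∀ v : ℤ, 0 ≤ v → v < N → S v = if v = root then 1 else 0) :
    DijkstraInv N A root 0 D P S := by
  have hDr : D root = 0 := by simp [hD root hr hrN]
  have hSr : S root = 1 := by simp [hS root hr hrN]
  have hone : ∀ v : ℤ, 0 ≤ v → v < N → 0 < S v → v = root := by
    intro v h0 h1 h2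
    rw [hS v h0 h1] at h2
    by_contra h; simp [h] at h2
  have hDn : ∀ v : ℤ, 0 ≤ v → v < N → 0 ≤ D v := by
    intro v h0 h1
    rw [hD v h0 h1]; split_ifs
    · exact le_rfl
    · exact hA _ _ hr hrN h0 h1
  refine ⟨?_, ?_, ?_, by omega, hDr, hDn, ?_, ?_, ?_, ?_, ?_, ?_, ?_⟩
  · rw [Finset.card_eq_one]
    refine ⟨root, ?_⟩
    ext v
    simp only [Finset.mem_filter, Finset.mem_Ico, Finset.mem_singleton]
    constructor
    · rintro ⟨⟨h0, h1⟩, h2⟩; exact hone v h0 h1 h2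
    · rintro rfl; omega
  · intro v h0 h1; rw [hS v h0 h1]; split_ifs <;> omega
  · intro v h0 h1; rw [hS v h0 h1]; split_ifs <;> simp
  · intro u v h0 h1 h2 h3 h4
    rw [hone u h0 h1 h4, hDr, hD v h2 h3]
    have := hA _ _ hr hrN h2 h3
    split_ifs <;> omega
  · intro u v h0 h1 h2 h3 h4 _
    rw [hone u h0 h1 h4, hDr]; exact hDn v h2 h3
  · intro v h0 h1 _; rw [hP v h0 h1]; exact hr
  · intro v h0 h1 _; rw [hP v h0 h1]; exact hrN
  · intro v h0 h1 _; rw [hP v h0 h1]; omega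
  · intro v h0 h1 h2; rw [hP v h0 h1, hDr, hD v h0 h1]; simp [h2]
  · intro v h0 h1 h2 h3; exact absurd (hone v h0 h1 h3) h2

/-- Settling an unsettled node `x` of least distance. The distances of settled nodes are at most
that of `x`, so relaxing the arcs from `x` does not change them. -/
theorem DijkstraInv.step (h : DijkstraInv N A root i D P S)
    (hA : ∀ u v : ℤ, 0 ≤ u → u < N → 0 ≤ v → v < N → 0 ≤ A u v)
    {x : ℤ} (hx : 0 ≤ x) (hxN : x < N) (hSx : S x = 0)
    (hmin : ∀ v : ℤ, 0 ≤ v → v < N → S v = 0 → D x ≤ D v) :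
    DijkstraInv N A root (i + 1) (relaxDist A D x N) (relaxPred A D P x N)
      (Function.update S x (i + 2)) := by
  have hD : ∀ v : ℤ, 0 ≤ v → v < N → relaxDist A D x N v = min (D v) (D x + A x v) := by
    intro v h0 h1
    simp only [relaxDist, h0, h1, true_and]
    split_ifs with hlt
    · exact (min_eq_right hlt.le).symm
    · exact (min_eq_left (not_lt.1 hlt)).symm
  have hSS : ∀ v, v ≠ x → Function.update S x (i + 2 : ℤ) v = S v := fun v hv => by simp [hv]
  have hSx' : Function.update S x (i + 2 : ℤ) x = i + 2 := by simp
  have hpos : ∀ v : ℤ, 0 < S v → v ≠ x := by rintro v hv rfl; omega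
  have hDx : relaxDist A D x N x = D x := by
    rw [hD x hx hxN]; exact min_eq_left (by have := hA x x hx hxN hx hxN; omega)
  have hDs : ∀ v : ℤ, 0 ≤ v → v < N → 0 < S v → relaxDist A D x N v = D v := by
    intro v h0 h1 h2
    rw [hD v h0 h1]
    have := h.settled_le v x h0 h1 hx hxN h2 hSx
    have := hA x v hx hxN h0 h1
    exact min_eq_left (by omega)
  have hPs : ∀ v : ℤ, 0 ≤ v → v < N → 0 < S v ∨ v = x → relaxPred A D P x N v = P v := by
    intro v h0 h1 h2
    have hle : D v ≤ D x + A x v := by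
      have := hA x v hx hxN h0 h1
      rcases h2 with h2 | rfl
      · have := h.settled_le v x h0 h1 hx hxN h2 hSx; omega
      · omega
    simp only [relaxPred]; rw [if_neg]; omega
  have hsettled : ∀ v, 0 < Function.update S x (i + 2 : ℤ) v ↔ 0 < S v ∨ v = x := by
    intro v
    by_cases hv : v = x
    · subst hv; simp; omega
    · simp [hv]
  have hr0 : root ≠ x := hpos root h.stamp_root
  refine ⟨?_, ?_, ?_, ?_, ?_, ?_, ?_, ?_, ?_, ?_, ?_, ?_, ?_⟩
  · have : (Finset.Ico (0 : ℤ) N).filter (fun v => 0 < Function.update S x (i + 2 : ℤ) v)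
        = insert x ((Finset.Ico (0 : ℤ) N).filter fun v => 0 < S v) := by
      ext v
      simp only [Finset.mem_filter, Finset.mem_Ico, Finset.mem_insert, hsettled]
      constructor
      · tauto
      · rintro (rfl | h) <;> tauto
    rw [this, Finset.card_insert_of_notMem (by simp [hSx]), h.card]
  · intro v h0 h1
    by_cases hv : v = x
    · subst hv; rw [hSx']; omega
    · rw [hSS v hv]; exact h.stamp_nonneg v h0 h1
  · intro v h0 h1
    by_cases hv : v = x
    · subst hv; rw [hSx']; push_cast; omega
    · rw [hSS v hv]; have := h.stamp_le v h0 h1; push_cast; omega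
  · rw [hsettled]; exact .inl h.stamp_root
  · have := h.dist_root
    simp only [relaxDist]
    split_ifs with hc
    · have := h.dist_nonneg x hx hxN
      have := hA x root hx hxN hc.1 hc.2.1
      omega
    · exact this
  · intro v h0 h1
    rw [hD v h0 h1]
    exact le_min (h.dist_nonneg v h0 h1)
      (add_nonneg (h.dist_nonneg x hx hxN) (hA x v hx hxN h0 h1))
  · intro u v h0 h1 h2 h3 h4
    rw [hD v h2 h3]
    rcases (hsettled u).1 h4 with h4 | rfl
    · rw [hDs u h0 h1 h4]
      exact (min_le_left _ _).trans (h.relaxed u v h0 h1 h2 h3 h4)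
    · rw [hDx]; exact min_le_right _ _
  · intro u v h0 h1 h2 h3 h4 h5
    have hvx : v ≠ x := by rintro rfl; rw [hSx'] at h5; omega
    rw [hSS v hvx] at h5
    have hux : relaxDist A D x N u ≤ D x := by
      rcases (hsettled u).1 h4 with h4 | rfl
      · rw [hDs u h0 h1 h4]; exact h.settled_le u x h0 h1 hx hxN h4 hSx
      · exact hDx.le
    rw [hD v h2 h3]
    refine le_min (hux.trans (hmin v h2 h3 h5)) (hux.trans ?_)
    have := hA x v hx hxN h2 h3
    omega
  · intro v h0 h1 h2
    simp only [relaxPred]; split_ifs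
    exacts [hx, h.pred_nonneg v h0 h1 h2]
  · intro v h0 h1 h2
    simp only [relaxPred]; split_ifs
    exacts [hxN, h.pred_lt v h0 h1 h2]
  · intro v h0 h1 h2
    rw [hsettled]
    simp only [relaxPred]; split_ifs
    exacts [.inr rfl, .inl (h.stamp_pred v h0 h1 h2)]
  · intro v h0 h1 h2
    have hp := hDs (P v) (h.pred_nonneg v h0 h1 h2) (h.pred_lt v h0 h1 h2) (h.stamp_pred v h0 h1 h2)
    simp only [relaxPred]
    split_ifs with hc
    · rw [hDx, hD v h0 h1, min_eq_right hc.2.2.le]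
    · rw [hp, hD v h0 h1, min_eq_left (by by_contra hlt; exact hc ⟨h0, h1, by omega⟩)]
      exact h.dist_eq v h0 h1 h2
  · intro v h0 h1 h2 h3
    have h3 := (hsettled v).1 h3
    rw [hPs v h0 h1 h3, hSS _ (hpos _ (h.stamp_pred v h0 h1 h2))]
    rcases h3 with h3 | rfl
    · rw [hSS _ (hpos _ h3)]; exact h.stamp_lt v h0 h1 h2 h3
    · rw [hSx']
      have := h.stamp_le _ (h.pred_nonneg v h0 h1 h2) (h.pred_lt v h0 h1 h2)
      omega

/-- Selects an unsettled node of least distance. -/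
def selectMin : Prog :=
  .assign rNode (.const (-1)) ⨾
  .forLoop rCol nodesE
    (.ite (.get aStamp (.reg rCol)) .skip
      (.ite (.lt (.reg rNode) (.const 0)) (.assign rNode (.reg rCol))
        (.ite (.lt (.get aDist (.reg rCol)) (.get aDist (.reg rNode)))
          (.assign rNode (.reg rCol)) .skip)))

theorem wp_selectMin {m : Memory} (hN : m.nodes = N)
    (hex : ∃ v : ℤ, 0 ≤ v ∧ v < N ∧ m.arr aStamp v = 0) :
    Wp selectMin (N * 6 + 3) m fun m' => 0 ≤ m'.reg rNode ∧ m'.reg rNode < N ∧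
      m.arr aStamp (m'.reg rNode) = 0 ∧
      ∀ v : ℤ, 0 ≤ v → v < N → m.arr aStamp v = 0 → m.arr aDist (m'.reg rNode) ≤ m.arr aDist v := by
  refine Wp.assign_seq (Wp.forLoop (T := 4) (n := N) (fun i m' =>
    (m'.reg rNode = -1 ∧ ∀ v : ℤ, 0 ≤ v → v < i → m.arr aStamp v ≠ 0) ∨
    (0 ≤ m'.reg rNode ∧ m'.reg rNode < i ∧ m.arr aStamp (m'.reg rNode) = 0 ∧
      ∀ v : ℤ, 0 ≤ v → v < i → m.arr aStamp v = 0 → m.arr aDist (m'.reg rNode) ≤ m.arr aDist v))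
    (by decide) (fun _ _ _ h => h) ?_ ?_ ?_ ?_)
  · intro m' ha
    rw [eval_nodesE, ha.nodes (by decide), nodes_setReg, hN]
  · left
    refine ⟨by simp, fun v h0 h1 => ?_⟩
    push_cast at h1; omega
  · intro i hi m' ha hr hI
    have hS : m'.arr aStamp = m.arr aStamp := ha.arr _ (by decide)
    have hD : m'.arr aDist = m.arr aDist := ha.arr _ (by decide)
    have hcase : ∀ v : ℤ, 0 ≤ v → v < (i + 1 : ℕ) → v < i ∨ v = i := fun v _ h => by
      push_cast at h; omega
    refine Wp.ite (fun hs => (Wp.skip ?_).mono (T' := 3) (by omega) fun _ _ h => h)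
      (fun hs => Wp.ite (fun hs' => (Wp.assign ?_).mono (T' := 2) (by omega) fun _ _ h => h)
        (fun hs' => Wp.ite (fun hs2 => Wp.assign ?_) (fun hs2 => Wp.skip ?_)))
    all_goals try rw [Expr.eval_lt_ne_zero] at hs'
    all_goals try rw [Expr.eval_lt_eq_zero] at hs'
    all_goals try rw [Expr.eval_lt_ne_zero] at hs2
    all_goals try rw [Expr.eval_lt_eq_zero] at hs2
    all_goals simp only [Expr.eval_get, Expr.eval_reg, hr, hS, hD, Expr.eval_const] at *
    · rcases hI with ⟨h1, h2⟩ | ⟨h1, h2, h3, h4⟩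
      · refine .inl ⟨h1, fun v h0 hv => ?_⟩
        rcases hcase v h0 hv with hv | rfl
        exacts [h2 v h0 hv, hs]
      · refine .inr ⟨h1, by push_cast; omega, h3, fun v h0 hv h5 => ?_⟩
        rcases hcase v h0 hv with hv | rfl
        exacts [h4 v h0 hv h5, absurd h5 hs]
    · rcases hI with ⟨h1, h2⟩ | ⟨h1, h2, h3, h4⟩
      · refine .inr ?_
        simp only [Memory.reg_setReg, if_true]
        refine ⟨by omega, by push_cast; omega, hs, fun v h0 hv h5 => ?_⟩
        rcases hcase v h0 hv with hv | rfl
        exacts [absurd h5 (h2 v h0 hv), le_rfl]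
      · omega
    · rcases hI with ⟨h1, h2⟩ | ⟨h1, h2, h3, h4⟩
      · omega
      · refine .inr ?_
        simp only [Memory.reg_setReg, if_true]
        refine ⟨by omega, by push_cast; omega, hs, fun v h0 hv h5 => ?_⟩
        rcases hcase v h0 hv with hv | rfl
        exacts [hs2.le.trans (h4 v h0 hv h5), le_rfl]
    · rcases hI with ⟨h1, h2⟩ | ⟨h1, h2, h3, h4⟩
      · omega
      · refine .inr ⟨h1, by push_cast; omega, h3, fun v h0 hv h5 => ?_⟩
        rcases hcase v h0 hv with hv | rfl
        exacts [h4 v h0 hv h5, hs2]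
  · intro m' _ hI
    rcases hI with ⟨h1, h2⟩ | h
    · obtain ⟨v, h0, h1, h3⟩ := hex
      exact absurd h3 (h2 v h0 h1)
    · exact h

/-- Relaxes all arcs from the selected node. -/
def relaxAll : Prog :=
  .forLoop rCol nodesE
    (.ite (.lt (.get aDist (.reg rNode) + entry aLen (.reg rNode) (.reg rCol))
        (.get aDist (.reg rCol)))
      (.store aDist (.reg rCol) (.get aDist (.reg rNode) + entry aLen (.reg rNode) (.reg rCol)) ⨾
        .store aPred (.reg rCol) (.reg rNode)) .skip)

theorem wp_relaxAll {m : Memory} (hN : m.nodes = N) {x : ℤ} (hx : m.reg rNode = x)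
    (hA : 0 ≤ mat N (m.arr aLen) x x) :
    Wp relaxAll (N * 5 + 2) m fun m' =>
      m'.arr aDist = relaxDist (mat N (m.arr aLen)) (m.arr aDist) x N ∧
      m'.arr aPred = relaxPred (mat N (m.arr aLen)) (m.arr aDist) (m.arr aPred) x N := by
  refine Wp.forLoop (T := 3) (n := N) (fun i m' =>
      m'.arr aDist = relaxDist (mat N (m.arr aLen)) (m.arr aDist) x i ∧
      m'.arr aPred = relaxPred (mat N (m.arr aLen)) (m.arr aDist) (m.arr aPred) x i)
    (by decide) (fun _ _ _ h => h) ?_ ?_ ?_ ?_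
  · intro m' ha
    rw [eval_nodesE, ha.nodes (by decide), hN]
  · constructor
    · funext v; rw [relaxDist, if_neg]; push_cast; omega
    · funext v; rw [relaxPred, if_neg]; push_cast; omega
  · intro i hi m' ha hr ⟨h1, h2⟩
    have hL : m'.arr aLen = m.arr aLen := ha.arr _ (by decide)
    have hx' : m'.reg rNode = x := (ha.reg _ (by decide)).trans hx
    have hN' : m'.nodes = N := (ha.nodes (by decide)).trans hN
    have hdx : m'.arr aDist x = m.arr aDist x := by
      rw [h1, relaxDist, if_neg]; omega
    have hdi : m'.arr aDist i = m.arr aDist i := by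
      rw [h1, relaxDist, if_neg]; omega
    have hc : (Expr.get aDist (.reg rNode) + entry aLen (.reg rNode) (.reg rCol)).eval m'
        = m.arr aDist x + mat N (m.arr aLen) x i := by
      simp [entry, hx', hr, hdx, hL, hN', mat]
    refine Wp.ite (fun hs => Wp.store_seq (Wp.store ?_)) (fun hs => (Wp.skip ?_).mono (T' := 2)
      (by omega) fun _ _ h => h)
    · rw [Expr.eval_lt_ne_zero, hc, Expr.eval_get, Expr.eval_reg, hr, hdi] at hs
      rw [hc]
      simp only [Memory.arr_setCell, h1, h2, hr, hx', Expr.eval_reg, Memory.reg_setCell]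
      constructor
      · funext v
        by_cases hv : v = i
        · subst hv; simp [relaxDist, hs]
        · simp only [if_true, show ((7:ℕ) = 8) = False by simp, if_false, Function.update_of_ne hv,
            relaxDist]
          refine if_congr ?_ rfl rfl
          push_cast
          constructor <;> rintro ⟨a, b, c⟩ <;> exact ⟨a, by omega, c⟩
      · funext v
        by_cases hv : v = i
        · subst hv; simp [relaxPred, hs]
        · simp only [if_true, show ((8:ℕ) = 7) = False by simp, if_false, Function.update_of_ne hv,
            relaxPred]
          refine if_congr ?_ rfl rfl
          push_cast
          constructor <;> rintro ⟨a, b, c⟩ <;> exact ⟨a, by omega, c⟩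
    · rw [Expr.eval_lt_eq_zero, hc, Expr.eval_get, Expr.eval_reg, hr, hdi, ← not_lt] at hs
      rw [h1, h2]
      constructor
      · funext v
        by_cases hv : v = i
        · subst hv; simp [relaxDist, hs]
        · simp only [relaxDist]
          refine if_congr ?_ rfl rfl
          push_cast
          constructor <;> rintro ⟨a, b, c⟩ <;> exact ⟨a, by omega, c⟩
      · funext v
        by_cases hv : v = i
        · subst hv; simp [relaxPred, hs]
        · simp only [relaxPred]
          refine if_congr ?_ rfl rfl
          push_cast
          constructor <;> rintro ⟨a, b, c⟩ <;> exact ⟨a, by omega, c⟩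
  · intro m' _ h
    exact h

/-- Dijkstra's algorithm on the complete digraph with non-negative arc lengths. -/
def dijkstra : Prog :=
  .forLoop rCol nodesE
    (.store aDist (.reg rCol) (entry aLen (.reg rRoot) (.reg rCol)) ⨾
      .store aPred (.reg rCol) (.reg rRoot) ⨾ .store aStamp (.reg rCol) (.const 0)) ⨾
  .store aDist (.reg rRoot) (.const 0) ⨾
  .store aStamp (.reg rRoot) (.const 1) ⨾
  .forLoop rRound (nodesE - .const 1)
    (selectMin ⨾ .store aStamp (.reg rNode) (.reg rRound + .const 2) ⨾ relaxAll)

theorem wp_dijkstra {m : Memory} (hN : m.nodes = N) (hroot : m.reg rRoot = root)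
    (hr : 0 ≤ root) (hrN : root < N)
    (hA : ∀ u v : ℤ, 0 ≤ u → u < N → 0 ≤ v → v < N → 0 ≤ mat N (m.arr aLen) u v) :
    Wp dijkstra (N * 5 + 2 + ((N - 1) * (N * 6 + 3 + (N * 5 + 2 + 1) + 2) + 2 + 1 + 1)) m
      fun m' => ShortestTree N (mat N (m.arr aLen)) root (m'.arr aDist) (m'.arr aPred)
        (m'.arr aStamp) := by
  have hN0 : 0 < N := by omega
  refine Wp.seq (Wp.forLoop (T := 3) (n := N) (fun i m' =>
    (∀ v : ℤ, 0 ≤ v → v < i → m'.arr aDist v = mat N (m.arr aLen) root v) ∧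
    (∀ v : ℤ, 0 ≤ v → v < i → m'.arr aPred v = root) ∧
    (∀ v : ℤ, 0 ≤ v → v < i → m'.arr aStamp v = 0)) (by decide) (fun _ _ _ h => h) ?_ ?_ ?_ ?_)
  · intro m' ha
    rw [eval_nodesE, ha.nodes (by decide), hN]
  · refine ⟨?_, ?_, ?_⟩ <;> intro v h0 h1 <;> push_cast at h1 <;> omega
  · intro i hi m' ha hr ⟨h1, h2, h3⟩
    have hL : m'.arr aLen = m.arr aLen := ha.arr _ (by decide)
    have hx' : m'.reg rRoot = root := (ha.reg _ (by decide)).trans hroot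
    have hN' : m'.nodes = N := (ha.nodes (by decide)).trans hN
    refine Wp.store_seq (Wp.store_seq (Wp.store ?_))
    refine ⟨?_, ?_, ?_⟩ <;> intro v h0 hv <;> by_cases hvi : v = i
    · subst hvi; simp [entry, hx', hr, hL, hN', mat]
    · have := h1 v h0 (by push_cast at hv; omega)
      simpa [hvi, hr]
    · subst hvi; simp [hx', hr]
    · have := h2 v h0 (by push_cast at hv; omega)
      simpa [hvi, hr]
    · subst hvi; simp [hr]
    · have := h3 v h0 (by push_cast at hv; omega)
      simpa [hvi, hr]
  · intro m1 ha1 ⟨h1, h2, h3⟩ _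
    have hr1 : m1.reg rRoot = root := (ha1.reg _ (by decide)).trans hroot
    have hN1 : m1.nodes = N := (ha1.nodes (by decide)).trans hN
    have hL1 : m1.arr aLen = m.arr aLen := ha1.arr _ (by decide)
    refine Wp.store_seq (Wp.store_seq (Wp.forLoop (T := N * 6 + 3 + (N * 5 + 2 + 1)) (n := N - 1)
      (fun i m' => DijkstraInv N (mat N (m.arr aLen)) root i (m'.arr aDist) (m'.arr aPred)
        (m'.arr aStamp)) (by decide) (fun _ _ _ h => h) ?_ ?_ ?_ ?_))
    · intro m' ha
      rw [Expr.eval_sub, eval_nodesE, ha.nodes (by decide), nodes_setCell _ (by decide),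
        nodes_setCell _ (by decide), hN1, Expr.eval_const]
      omega
    · refine DijkstraInv.init hr hrN hA ?_ ?_ ?_
      · intro v h0 hv
        simp [hr1, Function.update_apply, h1 v h0 hv]
      · intro v h0 hv
        simp [h2 v h0 hv]
      · intro v h0 hv
        simp [hr1, Function.update_apply, h3 v h0 hv]
    · intro i hi m2 ha2 hrd hI
      have hL2 : m2.arr aLen = m.arr aLen := by
        rw [ha2.arr _ (by decide)]; simpa using hL1
      have hN2 : m2.nodes = N := by
        rw [ha2.nodes (by decide), nodes_setCell _ (by decide), nodes_setCell _ (by decide), hN1]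
      refine Wp.seq ((wp_selectMin hN2 (hI.exists_unsettled (by omega))).mono le_rfl ?_)
      intro m3 ha3 ⟨x0, xN, xS, xmin⟩ _
      have hL3 : m3.arr aLen = m.arr aLen := (ha3.arr _ (by decide)).trans hL2
      have hN3 : m3.nodes = N := (ha3.nodes (by decide)).trans hN2
      have hrd3 : m3.reg rRound = i := (ha3.reg _ (by decide)).trans hrd
      have hD3 : m3.arr aDist = m2.arr aDist := ha3.arr _ (by decide)
      have hP3 : m3.arr aPred = m2.arr aPred := ha3.arr _ (by decide)
      have hS3 : m3.arr aStamp = m2.arr aStamp := ha3.arr _ (by decide)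
      refine Wp.store_seq ?_
      refine (wp_relaxAll (x := m3.reg rNode) ?_ (by simp) ?_).mono le_rfl ?_
      · rw [nodes_setCell _ (by decide), hN3]
      · simpa [hL3] using hA _ _ x0 xN x0 xN
      · intro m4 ha4 ⟨hd, hp⟩
        have hS4 : m4.arr aStamp = Function.update (m2.arr aStamp) (m3.reg rNode) (i + 2) := by
          rw [ha4.arr _ (by decide)]
          simp [hrd3, hS3]
        rw [hd, hp, hS4]
        simpa [hL3, hD3, hP3] using hI.step hA x0 xN xS xmin
    · intro m' _ hI
      exact hI.shortestTree hN0

end RAM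

/-! ### Paths as flows, and tracing a tree path back to the root -/

namespace RAM

/-- The net flow of one unit along the path `l`: the number of times that the path uses the arc
`(a, b)` minus the number of times that it uses `(b, a)`. -/
def pathFlow : List ℤ → ℤ → ℤ → ℤ
  | v :: u :: l, a, b =>
      (if a = v ∧ b = u then 1 else 0) - (if a = u ∧ b = v then 1 else 0) + pathFlow (u :: l) a b
  | _, _, _ => 0

/-- The sum of the arc costs `d` along the path `l`. -/
def pathCost (d : ℤ → ℤ → ℤ) : List ℤ → ℤ
  | v :: u :: l => d v u + pathCost d (u :: l)
  | _ => 0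

theorem pathFlow_antisymm (l : List ℤ) (a b : ℤ) : pathFlow l b a = -pathFlow l a b := by
  induction l with
  | nil => simp [pathFlow]
  | cons v l ih =>
      cases l with
      | nil => simp [pathFlow]
      | cons u l =>
          simp only [pathFlow, ih, and_comm (a := b = v), and_comm (a := b = u)]
          ring

theorem sum_pathFlow {s : Finset ℤ} (v : ℤ) (l : List ℤ) (hl : ∀ x ∈ v :: l, x ∈ s) (a : ℤ) :
    ∑ b ∈ s, pathFlow (v :: l) a b =
      (if a = v then 1 else 0) - (if a = (v :: l).getLast (by simp) then 1 else 0) := by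
  induction l generalizing v with
  | nil =>
      rw [List.getLast_singleton, sub_self]
      simp [pathFlow]
  | cons u l ih =>
      have hu : u ∈ s := hl u (by simp)
      have hv : v ∈ s := hl v (by simp)
      simp only [pathFlow, Finset.sum_add_distrib, Finset.sum_sub_distrib,
        ih u (fun x hx => hl x (by simp_all)), ite_and, List.getLast_cons_cons]
      by_cases h1 : a = v <;> by_cases h2 : a = u <;> simp [h1, h2, hu, hv] <;>
        split_ifs <;> simp_all

theorem sum_pathFlow_mul {s : Finset ℤ} {d : ℤ → ℤ → ℤ} (hd : ∀ a b, d b a = -d a b) (l : List ℤ)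
    (hl : ∀ x ∈ l, x ∈ s) :
    ∑ a ∈ s, ∑ b ∈ s, pathFlow l a b * d a b = 2 * pathCost d l := by
  induction l with
  | nil => simp [pathFlow, pathCost]
  | cons v l ih =>
      cases l with
      | nil => simp [pathFlow, pathCost]
      | cons u l =>
          have hu : u ∈ s := hl u (by simp)
          have hv : v ∈ s := hl v (by simp)
          have ih' := ih fun x hx => hl x (List.mem_cons_of_mem _ hx)
          have key : ∀ x ∈ s, ∀ y ∈ s,
              ∑ a ∈ s, ∑ b ∈ s, (if a = x ∧ b = y then 1 else 0) * d a b = d x y := by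
            intro x hx y hy
            rw [Finset.sum_eq_single_of_mem x hx fun a _ ha => by simp [ha],
              Finset.sum_eq_single_of_mem y hy fun b _ hb => by simp [hb]]
            simp
          simp only [pathFlow, pathCost, add_mul, sub_mul, Finset.sum_add_distrib,
            Finset.sum_sub_distrib, ih', key v hv u hu, key u hu v hv, hd v u]
          ring

theorem pathFlow_eq_zero {l : List ℤ} {a b : ℤ} (h : (a, b) ∉ l.zip l.tail)
    (h' : (b, a) ∉ l.zip l.tail) : pathFlow l a b = 0 := by
  induction l with
  | nil => simp [pathFlow]
  | cons v l ih =>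
      cases l with
      | nil => simp [pathFlow]
      | cons u l =>
          simp only [List.tail_cons, List.zip_cons_cons, List.mem_cons, Prod.mk.injEq, not_or]
            at h h' ih
          rw [pathFlow, ih h.2 h'.2, if_neg h.1, if_neg (fun hh => h'.1 ⟨hh.2, hh.1⟩)]
          simp

theorem mem_of_mem_zip_tail {l : List ℤ} {a b : ℤ} (h : (a, b) ∈ l.zip l.tail) :
    a ∈ l ∧ b ∈ l.tail := List.of_mem_zip h

theorem pathFlow_eq_one {l : List ℤ} (hl : l.Nodup) {a b : ℤ} (h : (a, b) ∈ l.zip l.tail) :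
    pathFlow l a b = 1 := by
  induction l with
  | nil => simp at h
  | cons v l ih =>
      cases l with
      | nil => simp at h
      | cons u l =>
          rw [List.nodup_cons] at hl
          have hvu : v ≠ u := fun hh => hl.1 (by simp [hh])
          simp only [List.tail_cons, List.zip_cons_cons, List.mem_cons, Prod.mk.injEq] at h ih
          rw [pathFlow]
          rcases h with ⟨rfl, rfl⟩ | h
          · rw [pathFlow_eq_zero]
            · simp [hvu]
            · exact fun hh => hl.1 (mem_of_mem_zip_tail hh).1
            · exact fun hh => hl.1 (List.mem_of_mem_tail (mem_of_mem_zip_tail hh).2)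
          · have h1 := mem_of_mem_zip_tail (l := u :: l) h
            have ha : a ≠ v := fun hh => hl.1 (hh ▸ h1.1)
            have hb : b ≠ v := fun hh => hl.1 (hh ▸ List.mem_of_mem_tail h1.2)
            simp [ih hl.2 h, ha, hb]

theorem pathFlow_cases {l : List ℤ} (hl : l.Nodup) (a b : ℤ) :
    ((a, b) ∈ l.zip l.tail ∧ pathFlow l a b = 1) ∨
    ((a, b) ∉ l.zip l.tail ∧ (b, a) ∈ l.zip l.tail ∧ pathFlow l a b = -1) ∨
    ((a, b) ∉ l.zip l.tail ∧ (b, a) ∉ l.zip l.tail ∧ pathFlow l a b = 0) := by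
  by_cases h : (a, b) ∈ l.zip l.tail
  · exact .inl ⟨h, pathFlow_eq_one hl h⟩
  · by_cases h' : (b, a) ∈ l.zip l.tail
    · exact .inr (.inl ⟨h, h', by rw [pathFlow_antisymm, pathFlow_eq_one hl h']⟩)
    · exact .inr (.inr ⟨h, h', pathFlow_eq_zero h h'⟩)

/-- The list of the nodes that are met when the predecessors `P` are followed up to `root`. -/
inductive Trace (P : ℤ → ℤ) (root : ℤ) : List ℤ → Prop
  | single : Trace P root [root]
  | cons {v : ℤ} {l : List ℤ} : v ≠ root → Trace P root (P v :: l) → Trace P root (v :: P v :: l)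

variable {N : ℕ} {A : ℤ → ℤ → ℤ} {root : ℤ} {D P S : ℤ → ℤ}

theorem Trace.getLast? {l : List ℤ} (h : Trace P root l) : l.getLast? = some root := by
  induction h with
  | single => rfl
  | cons _ _ ih => rw [List.getLast?_cons_cons]; exact ih

theorem Trace.of_mem_zip {l : List ℤ} (h : Trace P root l) {a b : ℤ} (hab : (a, b) ∈ l.zip l.tail) :
    a ≠ root ∧ b = P a := by
  induction h with
  | single => simp at hab
  | cons h1 _ ih =>
      simp only [List.tail_cons, List.zip_cons_cons, List.mem_cons, Prod.mk.injEq] at hab ih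
      rcases hab with ⟨rfl, rfl⟩ | hab
      exacts [⟨h1, rfl⟩, ih hab]

/-- Following the predecessors of a tree leads to the root along a simple path. -/
theorem ShortestTree.exists_trace (h : ShortestTree N A root D P S) (hr : 0 ≤ root)
    (hrN : root < N) {v : ℤ} (hv : 0 ≤ v) (hvN : v < N) :
    ∃ l, Trace P root (v :: l) ∧ (v :: l).Nodup ∧ ∀ x ∈ v :: l, 0 ≤ x ∧ x < N := by
  suffices H : ∀ k : ℕ, ∀ v : ℤ, 0 ≤ v → v < N → S v ≤ k → ∃ l, Trace P root (v :: l) ∧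
      (v :: l).Nodup ∧ ∀ x ∈ v :: l, 0 ≤ x ∧ x < N ∧ S x ≤ S v by
    obtain ⟨l, h1, h2, h3⟩ := H (S v).toNat v hv hvN (by omega)
    exact ⟨l, h1, h2, fun x hx => ⟨(h3 x hx).1, (h3 x hx).2.1⟩⟩
  intro k
  induction k with
  | zero =>
      intro v h0 h1 h2
      by_cases hvr : v = root
      · subst hvr
        exact ⟨[], .single, by simp, by simp [h0, h1]⟩
      · have := h.stamp_lt v h0 h1 hvr
        have := h.stamp_nonneg _ (h.pred_nonneg v h0 h1 hvr) (h.pred_lt v h0 h1 hvr)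
        omega
  | succ k ih =>
      intro v h0 h1 h2
      by_cases hvr : v = root
      · subst hvr
        exact ⟨[], .single, by simp, by simp [h0, h1]⟩
      · have hlt := h.stamp_lt v h0 h1 hvr
        obtain ⟨l, k1, k2, k3⟩ := ih (P v) (h.pred_nonneg v h0 h1 hvr) (h.pred_lt v h0 h1 hvr)
          (by push_cast at h2; omega)
        refine ⟨P v :: l, .cons hvr k1, ?_, ?_⟩
        · rw [List.nodup_cons]
          refine ⟨fun hv => ?_, k2⟩
          have := (k3 v hv).2.2
          omega
        · intro x hx
          rcases List.mem_cons.1 hx with rfl | hx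
          · exact ⟨h0, h1, le_rfl⟩
          · have := k3 x hx
            exact ⟨this.1, this.2.1, by omega⟩

/-- From the position `p` on, the array `f` holds the entries of the list. -/
def Holds (f : ℤ → ℤ) : ℤ → List ℤ → Prop
  | _, [] => True
  | p, x :: l => f p = x ∧ Holds f (p + 1) l

theorem holds_append {f : ℤ → ℤ} {p : ℤ} {l l' : List ℤ} :
    Holds f p (l ++ l') ↔ Holds f p l ∧ Holds f (p + l.length) l' := by
  induction l generalizing p with
  | nil => simp [Holds]
  | cons x l ih =>
      simp only [List.cons_append, Holds, ih, List.length_cons, Nat.cast_add, Nat.cast_one, and_assoc]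
      rw [show p + 1 + (l.length : ℤ) = p + (l.length + 1) by ring]

theorem Holds.congr {f g : ℤ → ℤ} {p : ℤ} {l : List ℤ} (h : Holds f p l)
    (hfg : ∀ j, p ≤ j → j < p + l.length → g j = f j) : Holds g p l := by
  induction l generalizing p with
  | nil => trivial
  | cons x l ih =>
      simp only [List.length_cons, Nat.cast_add, Nat.cast_one] at hfg
      exact ⟨(hfg p le_rfl (by omega)).trans h.1,
        ih h.2 fun j h1 h2 => hfg j (by omega) (by omega)⟩

theorem Holds.getElem {f : ℤ → ℤ} {p : ℤ} {l : List ℤ} (h : Holds f p l) (j : ℕ)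
    (hj : j < l.length) : f (p + j) = l[j] := by
  induction l generalizing p j with
  | nil => simp at hj
  | cons x l ih =>
      cases j with
      | zero => simpa using h.1
      | succ j =>
          have := ih h.2 j (by simpa using hj)
          rw [List.getElem_cons_succ, ← this]
          congr 1; push_cast; ring

/-- The snapshots and the satellites of a list of nodes, as they are written to the output. -/
def coords (n : ℤ) (l : List ℤ) : List ℤ := l.flatMap fun x => [x / n, x % n]

theorem length_coords (n : ℤ) (l : List ℤ) : (coords n l).length = 2 * l.length := by
  induction l with
  | nil => rfl
  | cons x l ih => simp only [coords, List.flatMap_cons, List.length_append] at *; simp; omega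

/-- Follows the predecessors from the current node to the root, moves one unit of residual capacity
from every arc (predecessor, node) to the opposite arc, and writes down the predecessors. -/
def tracePath : Prog :=
  .loop (.reg rCur - .reg rRoot)
    (.assign rNode (.get aPred (.reg rCur)) ⨾
      setEntry aRes (.reg rNode) (.reg rCur) (entry aRes (.reg rNode) (.reg rCur) - .const 1) ⨾
      setEntry aRes (.reg rCur) (.reg rNode) (entry aRes (.reg rCur) (.reg rNode) + .const 1) ⨾
      .store aOut (.reg rPos) (.reg rNode / satE) ⨾
      .store aOut (.reg rPos + .const 1) (.reg rNode - .reg rNode / satE * satE) ⨾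
      .assign rPos (.reg rPos + .const 2) ⨾
      .assign rCur (.reg rNode))

theorem wp_tracePath {l : List ℤ} (hl : Trace P root l) :
    ∀ {m : Memory}, m.nodes = N → m.reg rRoot = root → m.arr aPred = P →
      l.head? = some (m.reg rCur) → (∀ x ∈ l, 0 ≤ x ∧ x < N) →
      Wp tracePath (l.length * 8) m fun m' =>
        (∀ a b : ℤ, 0 ≤ a → a < N → 0 ≤ b → b < N →
          mat N (m'.arr aRes) a b = mat N (m.arr aRes) a b + pathFlow l a b) ∧
        m'.reg rPos = m.reg rPos + 2 * l.tail.length ∧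
        (∀ j, j < m.reg rPos → m'.arr aOut j = m.arr aOut j) ∧
        Holds (m'.arr aOut) (m.reg rPos) (coords (m.arr 0 0) l.tail) := by
  induction hl with
  | single =>
      intro m hN hr hP hc _
      simp only [List.head?_cons, Option.some.injEq] at hc
      refine (Wp.loop_exit (by simp [hr, ← hc]) ?_).mono (by simp) (fun _ _ h => h)
      simp [pathFlow, coords, Holds]
  | @cons v l hv hl ih =>
      intro m hN hr hP hc hx
      simp only [List.head?_cons, Option.some.injEq] at hc
      have hvx := hx v (by simp)
      have hpx := hx (P v) (by simp)
      refine (Wp.loop_step (T := 7) (T' := (P v :: l).length * 8) (by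
        simp [hr, ← hc]; omega) ?_).mono (by simp; omega) (fun _ _ h => h)
      refine Wp.assign_seq (Wp.store_seq (Wp.store_seq (Wp.store_seq (Wp.store_seq
        (Wp.assign_seq (Wp.assign ?_))))))
      set m1 := m.setReg rNode ((Expr.get aPred (.reg rCur)).eval m) with hm1
      have e1 : (Expr.get aPred (.reg rCur)).eval m = P v := by simp [hP, ← hc]
      have r1 : m1.reg rNode = P v := by simp [hm1, ← hP, ← hc]
      have r1c : m1.reg rCur = v := by simp [hm1, ← hc]
      have n1 : m1.nodes = N := hN
      have i1 : ((Expr.reg rNode) * nodesE + .reg rCur).eval m1 = P v * N + v := by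
        simp [r1, r1c, n1]
      set m2 := m1.setCell aRes (((Expr.reg rNode) * nodesE + .reg rCur).eval m1)
        ((entry aRes (.reg rNode) (.reg rCur) - .const 1).eval m1) with hm2
      have n2 : m2.nodes = N := by rw [hm2, nodes_setCell _ (by decide), n1]
      have i2 : ((Expr.reg rCur) * nodesE + .reg rNode).eval m2 = v * N + P v := by
        rw [Expr.eval_add, Expr.eval_mul, eval_nodesE, n2]; simp [hm2, r1, r1c]
      set m3 := m2.setCell aRes (((Expr.reg rCur) * nodesE + .reg rNode).eval m2)
        ((entry aRes (.reg rCur) (.reg rNode) + .const 1).eval m2) with hm3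
      have hR2 : ∀ a b : ℤ, 0 ≤ a → a < N → 0 ≤ b → b < N → mat N (m2.arr aRes) a b =
          mat N (m.arr aRes) a b - if a = P v ∧ b = v then 1 else 0 := by
        intro a b a0 a1 b0 b1
        rw [hm2, i1, Memory.arr_setCell, if_pos rfl, mat_update hvx.1 hvx.2 b0 b1]
        split_ifs with h
        · obtain ⟨rfl, rfl⟩ := h
          have : (entry aRes (.reg rNode) (.reg rCur)).eval m1 = mat N (m1.arr aRes) (P b) b := by
            simp only [entry, Expr.eval_get, i1, mat]
          rw [Expr.eval_sub, this, Expr.eval_const, hm1, Memory.arr_setReg]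
        · simp [hm1]
      have hR3 : ∀ a b : ℤ, 0 ≤ a → a < N → 0 ≤ b → b < N → mat N (m3.arr aRes) a b =
          mat N (m2.arr aRes) a b + if a = v ∧ b = P v then 1 else 0 := by
        intro a b a0 a1 b0 b1
        rw [hm3, i2, Memory.arr_setCell, if_pos rfl, mat_update hpx.1 hpx.2 b0 b1]
        split_ifs with h
        · obtain ⟨rfl, rfl⟩ := h
          have : (entry aRes (.reg rCur) (.reg rNode)).eval m2 = mat N (m2.arr aRes) a (P a) := by
            simp only [entry, Expr.eval_get, i2, mat]
          rw [Expr.eval_add, this, Expr.eval_const]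
        · simp
      have hreg3 : m3.reg = m1.reg := rfl
      have hinp3 : m3.arr 0 = m.arr 0 := by simp [hm3, hm2, hm1]
      have hout3 : m3.arr aOut = m.arr aOut := by simp [hm3, hm2, hm1]
      have hpos3 : m3.reg rPos = m.reg rPos := by simp [hreg3, hm1]
      have hmod : P v - P v / m.arr 0 0 * m.arr 0 0 = P v % m.arr 0 0 := by
        rw [Int.emod_def, mul_comm]
      refine (ih (m := _) ?_ ?_ ?_ ?_ ?_).mono le_rfl ?_
      · simp only [nodes_setReg, nodes_setCell _ (show aOut ≠ 0 by decide)]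
        rw [hm3, nodes_setCell _ (by decide), n2]
      · simp [hreg3, hm1, hr]
      · simp [hm3, hm2, hm1, hP]
      · simp [hreg3, r1]
      · exact fun x h => hx x (List.mem_cons_of_mem _ h)
      · intro m' _ ⟨k1, k2, k3, k4⟩
        simp only [Memory.arr_setReg, Memory.arr_setCell, Memory.reg_setReg, Memory.reg_setCell,
          Expr.eval_reg, Expr.eval_add, Expr.eval_sub, Expr.eval_mul, Expr.eval_div, Expr.eval_const,
          eval_satE, hreg3, r1, show (13 : ℕ) ≠ 12 by decide, show (4 : ℕ) ≠ 1 by decide,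
          show (0 : ℕ) ≠ 1 by decide, if_false, if_true, hinp3, hout3, hmod] at k1 k2 k3 k4
        rw [hreg3] at hpos3
        rw [hpos3] at k2 k3 k4
        refine ⟨fun a b a0 a1 b0 b1 => ?_, ?_, fun j hj => ?_, ?_⟩
        · rw [k1 a b a0 a1 b0 b1, hR3 a b a0 a1 b0 b1, hR2 a b a0 a1 b0 b1, pathFlow]
          ring
        · rw [k2]; simp; ring
        · rw [k3 j (by omega), Function.update_of_ne (by omega), Function.update_of_ne (by omega)]
        · simp only [List.tail_cons, coords, List.flatMap_cons] at k4 ⊢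
          rw [holds_append]
          refine ⟨⟨?_, ?_, trivial⟩, by simpa using k4⟩
          · rw [k3 _ (by omega), Function.update_of_ne (by omega), Function.update_self]
          · rw [k3 _ (by omega), Function.update_self]

end RAM

/-! ### Minimum-cost flows: potentials, augmentation, and decomposition into paths -/

namespace RAM

/-- The properties of the flow network that the algorithm depends on. The nodes are
`0, …, N - 1`; `U` are the arc capacities, and the cost of the arc `(u, v)` is `H u v`. One unit of
flow on `(u, v)` counts as minus one unit on `(v, u)`, so it is paid for with `H u v - H v u` per
ordered pair. From the super source `z` an arc of capacity `C` and of cost at most `M` leads to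
every other node. -/
structure IsNetwork (N : ℕ) (U H : ℤ → ℤ → ℤ) (z : ℤ) (C : ℕ) (M : ℤ) : Prop where
  super_nonneg : 0 ≤ z
  super_lt : z < N
  cap_nonneg : ∀ u v : ℤ, 0 ≤ u → u < N → 0 ≤ v → v < N → 0 ≤ U u v
  cost_nonneg : ∀ u v : ℤ, 0 ≤ u → u < N → 0 ≤ v → v < N → 0 ≤ H u v
  cap_opposite : ∀ u v : ℤ, 0 ≤ u → u < N → 0 ≤ v → v < N → 0 < H u v → U v u = 0
  cap_super : ∀ v : ℤ, 0 ≤ v → v < N → v ≠ z → U z v = C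
  cost_super : ∀ v : ℤ, 0 ≤ v → v < N → H z v ≤ M
  big_nonneg : 0 ≤ M

/-- The net amount of flow that leaves the node `a` when every node of `T` receives one unit from
the super source `z`. -/
def demand (z : ℤ) (T : Finset ℤ) (a : ℤ) : ℤ :=
  if a = z then T.card else if a ∈ T then -1 else 0

/-- The flow `U - R` with the residual capacities `R` serves the nodes of `T`, and the potential `p`
makes the reduced costs of all residual arcs non-negative. -/
structure ResidualInv (N : ℕ) (U H : ℤ → ℤ → ℤ) (z : ℤ) (C : ℕ) (T : Finset ℤ)
    (R : ℤ → ℤ → ℤ) (p : ℤ → ℤ) : Prop where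
  nonneg : ∀ u v : ℤ, 0 ≤ u → u < N → 0 ≤ v → v < N → 0 ≤ R u v
  add_opposite : ∀ u v : ℤ, 0 ≤ u → u < N → 0 ≤ v → v < N → R u v + R v u = U u v + U v u
  net : ∀ u : ℤ, 0 ≤ u → u < N → ∑ v ∈ Finset.Ico (0 : ℤ) N, (U u v - R u v) = demand z T u
  super : ∀ v : ℤ, 0 ≤ v → v < N → v ≠ z → (C : ℤ) - T.card ≤ R z v
  reduced : ∀ u v : ℤ, 0 ≤ u → u < N → 0 ≤ v → v < N → 0 < R u v →
    0 ≤ H u v - H v u + p u - p v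
  pot_super : p z = 0
  pot_nonneg : ∀ u : ℤ, 0 ≤ u → u < N → 0 ≤ p u

/-- The reduced costs of the residual arcs, and a length that is too big to be used for the
other pairs. -/
def arcLength (H R : ℤ → ℤ → ℤ) (p : ℤ → ℤ) (M : ℤ) (u v : ℤ) : ℤ :=
  if 0 < R u v then H u v - H v u + p u - p v else M + 1

variable {N C : ℕ} {U H R R' F G G' : ℤ → ℤ → ℤ} {z M t : ℤ} {T B : Finset ℤ} {p p' D P S : ℤ → ℤ}
  {l : List ℤ}

theorem ResidualInv.init (hn : IsNetwork N U H z C M) : ResidualInv N U H z C ∅ U 0 where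
  nonneg := hn.cap_nonneg
  add_opposite _ _ _ _ _ _ := rfl
  net u _ _ := by simp [demand]
  super v h0 h1 h2 := by simp [hn.cap_super v h0 h1 h2]
  reduced u v h0 h1 h2 h3 h4 := by
    have h5 := hn.cost_nonneg u v h0 h1 h2 h3
    have h6 := hn.cap_opposite v u h2 h3 h0 h1
    have h7 := hn.cost_nonneg v u h2 h3 h0 h1
    simp only [Pi.zero_apply]
    by_contra hlt
    have := h6 (by omega)
    omega
  pot_super := rfl
  pot_nonneg _ _ _ := le_rfl

theorem ResidualInv.arcLength_nonneg (hn : IsNetwork N U H z C M)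
    (h : ResidualInv N U H z C T R p) (u v : ℤ) (h0 : 0 ≤ u) (h1 : u < N) (h2 : 0 ≤ v) (h3 : v < N) :
    0 ≤ arcLength H R p M u v := by
  unfold arcLength
  split_ifs with hR
  · exact h.reduced u v h0 h1 h2 h3 hR
  · have := hn.big_nonneg; omega

theorem IsNetwork.cost_to_super (hn : IsNetwork N U H z C M) (hC : 0 < C) (v : ℤ) (h0 : 0 ≤ v)
    (h1 : v < N) (h2 : v ≠ z) : H v z = 0 := by
  have h3 := hn.cost_nonneg v z h0 h1 hn.super_nonneg hn.super_lt
  by_contra h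
  have := hn.cap_opposite v z h0 h1 hn.super_nonneg hn.super_lt (by omega)
  rw [hn.cap_super v h0 h1 h2] at this
  omega

/-- A tree of shortest paths uses residual arcs only, since a residual arc of length at most `M`
leads from the super source to every node. -/
theorem ResidualInv.tree_residual (hn : IsNetwork N U H z C M)
    (h : ResidualInv N U H z C T R p) (hT : T.card < C)
    (ht : ShortestTree N (arcLength H R p M) z D P S) {v : ℤ} (h0 : 0 ≤ v) (h1 : v < N)
    (h2 : v ≠ z) : 0 < R (P v) v := by
  have hR : 0 < R z v := by have := h.super v h0 h1 h2; omega
  have h3 := ht.relaxed z v hn.super_nonneg hn.super_lt h0 h1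
  have h4 := ht.dist_eq v h0 h1 h2
  have h5 := ht.dist_nonneg _ (ht.pred_nonneg v h0 h1 h2) (ht.pred_lt v h0 h1 h2)
  have h6 := hn.cost_super v h0 h1
  have h7 := h.pot_nonneg v h0 h1
  have h8 := hn.cost_to_super (by omega) v h0 h1 h2
  rw [arcLength, if_pos hR, ht.dist_root, h.pot_super] at h3
  by_contra hlt
  rw [arcLength, if_neg hlt] at h4
  omega

/-- Augmentation along a shortest path from the super source to `t`, which `l` lists backwards. -/
theorem ResidualInv.augment (hn : IsNetwork N U H z C M)
    (h : ResidualInv N U H z C T R p) (hT : T.card < C)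
    (ht : ShortestTree N (arcLength H R p M) z D P S) (htT : t ∉ T) (htz : t ≠ z)
    (hl : Trace P z (t :: l)) (hnd : (t :: l).Nodup) (hlN : ∀ x ∈ t :: l, 0 ≤ x ∧ x < N)
    (hR' : ∀ a b : ℤ, 0 ≤ a → a < N → 0 ≤ b → b < N → R' a b = R a b + pathFlow (t :: l) a b)
    (hp' : ∀ a : ℤ, 0 ≤ a → a < N → p' a = p a + D a) :
    ResidualInv N U H z C (insert t T) R' p' := by
  have harc : ∀ {a b : ℤ}, (a, b) ∈ (t :: l).zip (t :: l).tail →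
      0 ≤ a ∧ a < N ∧ a ≠ z ∧ b = P a ∧ 0 < R b a := by
    intro a b hab
    obtain ⟨h1, rfl⟩ := hl.of_mem_zip hab
    obtain ⟨h2, h3⟩ := hlN a (mem_of_mem_zip_tail hab).1
    exact ⟨h2, h3, h1, rfl, h.tree_residual hn hT ht h2 h3 h1⟩
  have hlast : (t :: l).getLast (by simp) = z := by
    have := hl.getLast?
    rwa [List.getLast?_eq_some_getLast (by simp), Option.some.injEq] at this
  refine ⟨?_, ?_, ?_, ?_, ?_, ?_, ?_⟩
  · intro u v h0 h1 h2 h3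
    have h4 := h.nonneg u v h0 h1 h2 h3
    rw [hR' u v h0 h1 h2 h3]
    rcases pathFlow_cases hnd u v with ⟨_, h5⟩ | ⟨_, h6, h5⟩ | ⟨_, _, h5⟩
    · omega
    · have := (harc h6).2.2.2.2; omega
    · omega
  · intro u v h0 h1 h2 h3
    rw [hR' u v h0 h1 h2 h3, hR' v u h2 h3 h0 h1, pathFlow_antisymm _ u v,
      ← h.add_opposite u v h0 h1 h2 h3]
    ring
  · intro u h0 h1
    have h2 := h.net u h0 h1
    have h3 := sum_pathFlow (s := Finset.Ico (0 : ℤ) N) t l (fun x hx => by simpa using hlN x hx) u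
    have h4 : ∑ v ∈ Finset.Ico (0 : ℤ) N, (U u v - R' u v) =
        ∑ v ∈ Finset.Ico (0 : ℤ) N, (U u v - R u v)
          - ∑ v ∈ Finset.Ico (0 : ℤ) N, pathFlow (t :: l) u v := by
      rw [← Finset.sum_sub_distrib]
      refine Finset.sum_congr rfl fun v hv => ?_
      rw [Finset.mem_Ico] at hv
      rw [hR' u v h0 h1 hv.1 hv.2]; ring
    rw [h4, h2, h3, hlast, demand, demand, Finset.card_insert_of_notMem htT]
    simp only [Finset.mem_insert]
    by_cases hu : u = z
    · subst hu; simp [htz.symm]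
    · by_cases hut : u = t
      · subst hut; simp [htT, hu]
      · simp [hu, hut]
  · intro v h0 h1 h2
    have h3 := h.super v h0 h1 h2
    rw [hR' z v hn.super_nonneg hn.super_lt h0 h1, Finset.card_insert_of_notMem htT]
    push_cast
    rcases pathFlow_cases hnd z v with ⟨_, h5⟩ | ⟨_, h6, h5⟩ | ⟨_, _, h5⟩ <;> omega
  · intro u v h0 h1 h2 h3 hpos
    rw [hp' u h0 h1, hp' v h2 h3]
    by_cases hR : 0 < R u v
    · have := ht.relaxed u v h0 h1 h2 h3
      rw [arcLength, if_pos hR] at this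
      omega
    · rw [hR' u v h0 h1 h2 h3] at hpos
      rcases pathFlow_cases hnd u v with ⟨h6, h5⟩ | ⟨_, h6, h5⟩ | ⟨_, _, h5⟩
      · obtain ⟨_, _, k3, rfl, k5⟩ := harc h6
        have := ht.dist_eq u h0 h1 k3
        rw [arcLength, if_pos k5] at this
        omega
      · omega
      · omega
  · rw [hp' z hn.super_nonneg hn.super_lt, h.pot_super, ht.dist_root]; rfl
  · intro u h0 h1
    rw [hp' u h0 h1]
    exact add_nonneg (h.pot_nonneg u h0 h1) (ht.dist_nonneg u h0 h1)

/-- Complementary slackness: the flow is a cheapest one among all flows with the same demands. The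
difference of two such flows is a circulation, so its cost equals its reduced cost, and every term
of the latter is non-negative. -/
theorem ResidualInv.cost_le (h : ResidualInv N U H z C T R p)
    (hanti : ∀ u v : ℤ, F v u = -F u v)
    (hcap : ∀ u v : ℤ, 0 ≤ u → u < N → 0 ≤ v → v < N → F u v ≤ U u v)
    (hnet : ∀ u : ℤ, 0 ≤ u → u < N → ∑ v ∈ Finset.Ico (0 : ℤ) N, F u v = demand z T u) :
    ∑ u ∈ Finset.Ico (0 : ℤ) N, ∑ v ∈ Finset.Ico (0 : ℤ) N, (U u v - R u v) * (H u v - H v u) ≤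
      ∑ u ∈ Finset.Ico (0 : ℤ) N, ∑ v ∈ Finset.Ico (0 : ℤ) N, F u v * (H u v - H v u) := by
  set s := Finset.Ico (0 : ℤ) N with hs
  have hmem : ∀ u ∈ s, 0 ≤ u ∧ u < N := fun u hu => by simpa [hs] using hu
  set E : ℤ → ℤ → ℤ := fun u v => F u v - (U u v - R u v) with hE
  have hEanti : ∀ u ∈ s, ∀ v ∈ s, E v u = -E u v := by
    intro u hu v hv
    have := h.add_opposite u v (hmem u hu).1 (hmem u hu).2 (hmem v hv).1 (hmem v hv).2
    have := hanti u v
    simp only [hE]; omega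
  have hEnet : ∀ u ∈ s, ∑ v ∈ s, E u v = 0 := by
    intro u hu
    simp only [hE]
    rw [Finset.sum_sub_distrib, hnet u (hmem u hu).1 (hmem u hu).2,
      h.net u (hmem u hu).1 (hmem u hu).2, sub_self]
  have h1 : ∑ u ∈ s, ∑ v ∈ s, E u v * p u = 0 :=
    Finset.sum_eq_zero fun u hu => by rw [← Finset.sum_mul, hEnet u hu, zero_mul]
  have h2 : ∑ u ∈ s, ∑ v ∈ s, E u v * p v = 0 := by
    rw [Finset.sum_comm]
    refine Finset.sum_eq_zero fun v hv => ?_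
    rw [← Finset.sum_mul, Finset.sum_congr rfl fun u hu => hEanti v hv u hu, Finset.sum_neg_distrib,
      hEnet v hv, neg_zero, zero_mul]
  have h3 : 0 ≤ ∑ u ∈ s, ∑ v ∈ s, E u v * (H u v - H v u + p u - p v) := by
    refine Finset.sum_nonneg fun u hu => Finset.sum_nonneg fun v hv => ?_
    obtain ⟨u0, u1⟩ := hmem u hu
    obtain ⟨v0, v1⟩ := hmem v hv
    have hb := hEanti u hu v hv
    rcases lt_trichotomy 0 (E u v) with hpos | hzero | hneg
    · refine mul_nonneg hpos.le (h.reduced u v u0 u1 v0 v1 ?_)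
      have := hcap u v u0 u1 v0 v1
      simp only [hE] at hpos; omega
    · rw [← hzero, zero_mul]
    · have h4 := h.reduced v u v0 v1 u0 u1 (by
        have := hcap v u v0 v1 u0 u1
        simp only [hE] at hb hneg; omega)
      exact mul_nonneg_of_nonpos_of_nonpos hneg.le (by omega)
  have h4 : ∑ u ∈ s, ∑ v ∈ s, E u v * (H u v - H v u + p u - p v) =
      ∑ u ∈ s, ∑ v ∈ s, F u v * (H u v - H v u)
        - ∑ u ∈ s, ∑ v ∈ s, (U u v - R u v) * (H u v - H v u)
        + ∑ u ∈ s, ∑ v ∈ s, E u v * p u - ∑ u ∈ s, ∑ v ∈ s, E u v * p v := by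
    simp only [← Finset.sum_sub_distrib, ← Finset.sum_add_distrib]
    refine Finset.sum_congr rfl fun u _ => Finset.sum_congr rfl fun v _ => ?_
    simp only [hE]; ring
  rw [h1, h2] at h4
  linarith

/-- The paths `L t` for `t ∈ T` have been split off from the flow `F`, which serves the nodes of
`B`; the negative of the remaining flow is `G`. -/
structure DecompInv (N : ℕ) (z : ℤ) (B : Finset ℤ) (F : ℤ → ℤ → ℤ) (T : Finset ℤ)
    (G : ℤ → ℤ → ℤ) (L : ℤ → List ℤ) : Prop where
  anti : ∀ u v : ℤ, 0 ≤ u → u < N → 0 ≤ v → v < N → G v u = -G u v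
  net : ∀ u : ℤ, 0 ≤ u → u < N → ∑ v ∈ Finset.Ico (0 : ℤ) N, -G u v = demand z (B \ T) u
  uses : ∀ u v : ℤ, 0 ≤ u → u < N → 0 ≤ v → v < N →
    ((T.filter fun t => (u, v) ∈ (L t).zip (L t).tail).card : ℤ) + max (-G u v) 0 = max (F u v) 0
  sum : ∀ u v : ℤ, 0 ≤ u → u < N → 0 ≤ v → v < N →
    F u v = -G u v + ∑ t ∈ T, pathFlow (L t) u v
  head : ∀ t ∈ T, (L t).head? = some z
  last : ∀ t ∈ T, (L t).getLast? = some t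
  nodup : ∀ t ∈ T, (L t).Nodup
  range : ∀ t ∈ T, ∀ x ∈ L t, 0 ≤ x ∧ x < N
  pos : ∀ t ∈ T, ∀ u v, (u, v) ∈ (L t).zip (L t).tail → 0 < F u v

theorem DecompInv.init {L : ℤ → List ℤ}
    (hanti : ∀ u v : ℤ, 0 ≤ u → u < N → 0 ≤ v → v < N → F v u = -F u v)
    (hnet : ∀ u : ℤ, 0 ≤ u → u < N → ∑ v ∈ Finset.Ico (0 : ℤ) N, F u v = demand z B u)
    (hG : ∀ u v : ℤ, 0 ≤ u → u < N → 0 ≤ v → v < N → G u v = -F u v) :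
    DecompInv N z B F ∅ G L where
  anti u v h0 h1 h2 h3 := by
    rw [hG u v h0 h1 h2 h3, hG v u h2 h3 h0 h1, hanti u v h0 h1 h2 h3]
  net u h0 h1 := by
    rw [Finset.sdiff_empty, ← hnet u h0 h1]
    refine Finset.sum_congr rfl fun v hv => ?_
    rw [Finset.mem_Ico] at hv
    rw [hG u v h0 h1 hv.1 hv.2, neg_neg]
  uses u v h0 h1 h2 h3 := by simp [hG u v h0 h1 h2 h3]
  sum u v h0 h1 h2 h3 := by simp [hG u v h0 h1 h2 h3]
  head := by simp
  last := by simp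
  nodup := by simp
  range := by simp
  pos := by simp

/-- The arc lengths for finding a path of positive flow. -/
def supportLength (G : ℤ → ℤ → ℤ) (u v : ℤ) : ℤ := if 0 < G u v then 0 else 1

theorem supportLength_nonneg (G : ℤ → ℤ → ℤ) (u v : ℤ) : 0 ≤ supportLength G u v := by
  unfold supportLength; split_ifs <;> omega

/-- The flow leads from the super source to every node `t` that is still to be served: no flow
enters the set of the nodes from which `t` can be reached, so a source must lie in it. -/
theorem DecompInv.dist_super {L : ℤ → List ℤ} (h : DecompInv N z B F T G L) (hz : 0 ≤ z)
    (hzN : z < N) (htB : t ∈ B) (htT : t ∉ T) (ht0 : 0 ≤ t) (htN : t < N) (hzB : z ∉ B)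
    (ht : ShortestTree N (supportLength G) t D P S) : D z = 0 := by
  by_contra hne
  set s := Finset.Ico (0 : ℤ) N with hs
  have hmem : ∀ u ∈ s, 0 ≤ u ∧ u < N := fun u hu => by simpa [hs] using hu
  set Z := s.filter fun v => D v = 0 with hZ
  have hZs : Z ⊆ s := Finset.filter_subset _ _
  have htZ : t ∈ Z := by simp [hZ, hs, ht0, htN, ht.dist_root]
  have hneg : ∑ u ∈ Z, ∑ v ∈ s, -G u v < 0 := by
    refine Finset.sum_neg' (fun u hu => ?_) ⟨t, htZ, ?_⟩
    · rw [h.net u (hmem u (hZs hu)).1 (hmem u (hZs hu)).2, demand, if_neg]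
      · split_ifs <;> simp
      · rintro rfl; exact hne (Finset.mem_filter.1 hu).2
    · rw [h.net t ht0 htN, demand, if_neg (by rintro rfl; exact hzB htB), if_pos (by simp [htB, htT])]
      simp
  have hin : ∑ u ∈ Z, ∑ v ∈ Z, -G u v = 0 := by
    have h1 : ∑ u ∈ Z, ∑ v ∈ Z, -G u v = ∑ u ∈ Z, ∑ v ∈ Z, G u v := by
      rw [Finset.sum_comm]
      refine Finset.sum_congr rfl fun u hu => Finset.sum_congr rfl fun v hv => ?_
      obtain ⟨u0, u1⟩ := hmem u (hZs hu)
      obtain ⟨v0, v1⟩ := hmem v (hZs hv)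
      rw [h.anti u v u0 u1 v0 v1, neg_neg]
    simp only [Finset.sum_neg_distrib] at h1 ⊢
    omega
  have hout : 0 ≤ ∑ u ∈ Z, ∑ v ∈ s \ Z, -G u v := by
    refine Finset.sum_nonneg fun u hu => Finset.sum_nonneg fun v hv => ?_
    obtain ⟨hv, hvZ⟩ := Finset.mem_sdiff.1 hv
    obtain ⟨u0, u1⟩ := hmem u (hZs hu)
    obtain ⟨v0, v1⟩ := hmem v hv
    by_contra hlt
    have h1 := ht.relaxed u v u0 u1 v0 v1
    rw [supportLength, if_pos (by omega), (Finset.mem_filter.1 hu).2] at h1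
    have := ht.dist_nonneg v v0 v1
    exact hvZ (Finset.mem_filter.2 ⟨hv, by omega⟩)
  have hsplit : ∀ u ∈ Z, ∑ v ∈ s, -G u v = ∑ v ∈ s \ Z, -G u v + ∑ v ∈ Z, -G u v := fun u _ =>
    (Finset.sum_sdiff hZs).symm
  rw [Finset.sum_congr rfl hsplit, Finset.sum_add_distrib, hin] at hneg
  omega

theorem Trace.dist_eq_zero (hl : Trace P t l) (ht : ShortestTree N (supportLength G) t D P S)
    (hlN : ∀ x ∈ l, 0 ≤ x ∧ x < N) (h0 : ∀ x, l.head? = some x → D x = 0) : ∀ x ∈ l, D x = 0 := by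
  induction hl with
  | single => simpa using ht.dist_root
  | @cons v l hv _ ih =>
      have hv0 : D v = 0 := h0 v rfl
      have hvN := hlN v (by simp)
      have h1 := ht.dist_eq v hvN.1 hvN.2 hv
      have h2 := ht.dist_nonneg _ (ht.pred_nonneg v hvN.1 hvN.2 hv) (ht.pred_lt v hvN.1 hvN.2 hv)
      have h3 := supportLength_nonneg G (P v) v
      have := ih (fun x hx => hlN x (List.mem_cons_of_mem _ hx)) (by
        rintro x hx
        simp only [List.head?_cons, Option.some.injEq] at hx
        subst hx; omega)
      intro x hx
      rcases List.mem_cons.1 hx with rfl | hx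
      exacts [hv0, this x hx]

/-- Splitting off a path from the super source to `t`. -/
theorem DecompInv.step {L : ℤ → List ℤ} (h : DecompInv N z B F T G L) (hz : 0 ≤ z)
    (hzN : z < N) (htB : t ∈ B) (htT : t ∉ T) (ht0 : 0 ≤ t) (htN : t < N) (hzB : z ∉ B)
    (ht : ShortestTree N (supportLength G) t D P S) (hl : Trace P t (z :: l))
    (hnd : (z :: l).Nodup) (hlN : ∀ x ∈ z :: l, 0 ≤ x ∧ x < N)
    (hG' : ∀ a b : ℤ, 0 ≤ a → a < N → 0 ≤ b → b < N → G' a b = G a b + pathFlow (z :: l) a b) :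
    DecompInv N z B F (insert t T) G' (Function.update L t (z :: l)) := by
  have hD := hl.dist_eq_zero ht hlN fun x hx => by
    simp only [List.head?_cons, Option.some.injEq] at hx
    subst hx; exact h.dist_super hz hzN htB htT ht0 htN hzB ht
  have hlast : (z :: l).getLast (by simp) = t := by
    have := hl.getLast?
    rwa [List.getLast?_eq_some_getLast (by simp), Option.some.injEq] at this
  have hzt : z ≠ t := by rintro rfl; exact hzB htB
  have harc : ∀ {a b : ℤ}, (a, b) ∈ (z :: l).zip (z :: l).tail →
      0 ≤ a ∧ a < N ∧ 0 ≤ b ∧ b < N ∧ G a b < 0 := by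
    intro a b hab
    obtain ⟨ma, mb⟩ := mem_of_mem_zip_tail hab
    replace mb := List.mem_of_mem_tail mb
    obtain ⟨a0, a1⟩ := hlN a ma
    obtain ⟨b0, b1⟩ := hlN b mb
    obtain ⟨h1, rfl⟩ := hl.of_mem_zip hab
    have h2 := ht.dist_eq a a0 a1 h1
    rw [hD a ma, hD _ mb, supportLength] at h2
    have h3 : 0 < G (P a) a := by
      by_contra h3
      rw [if_neg h3] at h2; omega
    have := h.anti a (P a) a0 a1 b0 b1
    exact ⟨a0, a1, b0, b1, by omega⟩
  have hLne : ∀ x ∈ T, x ≠ t := by rintro x hx rfl; exact htT hx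
  have hL : ∀ x ∈ T, Function.update L t (z :: l) x = L x := fun x hx => by simp [hLne x hx]
  have hLt : Function.update L t (z :: l) t = z :: l := by simp
  have hforall : ∀ {Q : ℤ → List ℤ → Prop}, Q t (z :: l) → (∀ x ∈ T, Q x (L x)) →
      ∀ x ∈ insert t T, Q x (Function.update L t (z :: l) x) := by
    intro Q h1 h2 x hx
    rcases Finset.mem_insert.1 hx with rfl | hx
    · rwa [hLt]
    · rw [hL x hx]; exact h2 x hx
  refine ⟨?_, ?_, ?_, ?_, ?_, ?_, ?_, ?_, ?_⟩
  · intro u v h0 h1 h2 h3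
    rw [hG' u v h0 h1 h2 h3, hG' v u h2 h3 h0 h1, pathFlow_antisymm, h.anti u v h0 h1 h2 h3]
    ring
  · intro u h0 h1
    have h2 := h.net u h0 h1
    have h3 := sum_pathFlow (s := Finset.Ico (0 : ℤ) N) z l (fun x hx => by simpa using hlN x hx) u
    have h4 : ∑ v ∈ Finset.Ico (0 : ℤ) N, -G' u v =
        ∑ v ∈ Finset.Ico (0 : ℤ) N, -G u v
          - ∑ v ∈ Finset.Ico (0 : ℤ) N, pathFlow (z :: l) u v := by
      rw [← Finset.sum_sub_distrib]
      refine Finset.sum_congr rfl fun v hv => ?_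
      rw [Finset.mem_Ico] at hv
      rw [hG' u v h0 h1 hv.1 hv.2]; ring
    have hcard : ((B \ T).card : ℤ) = (B \ insert t T).card + 1 := by
      have : B \ T = insert t (B \ insert t T) := by
        ext x; simp only [Finset.mem_sdiff, Finset.mem_insert, not_or]
        by_cases hx : x = t
        · subst hx; simp [htB, htT]
        · simp [hx]
      rw [this, Finset.card_insert_of_notMem (by simp)]
      push_cast; rfl
    rw [h4, h2, h3, hlast, demand, demand, hcard]
    simp only [Finset.mem_sdiff, Finset.mem_insert]
    by_cases hu : u = z
    · subst hu; simp [hzt]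
    · by_cases hut : u = t
      · subst hut; simp [htT, htB, hu]
      · simp [hu, hut]
  · intro u v h0 h1 h2 h3
    have h4 := h.uses u v h0 h1 h2 h3
    have hcongr : (T.filter fun x => (u, v) ∈ (Function.update L t (z :: l) x).zip
        (Function.update L t (z :: l) x).tail) = T.filter fun x => (u, v) ∈ (L x).zip (L x).tail :=
      Finset.filter_congr fun x hx => by rw [hL x hx]
    rw [Finset.filter_insert, hcongr, hLt, hG' u v h0 h1 h2 h3]
    rcases pathFlow_cases hnd u v with ⟨h6, h5⟩ | ⟨h7, h6, h5⟩ | ⟨h7, h6, h5⟩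
    · rw [if_pos h6, Finset.card_insert_of_notMem (by simp [htT]), h5]
      have := (harc h6).2.2.2.2
      push_cast; omega
    · rw [if_neg h7, h5]
      have := (harc h6).2.2.2.2
      have := h.anti u v h0 h1 h2 h3
      omega
    · rw [if_neg h7, h5, add_zero]; exact h4
  · intro u v h0 h1 h2 h3
    have h4 := h.sum u v h0 h1 h2 h3
    rw [Finset.sum_insert htT, hLt, hG' u v h0 h1 h2 h3,
      Finset.sum_congr rfl fun x hx => by rw [hL x hx]]
    omega
  · exact hforall (Q := fun _ l => l.head? = some z) rfl h.head
  · exact hforall (Q := fun x l => l.getLast? = some x) hl.getLast? h.last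
  · exact hforall (Q := fun _ l => l.Nodup) hnd h.nodup
  · exact hforall (Q := fun _ l => ∀ x ∈ l, 0 ≤ x ∧ x < N) hlN h.range
  · refine hforall (Q := fun _ l => ∀ u v, (u, v) ∈ l.zip l.tail → 0 < F u v) ?_ h.pos
    intro u v huv
    obtain ⟨a0, a1, b0, b1, hlt⟩ := harc huv
    have := h.uses u v a0 a1 b0 b1
    omega

end RAM

/-! ### The successive shortest path algorithm as a program -/

namespace RAM

/-- Runs `c` for all rows and columns of a square matrix. -/
def forEntries (c : Prog) : Prog := .forLoop rRow nodesE (.forLoop rCol nodesE c)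

/-- If the body turns `Pre u v` into `Post u v` for the current entry and preserves both properties
for all other entries, then the double loop establishes `Post` for all entries. -/
theorem Wp.forEntries {c : Prog} {T N : ℕ} {m : Memory} {Q : Memory → Prop}
    (Pre Post : ℤ → ℤ → Memory → Prop)
    (hr : rRow ∉ c.regs) (hc : rCol ∉ c.regs) (h0 : 0 ∉ c.arrs) (hN : m.nodes = N)
    (hPre : ∀ u v m x k, x = rRow ∨ x = rCol → Pre u v m → Pre u v (m.setReg x k))
    (hPost : ∀ u v m x k, x = rRow ∨ x = rCol → Post u v m → Post u v (m.setReg x k))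
    (hinit : ∀ u v : ℤ, 0 ≤ u → u < N → 0 ≤ v → v < N → Pre u v m)
    (hbody : ∀ u v : ℤ, 0 ≤ u → u < N → 0 ≤ v → v < N → ∀ m',
      Agree (rRow :: rCol :: c.regs) c.arrs m m' → m'.reg rRow = u → m'.reg rCol = v →
      Pre u v m' → Wp c T m' fun m'' => Post u v m'' ∧
        ∀ u' v' : ℤ, 0 ≤ u' → u' < N → 0 ≤ v' → v' < N → ¬(u' = u ∧ v' = v) →
          (Pre u' v' m' → Pre u' v' m'') ∧ (Post u' v' m' → Post u' v' m''))
    (hQ : ∀ m', Agree (rRow :: rCol :: c.regs) c.arrs m m' →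
      (∀ u v : ℤ, 0 ≤ u → u < N → 0 ≤ v → v < N → Post u v m') → Q m') :
    Wp (forEntries c) (N * (N * (T + 2) + 2 + 2) + 2) m Q := by
  have hsub : ∀ {m m'}, Agree (rRow :: (Prog.forLoop rCol nodesE c).regs)
      (Prog.forLoop rCol nodesE c).arrs m m' → Agree (rRow :: rCol :: c.regs) c.arrs m m' :=
    fun h => h.mono (by intro x; simp [Prog.forLoop, Prog.regs]; tauto)
      (by intro x; simp [Prog.forLoop, Prog.arrs])
  have hnodes : ∀ {X : List ℕ} {m m'}, Agree X c.arrs m m' → m.nodes = N →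
      nodesE.eval m' = N := fun h h' => by rw [eval_nodesE, h.nodes h0, h']
  refine Wp.forLoop (n := N) (T := N * (T + 2) + 2) (fun i m' => ∀ u v : ℤ, 0 ≤ u → u < N → 0 ≤ v →
    v < N → (u < i → Post u v m') ∧ (i ≤ u → Pre u v m')) ?_ ?_ ?_ ?_ ?_ ?_
  · simp [Prog.forLoop, Prog.regs, hr]
  · intro i m' k h u v u0 u1 v0 v1
    exact ⟨fun hu => hPost _ _ _ _ _ (.inl rfl) ((h u v u0 u1 v0 v1).1 hu),
      fun hu => hPre _ _ _ _ _ (.inl rfl) ((h u v u0 u1 v0 v1).2 hu)⟩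
  · intro m' h
    exact hnodes (hsub h) hN
  · intro u v u0 u1 v0 v1
    exact ⟨fun h => by push_cast at h; omega, fun _ => hinit u v u0 u1 v0 v1⟩
  · intro i hi m1 ha1 hr1 hI
    have hN1 : m1.nodes = N := by simpa using hnodes (hsub ha1) hN
    refine Wp.forLoop (n := N) (T := T) (fun j m' => ∀ u v : ℤ, 0 ≤ u → u < N → 0 ≤ v →
      v < N → (u < i ∨ u = i ∧ v < j → Post u v m') ∧ (i < u ∨ u = i ∧ j ≤ v → Pre u v m'))
      hc ?_ ?_ ?_ ?_ ?_
    · intro j m' k h u v u0 u1 v0 v1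
      exact ⟨fun hu => hPost _ _ _ _ _ (.inr rfl) ((h u v u0 u1 v0 v1).1 hu),
        fun hu => hPre _ _ _ _ _ (.inr rfl) ((h u v u0 u1 v0 v1).2 hu)⟩
    · intro m' h
      exact hnodes h hN1
    · intro u v u0 u1 v0 v1
      have := hI u v u0 u1 v0 v1
      exact ⟨fun h => this.1 (by push_cast at h; omega), fun h => this.2 (by omega)⟩
    · intro j hj m2 ha2 hr2 hJ
      have ha := (hsub ha1).trans (ha2.mono (by intro x; simp; tauto) (fun _ h => h))
      have hrow : m2.reg rRow = i := (ha2.reg _ (by simp [hr])).trans hr1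
      refine (hbody i j (by omega) (by omega) (by omega) (by omega) m2 ha hrow hr2
        ((hJ i j (by omega) (by omega) (by omega) (by omega)).2 (by omega))).mono le_rfl ?_
      intro m3 _ ⟨h1, h2⟩ u v u0 u1 v0 v1
      by_cases huv : u = i ∧ v = j
      · obtain ⟨rfl, rfl⟩ := huv
        exact ⟨fun _ => h1, fun h => by push_cast at h; omega⟩
      · obtain ⟨k1, k2⟩ := h2 u v u0 u1 v0 v1 huv
        obtain ⟨k3, k4⟩ := hJ u v u0 u1 v0 v1
        exact ⟨fun h => k2 (k3 (by push_cast at h; omega)),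
          fun h => k1 (k4 (by push_cast at h; omega))⟩
    · intro m2 _ hJ u v u0 u1 v0 v1
      obtain ⟨k3, k4⟩ := hJ u v u0 u1 v0 v1
      exact ⟨fun h => k3 (by push_cast at h; omega), fun h => k4 (by push_cast at h; omega)⟩
  · intro m' ha h
    refine hQ m' (hsub ha) fun u v u0 u1 v0 v1 => (h u v u0 u1 v0 v1).1 u1

variable {N : ℕ}

/-- Stores the reduced costs of the residual arcs as arc lengths. -/
def fillReducedCosts : Prog :=
  forEntries
    (.ite (.lt (.const 0) (entry aRes (.reg rRow) (.reg rCol)))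
      (setEntry aLen (.reg rRow) (.reg rCol)
        (entry aCost (.reg rRow) (.reg rCol) - entry aCost (.reg rCol) (.reg rRow)
          + .get aPot (.reg rRow) - .get aPot (.reg rCol)))
      (setEntry aLen (.reg rRow) (.reg rCol) (.reg rBig + .const 1)))

/-- The effect of a loop body that writes one entry of one matrix. -/
theorem entry_of_setCell {a : ℕ} {f : ℤ → ℤ → ℤ} {m : Memory} {u v i x : ℤ}
    (hi : i = u * N + v) (hx : x = f u v) (v0 : 0 ≤ v) (v1 : v < N) :
    mat N ((m.setCell a i x).arr a) u v = f u v ∧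
      ∀ u' v' : ℤ, 0 ≤ u' → u' < N → 0 ≤ v' → v' < N → ¬(u' = u ∧ v' = v) →
        (True → True) ∧
          (mat N (m.arr a) u' v' = f u' v' → mat N ((m.setCell a i x).arr a) u' v' = f u' v') := by
  subst hi
  rw [Memory.arr_setCell, if_pos rfl]
  constructor
  · rw [mat_update v0 v1 v0 v1, if_pos ⟨rfl, rfl⟩, hx]
  · intro u' v' _ _ w0 w1 hne
    refine ⟨fun _ => trivial, fun hh => ?_⟩
    rw [mat_update v0 v1 w0 w1, if_neg hne, hh]

theorem wp_fillReducedCosts {m : Memory} (hN : m.nodes = N) :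
    Wp fillReducedCosts (N * (N * (2 + 2) + 2 + 2) + 2) m fun m' =>
      ∀ u v : ℤ, 0 ≤ u → u < N → 0 ≤ v → v < N → mat N (m'.arr aLen) u v =
        arcLength (mat N (m.arr aCost)) (mat N (m.arr aRes)) (m.arr aPot) (m.reg rBig) u v := by
  refine Wp.forEntries (N := N) (fun _ _ _ => True) (fun u v m' => mat N (m'.arr aLen) u v =
    arcLength (mat N (m.arr aCost)) (mat N (m.arr aRes)) (m.arr aPot) (m.reg rBig) u v)
    (by decide) (by decide) (by decide) hN (fun _ _ _ _ _ _ _ => trivial)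
    (fun _ _ _ _ _ _ h => h) (fun _ _ _ _ _ _ => trivial) ?_ (fun _ _ h => h)
  intro u v u0 u1 v0 v1 m' ha hr hc _
  have hN' : m'.nodes = N := (ha.nodes (by decide)).trans hN
  have hR : m'.arr aRes = m.arr aRes := ha.arr _ (by decide)
  have hH : m'.arr aCost = m.arr aCost := ha.arr _ (by decide)
  have hp : m'.arr aPot = m.arr aPot := ha.arr _ (by decide)
  have hB : m'.reg rBig = m.reg rBig := ha.reg _ (by decide)
  have hres : (entry aRes (.reg rRow) (.reg rCol)).eval m' = mat N (m.arr aRes) u v := by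
    simp [entry, mat, hr, hc, hN', hR]
  refine Wp.ite (fun hs => Wp.store ?_) (fun hs => Wp.store ?_)
  · rw [Expr.eval_lt_ne_zero, hres, Expr.eval_const] at hs
    refine entry_of_setCell ?_ ?_ v0 v1
    · rw [Expr.eval_add, Expr.eval_mul, eval_nodesE, hN', Expr.eval_reg, Expr.eval_reg, hr, hc]
    · rw [arcLength, if_pos hs]
      simp [entry, mat, hr, hc, hN', hH, hp]
  · rw [Expr.eval_lt_eq_zero, hres, Expr.eval_const] at hs
    refine entry_of_setCell ?_ ?_ v0 v1
    · rw [Expr.eval_add, Expr.eval_mul, eval_nodesE, hN', Expr.eval_reg, Expr.eval_reg, hr, hc]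
    · simp [arcLength, not_lt.2 hs, hB]

/-- Stores the length `0` for the arcs with positive residual capacity, and `1` for all other pairs
of nodes. -/
def fillSupport : Prog :=
  forEntries
    (.ite (.lt (.const 0) (entry aRes (.reg rRow) (.reg rCol)))
      (setEntry aLen (.reg rRow) (.reg rCol) (.const 0))
      (setEntry aLen (.reg rRow) (.reg rCol) (.const 1)))

theorem wp_fillSupport {m : Memory} (hN : m.nodes = N) :
    Wp fillSupport (N * (N * (2 + 2) + 2 + 2) + 2) m fun m' =>
      ∀ u v : ℤ, 0 ≤ u → u < N → 0 ≤ v → v < N → mat N (m'.arr aLen) u v =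
        supportLength (mat N (m.arr aRes)) u v := by
  refine Wp.forEntries (N := N) (fun _ _ _ => True) (fun u v m' => mat N (m'.arr aLen) u v =
    supportLength (mat N (m.arr aRes)) u v)
    (by decide) (by decide) (by decide) hN (fun _ _ _ _ _ _ _ => trivial)
    (fun _ _ _ _ _ _ h => h) (fun _ _ _ _ _ _ => trivial) ?_ (fun _ _ h => h)
  intro u v u0 u1 v0 v1 m' ha hr hc _
  have hN' : m'.nodes = N := (ha.nodes (by decide)).trans hN
  have hR : m'.arr aRes = m.arr aRes := ha.arr _ (by decide)
  have hres : (entry aRes (.reg rRow) (.reg rCol)).eval m' = mat N (m.arr aRes) u v := by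
    simp [entry, mat, hr, hc, hN', hR]
  refine Wp.ite (fun hs => Wp.store ?_) (fun hs => Wp.store ?_)
  · rw [Expr.eval_lt_ne_zero, hres, Expr.eval_const] at hs
    refine entry_of_setCell ?_ ?_ v0 v1
    · rw [Expr.eval_add, Expr.eval_mul, eval_nodesE, hN', Expr.eval_reg, Expr.eval_reg, hr, hc]
    · simp [supportLength, hs]
  · rw [Expr.eval_lt_eq_zero, hres, Expr.eval_const] at hs
    refine entry_of_setCell ?_ ?_ v0 v1
    · rw [Expr.eval_add, Expr.eval_mul, eval_nodesE, hN', Expr.eval_reg, Expr.eval_reg, hr, hc]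
    · simp [supportLength, not_lt.2 hs]

/-- Replaces the residual capacities by the negative of the flow. -/
def negateFlow : Prog :=
  forEntries (setEntry aRes (.reg rRow) (.reg rCol)
    (entry aRes (.reg rRow) (.reg rCol) - entry aCap (.reg rRow) (.reg rCol)))

theorem wp_negateFlow {m : Memory} (hN : m.nodes = N) :
    Wp negateFlow (N * (N * (1 + 2) + 2 + 2) + 2) m fun m' =>
      ∀ u v : ℤ, 0 ≤ u → u < N → 0 ≤ v → v < N → mat N (m'.arr aRes) u v =
        -(mat N (m.arr aCap) u v - mat N (m.arr aRes) u v) := by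
  refine Wp.forEntries (N := N)
    (fun u v m' => mat N (m'.arr aRes) u v = mat N (m.arr aRes) u v)
    (fun u v m' => mat N (m'.arr aRes) u v = -(mat N (m.arr aCap) u v - mat N (m.arr aRes) u v))
    (by decide) (by decide) (by decide) hN (fun _ _ _ _ _ _ h => h)
    (fun _ _ _ _ _ _ h => h) (fun _ _ _ _ _ _ => rfl) ?_ (fun _ _ h => h)
  intro u v u0 u1 v0 v1 m' ha hr hc hpre
  have hN' : m'.nodes = N := (ha.nodes (by decide)).trans hN
  have hU : m'.arr aCap = m.arr aCap := ha.arr _ (by decide)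
  have hi : ((Expr.reg rRow) * nodesE + .reg rCol).eval m' = u * N + v := by simp [hr, hc, hN']
  refine Wp.store ?_
  rw [hi]
  have hval : (entry aRes (.reg rRow) (.reg rCol) - entry aCap (.reg rRow) (.reg rCol)).eval m' =
      -(mat N (m.arr aCap) u v - mat N (m.arr aRes) u v) := by
    rw [← hpre, ← hU, Expr.eval_sub, entry, entry, Expr.eval_get, Expr.eval_get, hi, mat, mat]
    ring
  rw [hval]
  constructor
  · rw [Memory.arr_setCell, if_pos rfl, mat_update v0 v1 v0 v1, if_pos ⟨rfl, rfl⟩]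
  · intro u' v' _ _ w0 w1 hne
    rw [Memory.arr_setCell, if_pos rfl, mat_update v0 v1 w0 w1, if_neg hne]
    exact ⟨id, id⟩

/-- Adds the distances to the potentials. -/
def updatePotentials : Prog :=
  .forLoop rCol nodesE
    (.store aPot (.reg rCol) (.get aPot (.reg rCol) + .get aDist (.reg rCol)))

theorem wp_updatePotentials {m : Memory} (hN : m.nodes = N) :
    Wp updatePotentials (N * (1 + 2) + 2) m fun m' =>
      ∀ v : ℤ, 0 ≤ v → v < N → m'.arr aPot v = m.arr aPot v + m.arr aDist v := by
  refine Wp.forLoop (n := N) (fun i m' => ∀ v : ℤ, 0 ≤ v → v < N →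
    m'.arr aPot v = m.arr aPot v + if v < i then m.arr aDist v else 0)
    (by decide) (fun _ _ _ h => h) ?_ ?_ ?_ ?_
  · intro m' ha
    rw [eval_nodesE, ha.nodes (by decide), hN]
  · intro v h0 h1
    rw [if_neg (by push_cast; omega), add_zero]
  · intro i hi m' ha hr hI
    have hD : m'.arr aDist = m.arr aDist := ha.arr _ (by decide)
    refine Wp.store ?_
    intro v h0 h1
    have h2 := hI v h0 h1
    by_cases hv : v = i
    · subst hv
      simp [hr, hD, h2]
    · simp only [Memory.arr_setCell, if_true, Expr.eval_reg, hr, Function.update_of_ne hv, h2]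
      congr 1
      refine if_congr ?_ rfl rfl
      push_cast; omega
  · intro m' _ h v h0 h1
    rw [h v h0 h1, if_pos h1]

/-- The sinks of the clients among the first `i` satellites, as determined by the input array. -/
def sinks (f : ℤ → ℤ) (i : ℕ) : Finset ℤ :=
  ((Finset.range i).filter fun c : ℕ => f (5 + 3 * c) ≠ 0).image fun c : ℕ => f 1 * f 0 + c

theorem sinks_succ_of_ne {f : ℤ → ℤ} {i : ℕ} (h : f (5 + 3 * i) ≠ 0) :
    sinks f (i + 1) = insert (f 1 * f 0 + i) (sinks f i) := by
  rw [sinks, Finset.range_add_one, Finset.filter_insert, if_pos h, Finset.image_insert]; rfl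

theorem sinks_succ_of_eq {f : ℤ → ℤ} {i : ℕ} (h : f (5 + 3 * i) = 0) :
    sinks f (i + 1) = sinks f i := by
  rw [sinks, Finset.range_add_one, Finset.filter_insert, if_neg (by simpa using h)]; rfl

theorem notMem_sinks {f : ℤ → ℤ} (i : ℕ) : f 1 * f 0 + i ∉ sinks f i := by
  simp [sinks]

theorem sinks_mono {f : ℤ → ℤ} {i j : ℕ} (h : i ≤ j) : sinks f i ⊆ sinks f j :=
  Finset.image_subset_image (Finset.filter_subset_filter _ (Finset.range_subset_range.2 h))

theorem mem_sinks {f : ℤ → ℤ} {i j : ℕ} (hi : i < j) (h : f (5 + 3 * i) ≠ 0) :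
    f 1 * f 0 + i ∈ sinks f j :=
  Finset.mem_image.2 ⟨i, by simp [hi, h], rfl⟩

theorem card_sinks_lt {f : ℤ → ℤ} {i j : ℕ} (hi : i < j) (h : f (5 + 3 * i) ≠ 0) :
    (sinks f i).card < (sinks f j).card :=
  Finset.card_lt_card (Finset.ssubset_iff_subset_ne.2 ⟨sinks_mono hi.le, fun he =>
    notMem_sinks i (he ▸ mem_sinks hi h)⟩)

/-- The sink of the current client. -/
def sinkE : Expr := snapE * satE + .reg rClient

/-- The entry of the input that tells whether the current satellite is a client. -/
def isClientE : Expr := .get 0 (.const 5 + .reg rClient * .const 3)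

/-- Augments the flow for the current client along a shortest path from the super source to its
sink. -/
def augmentClient : Prog :=
  fillReducedCosts ⨾ .assign rRoot superE ⨾ .assign rCur sinkE ⨾ dijkstra ⨾ tracePath ⨾
    updatePotentials

/-- Routes the clients one after the other. -/
def phaseOne : Prog := .forLoop rClient satE (.ite isClientE augmentClient .skip)

/-- A step bound for Dijkstra's algorithm. -/
def dijkstraSteps (N : ℕ) : ℕ :=
  N * 5 + 2 + (N * (N * 6 + 3 + (N * 5 + 2 + 1) + 2) + 2 + 1 + 1)

/-- A step bound for one augmentation. -/
def augmentSteps (N : ℕ) : ℕ :=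
  N * (N * (2 + 2) + 2 + 2) + 2 + (dijkstraSteps N + (N * 8 + (N * (1 + 2) + 2)) + 1 + 1)

theorem length_le_of_nodup {l : List ℤ} (hnd : l.Nodup) (h : ∀ x ∈ l, 0 ≤ x ∧ x < N) :
    l.length ≤ N := by
  rw [← List.toFinset_card_of_nodup hnd]
  calc _ ≤ (Finset.Ico (0 : ℤ) N).card := Finset.card_le_card fun x hx => by
        simpa using h x (List.mem_toFinset.1 hx)
    _ = N := by simp

variable {n K C : ℕ} {U H : ℤ → ℤ → ℤ} {M : ℤ}

/-- The memory holds a network with its capacities and costs; `f` is the input array. -/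
structure HoldsNetwork (N : ℕ) (U H : ℤ → ℤ → ℤ) (M : ℤ) (f : ℤ → ℤ) (m : Memory) : Prop where
  inp : m.arr 0 = f
  nodes : m.nodes = N
  big : m.reg rBig = M
  cap : ∀ u v : ℤ, 0 ≤ u → u < N → 0 ≤ v → v < N → mat N (m.arr aCap) u v = U u v
  cost : ∀ u v : ℤ, 0 ≤ u → u < N → 0 ≤ v → v < N → mat N (m.arr aCost) u v = H u v

theorem HoldsNetwork.of_agree {f : ℤ → ℤ} {m m' : Memory} {X Y : List ℕ}
    (h : HoldsNetwork N U H M f m) (ha : Agree X Y m m') (hX : rBig ∉ X)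
    (h0 : 0 ∉ Y) (h1 : aCap ∉ Y) (h2 : aCost ∉ Y) : HoldsNetwork N U H M f m' :=
  ⟨(ha.arr _ h0).trans h.inp, (ha.nodes h0).trans h.nodes, (ha.reg _ hX).trans h.big,
    by rw [ha.arr _ h1]; exact h.cap, by rw [ha.arr _ h2]; exact h.cost⟩

theorem arcLength_congr {H' R R' : ℤ → ℤ → ℤ} {p : ℤ → ℤ}
    {u v : ℤ} (h1 : H' u v = H u v) (h2 : H' v u = H v u) (h3 : R' u v = R u v) :
    arcLength H' R' p M u v = arcLength H R p M u v := by
  simp only [arcLength, h1, h2, h3]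

theorem ShortestTree.congr {A A' : ℤ → ℤ → ℤ} {root : ℤ} {D P S : ℤ → ℤ}
    (h : ShortestTree N A root D P S)
    (hA : ∀ u v : ℤ, 0 ≤ u → u < N → 0 ≤ v → v < N → A u v = A' u v) :
    ShortestTree N A' root D P S where
  dist_root := h.dist_root
  dist_nonneg := h.dist_nonneg
  relaxed u v h0 h1 h2 h3 := by rw [← hA u v h0 h1 h2 h3]; exact h.relaxed u v h0 h1 h2 h3
  pred_nonneg := h.pred_nonneg
  pred_lt := h.pred_lt
  dist_eq v h0 h1 h2 := by
    rw [← hA _ _ (h.pred_nonneg v h0 h1 h2) (h.pred_lt v h0 h1 h2) h0 h1]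
    exact h.dist_eq v h0 h1 h2
  stamp_nonneg := h.stamp_nonneg
  stamp_lt := h.stamp_lt

theorem wp_augmentClient {m : Memory} {f : ℤ → ℤ} (hm : HoldsNetwork N U H M f m)
    (hn : IsNetwork N U H ((f 1 + 1) * f 0) C M) {T : Finset ℤ} {R : ℤ → ℤ → ℤ} {t : ℤ}
    (hR : ∀ u v : ℤ, 0 ≤ u → u < N → 0 ≤ v → v < N → mat N (m.arr aRes) u v = R u v)
    (h : ResidualInv N U H ((f 1 + 1) * f 0) C T R (m.arr aPot)) (hT : T.card < C)
    (htE : f 1 * f 0 + m.reg rClient = t) (ht0 : 0 ≤ t) (htN : t < (f 1 + 1) * f 0) (htT : t ∉ T) :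
    Wp augmentClient (augmentSteps N) m fun m' =>
      ResidualInv N U H ((f 1 + 1) * f 0) C (insert t T) (mat N (m'.arr aRes)) (m'.arr aPot) := by
  set z := (f 1 + 1) * f 0 with hz
  have htz : t ≠ z := by omega
  have hzN := hn.super_lt
  refine Wp.seq ((wp_fillReducedCosts hm.nodes).mono le_rfl ?_)
  intro m1 ha1 hA _
  have hm1 := hm.of_agree ha1 (by decide) (by decide) (by decide) (by decide)
  have hR1 : m1.arr aRes = m.arr aRes := ha1.arr _ (by decide)
  have hp1 : m1.arr aPot = m.arr aPot := ha1.arr _ (by decide)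
  have hc1 : m1.reg rClient = m.reg rClient := ha1.reg _ (by decide)
  have hA1 : ∀ u v : ℤ, 0 ≤ u → u < N → 0 ≤ v → v < N →
      mat N (m1.arr aLen) u v = arcLength H R (m.arr aPot) M u v := by
    intro u v u0 u1 v0 v1
    rw [hA u v u0 u1 v0 v1, hm.big]
    exact arcLength_congr (hm.cost u v u0 u1 v0 v1) (hm.cost v u v0 v1 u0 u1)
      (hR u v u0 u1 v0 v1)
  refine Wp.assign_seq (Wp.assign_seq ?_)
  set m2 := (m1.setReg rRoot (superE.eval m1)).setReg rCur
    (sinkE.eval (m1.setReg rRoot (superE.eval m1))) with hm2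
  have hroot2 : m2.reg rRoot = z := by simp [hm2, hm1.inp, hz]
  have hcur2 : m2.reg rCur = t := by simp [hm2, hm1.inp, sinkE, hc1, htE]
  have hl2 : m2.arr = m1.arr := rfl
  refine (Wp.seq (T := dijkstraSteps N) (T' := N * 8 + (N * (1 + 2) + 2))
    ((wp_dijkstra (N := N) (root := z) (m := m2) hm1.nodes hroot2 hn.super_nonneg hzN ?_).mono
      ?_ ?_)).mono (by omega) fun _ _ h => h
  · intro u v u0 u1 v0 v1
    rw [hl2, hA1 u v u0 u1 v0 v1]
    exact h.arcLength_nonneg hn u v u0 u1 v0 v1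
  · simp only [dijkstraSteps]; gcongr; omega
  intro m3 ha3 htree _
  replace htree := htree.congr (A' := arcLength H R (m.arr aPot) M) (by rw [hl2]; exact hA1)
  have hR3 : m3.arr aRes = m.arr aRes := (ha3.arr _ (by decide)).trans hR1
  have hp3 : m3.arr aPot = m.arr aPot := (ha3.arr _ (by decide)).trans hp1
  obtain ⟨l, hl, hnd, hlN⟩ := htree.exists_trace hn.super_nonneg hzN ht0 (by omega : t < N)
  have hcur3 : m3.reg rCur = t := (ha3.reg _ (by decide)).trans hcur2
  have hroot3 : m3.reg rRoot = z := (ha3.reg _ (by decide)).trans hroot2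
  have hN3 : m3.nodes = N := (ha3.nodes (by decide)).trans hm1.nodes
  refine Wp.seq ((wp_tracePath hl (m := m3) hN3 hroot3 rfl (by simp [hcur3]) hlN).mono ?_ ?_)
  · exact Nat.mul_le_mul_right _ (length_le_of_nodup hnd hlN)
  intro m4 ha4 ⟨hRes, _⟩ _
  have hN4 : m4.nodes = N := (ha4.nodes (by decide)).trans hN3
  have hp4 : m4.arr aPot = m.arr aPot := (ha4.arr _ (by decide)).trans hp3
  have hD4 : m4.arr aDist = m3.arr aDist := ha4.arr _ (by decide)
  refine (wp_updatePotentials hN4).mono le_rfl ?_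
  intro m5 ha5 hpot
  have hR5 : m5.arr aRes = m4.arr aRes := ha5.arr _ (by decide)
  refine h.augment hn hT htree htT htz hl hnd hlN ?_ ?_
  · intro a b a0 a1 b0 b1
    rw [hR5, hRes a b a0 a1 b0 b1, hR3, hR a b a0 a1 b0 b1]
  · intro a a0 a1
    rw [hpot a a0 a1, hp4, hD4]

theorem wp_phaseOne {m : Memory} {f : ℤ → ℤ} (hm : HoldsNetwork N U H M f m) (hf0 : f 0 = n)
    (hf1 : f 1 = K)
    (hn : IsNetwork N U H ((f 1 + 1) * f 0) (sinks f n).card M)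
    (hR : ∀ u v : ℤ, 0 ≤ u → u < N → 0 ≤ v → v < N → mat N (m.arr aRes) u v = U u v)
    (hp : m.arr aPot = 0) :
    Wp phaseOne (n * (augmentSteps N + 1 + 2) + 2) m fun m' =>
      ∃ p, ResidualInv N U H ((f 1 + 1) * f 0) (sinks f n).card (sinks f n)
        (mat N (m'.arr aRes)) p := by
  refine Wp.forLoop (n := n) (T := augmentSteps N + 1)
    (fun i m' => ∃ R : ℤ → ℤ → ℤ, (∀ u v : ℤ, 0 ≤ u → u < N → 0 ≤ v → v < N →
      mat N (m'.arr aRes) u v = R u v) ∧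
      ResidualInv N U H ((f 1 + 1) * f 0) (sinks f n).card (sinks f i) R (m'.arr aPot))
    (by decide) (fun _ _ _ h => h) ?_ ?_ ?_ ?_
  · intro m' ha
    rw [eval_satE, ha.arr _ (by decide), hm.inp, hf0]
  · refine ⟨U, hR, ?_⟩
    rw [hp]
    simpa [sinks] using ResidualInv.init hn
  · intro i hi m' ha hr ⟨R, hR, hI⟩
    have hm' := hm.of_agree ha (by decide) (by decide) (by decide) (by decide)
    have hcl : isClientE.eval m' = f (5 + 3 * i) := by simp [isClientE, hm'.inp, hr, mul_comm]
    refine Wp.ite (fun hs => ?_) (fun hs => (Wp.skip ?_).mono (T' := augmentSteps N) ?_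
      fun _ _ h => h)
    · rw [hcl] at hs
      have hK : (0 : ℤ) ≤ f 1 * f 0 := by rw [hf0, hf1]; positivity
      refine (wp_augmentClient (t := f 1 * f 0 + i) hm' hn hR hI (card_sinks_lt hi hs)
        (by rw [hr]) (by omega) ?_ (notMem_sinks i)).mono le_rfl ?_
      · rw [add_mul, one_mul, hf0]; omega
      · intro m'' _ h
        rw [sinks_succ_of_ne hs]
        exact ⟨_, fun _ _ _ _ _ _ => rfl, h⟩
    · rw [hcl] at hs
      rw [sinks_succ_of_eq hs]
      exact ⟨R, hR, hI⟩
    · simp only [augmentSteps]; omega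
  · intro m' _ ⟨R, hR, hI⟩
    refine ⟨m'.arr aPot, ?_⟩
    -- residual capacities outside the range of the nodes play no role
    have hz := hn.super_nonneg
    have hzN := hn.super_lt
    exact
      { nonneg := fun u v a b c d => by rw [hR u v a b c d]; exact hI.nonneg u v a b c d
        add_opposite := fun u v a b c d => by
          rw [hR u v a b c d, hR v u c d a b]; exact hI.add_opposite u v a b c d
        net := fun u a b => by
          rw [← hI.net u a b]
          refine Finset.sum_congr rfl fun v hv => ?_
          rw [Finset.mem_Ico] at hv
          rw [hR u v a b hv.1 hv.2]
        super := fun v a b c => by rw [hR _ v hz hzN a b]; exact hI.super v a b c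
        reduced := fun u v a b c d => by rw [hR u v a b c d]; exact hI.reduced u v a b c d
        pot_super := hI.pot_super
        pot_nonneg := hI.pot_nonneg }

end RAM

/-! ### The decomposition of the flow into routes as a program -/

namespace RAM

variable {N n K C : ℕ} {U H F : ℤ → ℤ → ℤ} {M : ℤ}

/-- Splits off a path to the sink of the current client and writes its length and its nodes to the
output. The trace also writes the sink, which is dropped again. -/
def routeClient : Prog :=
  fillSupport ⨾ .assign rStart (.reg rPos) ⨾ .assign rPos (.reg rPos + .const 1) ⨾
    .assign rRoot sinkE ⨾ .assign rCur superE ⨾ dijkstra ⨾ tracePath ⨾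
    .assign rPos (.reg rPos - .const 2) ⨾
    .store aOut (.reg rStart) ((.reg rPos - .reg rStart - .const 1) / .const 2)

/-- Splits the flow into one path for every client, and writes the answer. -/
def phaseTwo : Prog :=
  negateFlow ⨾ .store aOut (.const 0) (.const 1) ⨾ .assign rPos (.const 1) ⨾
    .forLoop rClient satE (.ite isClientE routeClient
      (.store aOut (.reg rPos) (.const 0) ⨾ .assign rPos (.reg rPos + .const 1))) ⨾
    .assign 0 (.reg rPos)

/-- The inner nodes of a path. -/
def inner (l : List ℤ) : List ℤ := l.tail.dropLast

/-- The output for the first `i` satellites, when `L t` is the path to the sink `t`. -/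
def routeOutput (f : ℤ → ℤ) (L : ℤ → List ℤ) (i : ℕ) : List ℤ :=
  (List.range i).flatMap fun c : ℕ => if f (5 + 3 * c) ≠ 0 then
    ((inner (L (f 1 * f 0 + c))).length : ℤ) :: coords (f 0) (inner (L (f 1 * f 0 + c))) else [0]

theorem routeOutput_succ (f : ℤ → ℤ) (L : ℤ → List ℤ) (i : ℕ) : routeOutput f L (i + 1) =
    routeOutput f L i ++ if f (5 + 3 * i) ≠ 0 then
      ((inner (L (f 1 * f 0 + i))).length : ℤ) :: coords (f 0) (inner (L (f 1 * f 0 + i)))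
      else [0] := by
  simp [routeOutput, List.range_succ]

theorem routeOutput_update (f : ℤ → ℤ) (L : ℤ → List ℤ) (i : ℕ) (l : List ℤ) :
    routeOutput f (Function.update L (f 1 * f 0 + i) l) i = routeOutput f L i := by
  simp only [routeOutput]
  refine List.flatMap_congr fun c hc => ?_
  rw [List.mem_range] at hc
  rw [Function.update_of_ne (by omega)]

/-- A step bound for the extraction of one path. -/
def routeSteps (N : ℕ) : ℕ :=
  N * (N * (2 + 2) + 2 + 2) + 2 + (dijkstraSteps N + (N * 8 + (1 + 1)) + 1 + 1 + 1 + 1)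

theorem wp_routeClient {m : Memory} {f : ℤ → ℤ} (hf : m.arr 0 = f) (hN : m.nodes = N)
    {z t : ℤ} (hz : z = (f 1 + 1) * f 0) (hz0 : 0 ≤ z) (hzN : z < N)
    {T B : Finset ℤ} {L : ℤ → List ℤ} (h : DecompInv N z B F T (mat N (m.arr aRes)) L)
    (htE : f 1 * f 0 + m.reg rClient = t) (ht0 : 0 ≤ t) (htN : t < z) (htT : t ∉ T) (htB : t ∈ B)
    (hzB : z ∉ B) :
    Wp routeClient (routeSteps N) m fun m' => ∃ l,
      DecompInv N z B F (insert t T) (mat N (m'.arr aRes)) (Function.update L t l) ∧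
      m'.reg rPos = m.reg rPos + 1 + (coords (f 0) (inner l)).length ∧
      (∀ j, j < m.reg rPos → m'.arr aOut j = m.arr aOut j) ∧
      Holds (m'.arr aOut) (m.reg rPos) (((inner l).length : ℤ) :: coords (f 0) (inner l)) := by
  have htz : z ≠ t := by omega
  refine Wp.seq ((wp_fillSupport hN).mono le_rfl ?_)
  intro m1 ha1 hA _
  have hR1 : m1.arr aRes = m.arr aRes := ha1.arr _ (by decide)
  have hf1 : m1.arr 0 = f := (ha1.arr _ (by decide)).trans hf
  have hc1 : m1.reg rClient = m.reg rClient := ha1.reg _ (by decide)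
  have hp1 : m1.reg rPos = m.reg rPos := ha1.reg _ (by decide)
  have hN1 : m1.nodes = N := (ha1.nodes (by decide)).trans hN
  have ho1 : m1.arr aOut = m.arr aOut := ha1.arr _ (by decide)
  refine Wp.assign_seq (Wp.assign_seq (Wp.assign_seq (Wp.assign_seq ?_)))
  generalize hm2 : Memory.setReg _ rCur _ = m2
  have hroot2 : m2.reg rRoot = t := by simp [← hm2, hf1, sinkE, hc1, htE]
  have hcur2 : m2.reg rCur = z := by simp [← hm2, hf1, hz]
  have hpos2 : m2.reg rPos = m.reg rPos + 1 := by simp [← hm2, hp1]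
  have hst2 : m2.reg rStart = m.reg rPos := by simp [← hm2, hp1]
  have hl2 : m2.arr = m1.arr := by simp [← hm2]
  have hN2 : m2.nodes = N := by simp [← hm2, hN1]
  refine (Wp.seq (T := dijkstraSteps N) (T' := N * 8 + (1 + 1))
    ((wp_dijkstra (N := N) (root := t) (m := m2) hN2 hroot2 ht0 (by omega) ?_).mono
      ?_ ?_)).mono (by omega) fun _ _ h => h
  · intro u v u0 u1 v0 v1
    rw [hl2, hA u v u0 u1 v0 v1]
    exact supportLength_nonneg _ _ _
  · simp only [dijkstraSteps]; gcongr; omega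
  intro m3 ha3 htree _
  replace htree := htree.congr (A' := supportLength (mat N (m.arr aRes))) (by rw [hl2]; exact hA)
  have hR3 : m3.arr aRes = m.arr aRes := (ha3.arr _ (by decide)).trans (by rw [hl2, hR1])
  have hf3 : m3.arr 0 = f := (ha3.arr _ (by decide)).trans (by rw [hl2, hf1])
  have ho3 : m3.arr aOut = m.arr aOut := (ha3.arr _ (by decide)).trans (by rw [hl2, ho1])
  obtain ⟨l, hl, hnd, hlN⟩ := htree.exists_trace ht0 (by omega) hz0 hzN
  have hcur3 : m3.reg rCur = z := (ha3.reg _ (by decide)).trans hcur2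
  have hroot3 : m3.reg rRoot = t := (ha3.reg _ (by decide)).trans hroot2
  have hpos3 : m3.reg rPos = m.reg rPos + 1 := (ha3.reg _ (by decide)).trans hpos2
  have hst3 : m3.reg rStart = m.reg rPos := (ha3.reg _ (by decide)).trans hst2
  have hN3 : m3.nodes = N := (ha3.nodes (by decide)).trans hN2
  refine Wp.seq ((wp_tracePath hl (m := m3) hN3 hroot3 rfl (by simp [hcur3]) hlN).mono ?_ ?_)
  · exact Nat.mul_le_mul_right _ (length_le_of_nodup hnd hlN)
  intro m4 ha4 ⟨hRes, hp4, hpre, hcoords⟩ _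
  have hst4 : m4.reg rStart = m.reg rPos := (ha4.reg _ (by decide)).trans hst3
  -- the trace consists of the super source, the inner nodes and the sink
  have hlne : l ≠ [] := by
    rintro rfl
    have := hl.getLast?
    simp [htz] at this
  obtain ⟨xs, rfl⟩ : ∃ xs, l = xs ++ [t] := by
    refine ⟨l.dropLast, ?_⟩
    have h1 := hl.getLast?
    obtain ⟨a, l', rfl⟩ := List.exists_cons_of_ne_nil hlne
    rw [List.getLast?_cons_cons, List.getLast?_eq_some_getLast (by simp), Option.some.injEq] at h1
    rw [← h1, List.dropLast_append_getLast]
  have hinner : inner (z :: (xs ++ [t])) = xs := by simp [inner]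
  simp only [List.tail_cons, hf3, hpos3, List.length_append, List.length_singleton, coords,
    List.flatMap_append] at hp4 hpre hcoords
  rw [holds_append] at hcoords
  replace hcoords : Holds (m4.arr aOut) (m.reg rPos + 1) (coords (f 0) xs) := hcoords.1
  push_cast at hp4
  refine Wp.assign_seq (Wp.store ⟨z :: (xs ++ [t]), ?_, ?_, ?_, ?_⟩)
  · refine h.step hz0 hzN htB htT ht0 (by omega) hzB htree hl hnd hlN ?_
    intro a b a0 a1 b0 b1
    simpa [hR3] using hRes a b a0 a1 b0 b1
  · rw [hinner, length_coords]
    simp [hp4]; ring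
  · intro j hj
    simp [hst4, Function.update_of_ne (show j ≠ m.reg rPos by omega), hpre j (by omega), ho3]
  · rw [hinner]
    have hlen : (m.reg rPos + 1 + 2 * ((xs.length : ℤ) + 1) - 2 - m.reg rPos - 1) / 2
        = xs.length := by omega
    refine ⟨by simp [hst4, hp4, hlen], hcoords.congr fun j h1 _ => ?_⟩
    simp [hst4, Function.update_of_ne (show j ≠ m.reg rPos by omega)]

theorem wp_phaseTwo {m : Memory} {f : ℤ → ℤ} (hf : m.arr 0 = f) (hN : m.nodes = N)
    (hf0 : f 0 = n) (hf1 : f 1 = K) {z : ℤ} (hz : z = (f 1 + 1) * f 0) (hzN : z < N)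
    (hcap : ∀ u v : ℤ, 0 ≤ u → u < N → 0 ≤ v → v < N → mat N (m.arr aCap) u v = U u v)
    (hanti : ∀ u v : ℤ, 0 ≤ u → u < N → 0 ≤ v → v < N →
      U v u - mat N (m.arr aRes) v u = -(U u v - mat N (m.arr aRes) u v))
    (hnet : ∀ u : ℤ, 0 ≤ u → u < N → ∑ v ∈ Finset.Ico (0 : ℤ) N, (U u v - mat N (m.arr aRes) u v) =
      demand z (sinks f n) u) :
    Wp phaseTwo (N * (N * (1 + 2) + 2 + 2) + 2 + (n * (routeSteps N + 1 + 2) + 2 + 1 + 1 + 1)) m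
      fun m' => ∃ G L, DecompInv N z (sinks f n) (fun u v => U u v - mat N (m.arr aRes) u v)
          (sinks f n) G L ∧
        m'.reg 0 = (1 :: routeOutput f L n).length ∧
        Holds (m'.arr aOut) 0 (1 :: routeOutput f L n) := by
  have hK : (0 : ℤ) ≤ f 1 * f 0 := by rw [hf0, hf1]; positivity
  have hz0 : 0 ≤ z := by
    have : (0 : ℤ) ≤ f 0 := by rw [hf0]; positivity
    rw [hz, add_mul, one_mul]; omega
  have hzB : z ∉ sinks f n := by
    rw [hz]
    intro h
    obtain ⟨c, hc, hcz⟩ := Finset.mem_image.1 h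
    have := Finset.mem_range.1 (Finset.mem_filter.1 hc).1
    rw [add_mul, one_mul, hf0] at hcz
    omega
  refine Wp.seq ((wp_negateFlow hN).mono le_rfl ?_)
  intro m1 ha1 hneg _
  have hN1 : m1.nodes = N := (ha1.nodes (by decide)).trans hN
  have hf1' : m1.arr 0 = f := (ha1.arr _ (by decide)).trans hf
  refine Wp.store_seq (Wp.assign_seq ?_)
  generalize hm2 : Memory.setReg _ rPos _ = m2
  have hN2 : m2.nodes = N := by
    rw [← hm2, nodes_setReg, nodes_setCell _ (by decide), hN1]
  have hf2 : m2.arr 0 = f := by simp [← hm2, hf1']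
  have hR2 : m2.arr aRes = m1.arr aRes := by simp [← hm2]
  refine Wp.seq (T := n * (routeSteps N + 1 + 2) + 2) (T' := 1)
    (Wp.forLoop (n := n) (T := routeSteps N + 1) (fun i m' => ∃ L,
    DecompInv N z (sinks f n) (fun u v => U u v - mat N (m.arr aRes) u v) (sinks f i)
      (mat N (m'.arr aRes)) L ∧
    m'.reg rPos = (1 :: routeOutput f L i).length ∧
    Holds (m'.arr aOut) 0 (1 :: routeOutput f L i)) (by decide) (fun _ _ _ h => h) ?_ ?_ ?_ ?_)
  · intro m' ha
    rw [eval_satE, ha.arr _ (by decide), hf2, hf0]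
  · refine ⟨fun _ => [], ?_, by simp [← hm2, routeOutput], ?_⟩
    · have h0 : sinks f 0 = ∅ := by simp [sinks]
      rw [h0]
      refine DecompInv.init hanti hnet fun u v u0 u1 v0 v1 => ?_
      rw [hR2, hneg u v u0 u1 v0 v1, hcap u v u0 u1 v0 v1]
    · simp [routeOutput, Holds, ← hm2]
  · intro i hi m3 ha3 hr3 ⟨L, hI, hpos, hout⟩
    have hN3 : m3.nodes = N := (ha3.nodes (by decide)).trans hN2
    have hf3 : m3.arr 0 = f := (ha3.arr _ (by decide)).trans hf2
    have hcl : isClientE.eval m3 = f (5 + 3 * i) := by simp [isClientE, hf3, hr3, mul_comm]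
    refine Wp.ite (fun hs => ?_) (fun hs => ?_)
    · rw [hcl] at hs
      refine (wp_routeClient (t := f 1 * f 0 + i) hf3 hN3 hz hz0 hzN hI (by rw [hr3]) (by omega) ?_
        (notMem_sinks i) (mem_sinks hi hs) hzB).mono le_rfl ?_
      · rw [hz, add_mul, one_mul, hf0]; omega
      · intro m4 _ ⟨l, h1, h2, h3, h4⟩
        refine ⟨Function.update L (f 1 * f 0 + i) l, ?_, ?_, ?_⟩
        · rw [sinks_succ_of_ne hs]; exact h1
        · rw [h2, hpos, routeOutput_succ, routeOutput_update, if_pos hs, Function.update_self]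
          simp; ring
        · rw [routeOutput_succ, routeOutput_update, if_pos hs, Function.update_self,
            ← List.cons_append, holds_append, zero_add, ← hpos]
          exact ⟨hout.congr fun j _ h => h3 j (by omega), h4⟩
    · rw [hcl] at hs
      refine (Wp.store_seq (Wp.assign ⟨L, ?_, ?_, ?_⟩)).mono (by simp only [routeSteps]; omega)
        fun _ _ h => h
      · rw [sinks_succ_of_eq hs]
        simpa using hI
      · rw [routeOutput_succ, if_neg (by simpa using hs)]
        simp [hpos]
      · rw [routeOutput_succ, if_neg (by simpa using hs), ← List.cons_append, holds_append,
          zero_add, ← hpos]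
        refine ⟨hout.congr fun j _ h => ?_, ?_, trivial⟩
        · simp [Function.update_of_ne (show j ≠ m3.reg rPos by omega)]
        · simp
  · intro m3 ha3 ⟨L, hI, hpos, hout⟩ _
    refine Wp.assign ⟨_, L, hI, ?_, ?_⟩
    · simpa using hpos
    · simpa using hout

end RAM

/-! ### Setting up the flow network as a program -/

namespace RAM

notation "rCapVal" => (15 : ℕ)
notation "rCostVal" => (16 : ℕ)

variable {N n K C : ℕ} {f : ℤ → ℤ}

/-- The entries of the input for the satellite in register `rSat`: whether it is a client, and the
numerator and the denominator of its weight. -/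
def satEntryE (j : ℤ) : Expr := .get 0 (.const (5 + j) + .reg rSat * .const 3)

/-- Computes the number of clients and the product of the denominators of their weights. -/
def countClients : Prog :=
  .assign rCount (.const 0) ⨾ .assign rDenom (.const 1) ⨾
  .forLoop rSat satE (.ite (satEntryE 0)
    (.assign rCount (.reg rCount + .const 1) ⨾ .assign rDenom (.reg rDenom * satEntryE 2)) .skip)

/-- The common denominator of the weights. -/
def commonDenom (f : ℤ → ℤ) (i : ℕ) : ℤ :=
  ∏ c ∈ (Finset.range i).filter (fun c : ℕ => f (5 + 3 * c) ≠ 0), f (7 + 3 * c)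

theorem eval_satEntryE {m : Memory} (hf : m.arr 0 = f) {i : ℕ} (hi : m.reg rSat = i) (j : ℤ) :
    (satEntryE j).eval m = f (5 + j + 3 * i) := by
  simp [satEntryE, hf, hi, mul_comm]

theorem card_sinks (f : ℤ → ℤ) (i : ℕ) :
    (sinks f i).card = ((Finset.range i).filter fun c : ℕ => f (5 + 3 * c) ≠ 0).card :=
  Finset.card_image_of_injective _ fun a b h => by simpa using h

theorem wp_countClients {m : Memory} (hf : m.arr 0 = f) (hf0 : f 0 = n) :
    Wp countClients (n * (3 + 2) + 2 + 1 + 1) m fun m' =>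
      m'.reg rCount = (sinks f n).card ∧ m'.reg rDenom = commonDenom f n := by
  refine Wp.assign_seq (Wp.assign_seq (Wp.forLoop (n := n) (T := 3) (fun i m' =>
    m'.reg rCount = (sinks f i).card ∧ m'.reg rDenom = commonDenom f i)
    (by decide) (fun _ _ _ h => h) ?_ ?_ ?_ ?_))
  · intro m' ha
    rw [eval_satE, ha.arr _ (by decide)]
    simp [hf, hf0]
  · simp [sinks, commonDenom]
  · intro i hi m' ha hr ⟨h1, h2⟩
    have hf' : m'.arr 0 = f := by rw [ha.arr _ (by decide)]; simp [hf]
    have hins : f (5 + 3 * i) ≠ 0 → (Finset.range (i + 1)).filter (fun c : ℕ => f (5 + 3 * c) ≠ 0) =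
        insert i ((Finset.range i).filter fun c : ℕ => f (5 + 3 * c) ≠ 0) := fun h => by
      rw [Finset.range_add_one, Finset.filter_insert, if_pos h]
    have hni : f (5 + 3 * i) = 0 → (Finset.range (i + 1)).filter (fun c : ℕ => f (5 + 3 * c) ≠ 0) =
        (Finset.range i).filter fun c : ℕ => f (5 + 3 * c) ≠ 0 := fun h => by
      rw [Finset.range_add_one, Finset.filter_insert, if_neg (by simpa using h)]
    refine Wp.ite (fun hs => Wp.assign_seq (Wp.assign ?_)) (fun hs => (Wp.skip ?_).mono (T' := 2)
      (by omega) fun _ _ h => h)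
    · rw [eval_satEntryE hf' hr, add_zero] at hs
      rw [card_sinks, commonDenom, hins hs, Finset.card_insert_of_notMem (by simp),
        Finset.prod_insert (by simp), ← card_sinks, ← commonDenom]
      have : ∀ v, (satEntryE 2).eval (m'.setReg rCount v) = f (7 + 3 * i) := fun v => by
        rw [eval_satEntryE (f := f) (i := i) (by simpa using hf') (by simpa using hr)]; norm_num
      simp [h1, h2, this, mul_comm]
    · rw [eval_satEntryE hf' hr, add_zero] at hs
      rw [card_sinks, commonDenom, hni hs, ← card_sinks, ← commonDenom]
      exact ⟨h1, h2⟩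
  · intro m' _ h
    exact h

/-- The weight of a satellite, multiplied with the common denominator. -/
def scaledWeight (f : ℤ → ℤ) (d : ℤ) (i : ℤ) : ℤ := d * f (6 + 3 * i) / f (7 + 3 * i)

/-- For every copy of a satellite, computes the weight times the number of the snapshot, and a bound
for the objective plus one. -/
def accumulateWeights : Prog :=
  .assign rBig (.const 1) ⨾
  .forLoop rSnap snapE (.forLoop rSat satE
    (.store aWeight (.reg rSnap * satE + .reg rSat)
        (.get aWeight (.reg rSnap * satE + .reg rSat - satE)
          + .reg rDenom * satEntryE 1 / satEntryE 2) ⨾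
      .assign rBig (.reg rBig + .reg rDenom * satEntryE 1 / satEntryE 2)))

/-- The contents of the array of weights when the cells below `b` have been filled. -/
def weightArray (n : ℕ) (w : ℤ → ℤ) (b : ℤ) (x : ℤ) : ℤ :=
  if 0 ≤ x ∧ x < b then (x / n + 1) * w (x % n) else 0

theorem wp_accumulateWeights {m : Memory} (hf : m.arr 0 = f) (hf0 : f 0 = n) (hf1 : f 1 = K)
    (hw : m.arr aWeight = 0) {d : ℤ} (hd : m.reg rDenom = d) :
    Wp accumulateWeights (K * (n * (2 + 2) + 2 + 2) + 2 + 1) m fun m' =>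
      m'.arr aWeight = weightArray n (scaledWeight f d) (K * n) ∧
      m'.reg rBig = 1 + K * ∑ i ∈ Finset.range n, scaledWeight f d i := by
  set w := scaledWeight f d with hwdef
  refine Wp.assign_seq (Wp.forLoop (n := K) (T := n * (2 + 2) + 2) (fun k m' =>
    m'.arr aWeight = weightArray n w (k * n) ∧
      m'.reg rBig = 1 + k * ∑ i ∈ Finset.range n, w i)
    (by decide) (fun _ _ _ h => h) ?_ ?_ ?_ ?_)
  · intro m' ha
    rw [eval_snapE, ha.arr _ (by decide)]
    simp [hf, hf1]
  · constructor
    · funext x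
      rw [weightArray, if_neg (by push_cast; omega)]
      simp [hw]
    · simp
  · intro k hk m1 ha1 hr1 ⟨h1, h2⟩
    have hf1' : m1.arr 0 = f := by rw [ha1.arr _ (by decide)]; simp [hf]
    have hd1 : m1.reg rDenom = d := by rw [ha1.reg _ (by decide)]; simp [hd]
    refine Wp.forLoop (n := n) (T := 2) (fun i m' =>
      m'.arr aWeight = weightArray n w (k * n + i) ∧
        m'.reg rBig = 1 + k * ∑ i ∈ Finset.range n, w i + ∑ i ∈ Finset.range i, w i)
      (by decide) (fun _ _ _ h => h) ?_ ?_ ?_ ?_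
    · intro m' ha
      rw [eval_satE, ha.arr _ (by decide), hf1', hf0]
    · simpa using ⟨h1, h2⟩
    · intro i hi m2 ha2 hr2 ⟨h3, h4⟩
      have hf2 : m2.arr 0 = f := (ha2.arr _ (by decide)).trans hf1'
      have hd2 : m2.reg rDenom = d := (ha2.reg _ (by decide)).trans hd1
      have hk2 : m2.reg rSnap = k := (ha2.reg _ (by decide)).trans hr1
      have hE : ∀ m3 : Memory, m3.arr 0 = f → m3.reg = m2.reg →
          (Expr.reg rDenom * satEntryE 1 / satEntryE 2).eval m3 = w i := by
        intro m3 h5 h6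
        rw [Expr.eval_div, Expr.eval_mul, eval_satEntryE h5 (by rw [h6, hr2]),
          eval_satEntryE h5 (by rw [h6, hr2]), Expr.eval_reg, h6, hd2, hwdef, scaledWeight]
        norm_num
      have hn0 : (0 : ℤ) < n := by omega
      have hdiv : ((k : ℤ) * n + i) / n = k := by
        rw [add_comm, Int.add_mul_ediv_right _ _ hn0.ne',
          Int.ediv_eq_zero_of_lt (by omega) (by omega), zero_add]
      have hmod : ((k : ℤ) * n + i) % n = i := by
        rw [add_comm, Int.add_mul_emod_self_right, Int.emod_eq_of_lt (by omega) (by omega)]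
      have hidx : (Expr.reg rSnap * satE + .reg rSat).eval m2 = (k : ℤ) * n + i := by
        simp [hk2, hr2, hf2, hf0]
      have hprev : weightArray n w (k * n + i) (k * n + i - n) = k * w i := by
        rw [weightArray]
        rcases Nat.eq_zero_or_pos k with rfl | hk0
        · rw [if_neg (by push_cast; omega)]; simp
        · have : (n : ℤ) ≤ k * n := le_mul_of_one_le_left hn0.le (by omega)
          have he : (k : ℤ) * n + i - n = (k - 1) * n + i := by ring
          rw [if_pos (by omega), he, add_comm (((k : ℤ) - 1) * n), Int.add_mul_ediv_right _ _ hn0.ne',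
            Int.add_mul_emod_self_right, Int.emod_eq_of_lt (by omega) (by omega),
            Int.ediv_eq_zero_of_lt (by omega) (by omega)]
          ring
      have hval : (Expr.get aWeight (.reg rSnap * satE + .reg rSat - satE)
          + .reg rDenom * satEntryE 1 / satEntryE 2).eval m2 = (k + 1) * w i := by
        rw [Expr.eval_add, hE m2 hf2 rfl, Expr.eval_get, Expr.eval_sub, hidx, eval_satE, hf2, hf0,
          h3, hprev]
        ring
      refine Wp.store_seq (Wp.assign ?_)
      rw [hidx, hval]
      constructor
      · rw [Memory.arr_setReg, Memory.arr_setCell, if_pos rfl, h3]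
        funext x
        by_cases hx : x = k * n + i
        · have : (0 : ℤ) ≤ k * n := by positivity
          subst hx
          rw [Function.update_self, weightArray, if_pos (by push_cast; omega), hdiv, hmod]
        · rw [Function.update_of_ne hx, weightArray, weightArray]
          refine if_congr ?_ rfl rfl
          push_cast; omega
      · rw [Expr.eval_add, hE (m2.setCell aWeight (k * n + i) ((k + 1) * w i)) (by simp [hf2]) rfl,
          Finset.sum_range_succ]
        simp [h4]; ring
    · intro m' _ ⟨h3, h4⟩
      constructor
      · rw [h3]; push_cast; congr 1; ring
      · rw [h4]; push_cast; ring
  · intro m' _ h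
    exact h

/-- The capacities of the flow network, in terms of the input array. The copy of satellite `i` in
snapshot `k` is the node `k n + i`; the layer after the last snapshot holds the sinks, and the super
source comes last. Missing arcs are written as `0 / 0`, and this quotient is `0`. -/
def netCap (f : ℤ → ℤ) (C : ℤ) (u v : ℤ) : ℤ :=
  if u = (f 1 + 1) * f 0 then if v = (f 1 + 1) * f 0 then 0 else C
  else if v = (f 1 + 1) * f 0 then 0
  else if u / f 0 = v / f 0 then
    f (5 + f 0 * 3 + (u * f 0 + v % f 0) * 2) * f 4
      / (f (6 + f 0 * 3 + (u * f 0 + v % f 0) * 2) * f 3)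
  else if u % f 0 = v % f 0 then
    if v / f 0 = f 1 then C else if u / f 0 + 1 = v / f 0 then C else 0
  else 0

/-- The costs of the flow network, in terms of the input array; `W` are the costs of the arcs to the
sinks. -/
def netCost (f : ℤ → ℤ) (M : ℤ) (W : ℤ → ℤ) (u v : ℤ) : ℤ :=
  if u = (f 1 + 1) * f 0 then if v = (f 1 + 1) * f 0 then 0 else if v = f 2 then 0 else M
  else if v = (f 1 + 1) * f 0 then 0
  else if u / f 0 = v / f 0 then 0
  else if u % f 0 = v % f 0 then if v / f 0 = f 1 then W u else 0
  else 0

/-- The position in the input of the capacity for the current entry. -/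
def capIndexE (j : ℤ) : Expr :=
  .const j + satE * .const 3
    + (.reg rRow * satE + (.reg rCol - .reg rCol / satE * satE)) * .const 2

/-- Computes the capacity and the cost for the current entry. -/
def entryValues : Prog :=
  .assign rCapVal (.const 0) ⨾ .assign rCostVal (.const 0) ⨾
  .ite (.eq (.reg rRow) superE)
    (.ite (.eq (.reg rCol) superE) .skip
      (.assign rCapVal (.reg rCount) ⨾
        .ite (.eq (.reg rCol) (.get 0 (.const 2))) .skip (.assign rCostVal (.reg rBig))))
    (.ite (.eq (.reg rCol) superE) .skip
      (.ite (.eq (.reg rRow / satE) (.reg rCol / satE))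
        (.assign rCapVal (.get 0 (capIndexE 5) * .get 0 (.const 4)
          / (.get 0 (capIndexE 6) * .get 0 (.const 3))))
        (.ite (.eq (.reg rRow - .reg rRow / satE * satE) (.reg rCol - .reg rCol / satE * satE))
          (.ite (.eq (.reg rCol / satE) snapE)
            (.assign rCapVal (.reg rCount) ⨾ .assign rCostVal (.get aWeight (.reg rRow)))
            (.ite (.eq (.reg rRow / satE + .const 1) (.reg rCol / satE))
              (.assign rCapVal (.reg rCount)) .skip))
          .skip)))

theorem sub_div_mul (a b : ℤ) : a - a / b * b = a % b := by rw [Int.emod_def, mul_comm]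

theorem wp_entryValues {m : Memory} (hf : m.arr 0 = f) :
    Wp entryValues 9 m fun m' =>
      m'.reg rCapVal = netCap f (m.reg rCount) (m.reg rRow) (m.reg rCol) ∧
      m'.reg rCostVal = netCost f (m.reg rBig) (m.arr aWeight) (m.reg rRow) (m.reg rCol) := by
  refine Wp.assign_seq (Wp.assign_seq ?_)
  have hcap : ∀ (m' : Memory) j, m'.arr 0 = f → (capIndexE j).eval m' =
      j + f 0 * 3 + (m'.reg rRow * f 0 + m'.reg rCol % f 0) * 2 := by
    intro m' j h
    simp [capIndexE, h, sub_div_mul]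
  refine Wp.ite (T := 6) (fun h1 => ?_) (fun h1 => ?_)
  · rw [Expr.eval_eq_ne_zero] at h1
    refine (Wp.ite (T := 3) (fun h2 => (Wp.skip ?_).mono (T' := 3) (by omega) fun _ _ h => h)
      (fun h2 => Wp.assign_seq (Wp.ite (fun h3 => Wp.skip ?_) (fun h3 => Wp.assign ?_)))).mono
        (by omega) fun _ _ h => h
    · rw [Expr.eval_eq_ne_zero] at h2
      simp [hf] at h1 h2
      simp [netCap, netCost, h1, h2]
    · rw [Expr.eval_eq_eq_zero] at h2
      rw [Expr.eval_eq_ne_zero] at h3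
      simp [hf] at h1 h2 h3
      rw [netCap, netCost, if_pos h1, if_neg h2, if_pos h1, if_neg h2, if_pos h3]
      simp
    · rw [Expr.eval_eq_eq_zero] at h2
      rw [Expr.eval_eq_eq_zero] at h3
      simp [hf] at h1 h2 h3
      simp [netCap, netCost, h1, h2, h3]
  · rw [Expr.eval_eq_eq_zero] at h1
    refine Wp.ite (T := 5) (fun h2 => (Wp.skip ?_).mono (T' := 5) (by omega) fun _ _ h => h)
      (fun h2 => Wp.ite (T := 4)
        (fun h3 => (Wp.assign ?_).mono (T' := 4) (by omega) fun _ _ h => h)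
        (fun h3 => Wp.ite (T := 3)
          (fun h4 => Wp.ite (T := 2) (fun h5 => Wp.assign_seq (Wp.assign ?_))
            (fun h5 => Wp.ite (T := 1) (fun h6 => Wp.assign ?_) (fun h6 => Wp.skip ?_)))
          (fun h4 => (Wp.skip ?_).mono (T' := 3) (by omega) fun _ _ h => h)))
    all_goals first | rw [Expr.eval_eq_ne_zero] at h2 | rw [Expr.eval_eq_eq_zero] at h2
    all_goals try first | rw [Expr.eval_eq_ne_zero] at h3 | rw [Expr.eval_eq_eq_zero] at h3
    all_goals try first | rw [Expr.eval_eq_ne_zero] at h4 | rw [Expr.eval_eq_eq_zero] at h4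
    all_goals try first | rw [Expr.eval_eq_ne_zero] at h5 | rw [Expr.eval_eq_eq_zero] at h5
    all_goals try first | rw [Expr.eval_eq_ne_zero] at h6 | rw [Expr.eval_eq_eq_zero] at h6
    · simp [hf] at h1 h2
      simp [netCap, netCost, h1, h2]
    · simp [hf] at h1 h2 h3
      rw [Expr.eval_div, Expr.eval_mul, Expr.eval_mul, Expr.eval_get, Expr.eval_get, Expr.eval_get,
        Expr.eval_get, hcap _ _ (by simp [hf]), hcap _ _ (by simp [hf])]
      simp [netCap, netCost, h1, h2, h3, hf]
    · simp [hf, sub_div_mul] at h1 h2 h3 h4 h5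
      rw [h5] at h3
      simp [netCap, netCost, h1, h2, h3, h4, h5]
    · simp [hf, sub_div_mul] at h1 h2 h3 h4 h5 h6
      simp [netCap, netCost, h1, h2, h3, h4, h5, h6]
    · simp [hf, sub_div_mul] at h1 h2 h3 h4 h5 h6
      simp [netCap, netCost, h1, h2, h3, h4, h5, h6]
    · simp [hf, sub_div_mul] at h1 h2 h3 h4
      simp [netCap, netCost, h1, h2, h3, h4]

/-- Fills in the matrices of the capacities, of the costs, and of the residual capacities of the
zero flow. -/
def fillNetwork : Prog :=
  forEntries (entryValues ⨾ setEntry aCap (.reg rRow) (.reg rCol) (.reg rCapVal) ⨾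
    setEntry aRes (.reg rRow) (.reg rCol) (.reg rCapVal) ⨾
    setEntry aCost (.reg rRow) (.reg rCol) (.reg rCostVal))

theorem wp_fillNetwork {m : Memory} (hf : m.arr 0 = f) (hN : m.nodes = N) :
    Wp fillNetwork (N * (N * (12 + 2) + 2 + 2) + 2) m fun m' =>
      HoldsNetwork N (netCap f (m.reg rCount)) (netCost f (m.reg rBig) (m.arr aWeight))
        (m.reg rBig) f m' ∧
      ∀ u v : ℤ, 0 ≤ u → u < N → 0 ≤ v → v < N →
        mat N (m'.arr aRes) u v = netCap f (m.reg rCount) u v := by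
  set U := netCap f (m.reg rCount) with hU
  set H := netCost f (m.reg rBig) (m.arr aWeight) with hH
  refine Wp.forEntries (N := N) (fun _ _ _ => True) (fun u v m' =>
    mat N (m'.arr aCap) u v = U u v ∧ mat N (m'.arr aCost) u v = H u v ∧
      mat N (m'.arr aRes) u v = U u v)
    (by decide) (by decide) (by decide) hN (fun _ _ _ _ _ _ _ => trivial)
    (fun _ _ _ _ _ _ h => h) (fun _ _ _ _ _ _ => trivial) ?_ ?_
  · intro u v u0 u1 v0 v1 m1 ha hr hc _
    have hN1 : m1.nodes = N := (ha.nodes (by decide)).trans hN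
    have hf1 : m1.arr 0 = f := (ha.arr _ (by decide)).trans hf
    have hcount : m1.reg rCount = m.reg rCount := ha.reg _ (by decide)
    have hbig : m1.reg rBig = m.reg rBig := ha.reg _ (by decide)
    have hW : m1.arr aWeight = m.arr aWeight := ha.arr _ (by decide)
    refine Wp.seq (T := 9) (T' := 3) ((wp_entryValues hf1).mono le_rfl ?_)
    intro m2 ha2 ⟨h1, h2⟩ _
    rw [hr, hc, hcount, ← hU] at h1
    rw [hr, hc, hbig, hW, ← hH] at h2
    have hN2 : m2.nodes = N := (ha2.nodes (by decide)).trans hN1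
    have hr2 : m2.reg rRow = u := (ha2.reg _ (by decide)).trans hr
    have hc2 : m2.reg rCol = v := (ha2.reg _ (by decide)).trans hc
    have ho : ∀ a, a ∉ entryValues.arrs → m2.arr a = m1.arr a := ha2.arr
    have hidx : ∀ m' : Memory, m'.nodes = N → m'.reg = m2.reg →
        (Expr.reg rRow * nodesE + .reg rCol).eval m' = u * N + v := by
      intro m' h3 h4
      simp [h3, h4, hr2, hc2]
    refine Wp.store_seq (Wp.store_seq (Wp.store ?_))
    rw [hidx m2 hN2 rfl, hidx (m2.setCell aCap _ _) (by rw [nodes_setCell _ (by decide), hN2]) rfl,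
      hidx ((m2.setCell aCap _ _).setCell aRes _ _)
        (by rw [nodes_setCell _ (by decide), nodes_setCell _ (by decide), hN2]) rfl]
    simp only [Memory.arr_setCell, Memory.reg_setCell, Expr.eval_reg, h1, h2,
      show (2 : ℕ) ≠ 3 by decide, show (2 : ℕ) ≠ 4 by decide, show (3 : ℕ) ≠ 2 by decide,
      show (3 : ℕ) ≠ 4 by decide, show (4 : ℕ) ≠ 2 by decide, show (4 : ℕ) ≠ 3 by decide, if_true,
      if_false, ho 2 (by decide), ho 3 (by decide), ho 4 (by decide)]
    refine ⟨by simp [mat_update v0 v1 v0 v1], fun u' v' _ _ w0 w1 hne => ⟨fun _ => trivial, ?_⟩⟩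
    simp [mat_update v0 v1 w0 w1, hne]
  · intro m' ha h
    exact ⟨⟨(ha.arr _ (by decide)).trans hf, (ha.nodes (by decide)).trans hN, ha.reg _ (by decide),
      fun u v a b c d => (h u v a b c d).1, fun u v a b c d => (h u v a b c d).2.1⟩,
      fun u v a b c d => (h u v a b c d).2.2⟩

end RAM

/-! ### The entries of an encoded instance -/

namespace UFWS

/-- The input array for an instance. -/
def inp (P : UFWS) : ℤ → ℤ := (RAM.input P.encode).arr 0

theorem length_flatMap_finRange {b : ℕ} :
    ∀ {n : ℕ} {g : Fin n → List ℕ}, (∀ i, (g i).length = b) →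
      ((List.finRange n).flatMap g).length = n * b
  | n, g, hg => by simp [List.length_flatMap, hg]

theorem getD_flatMap_finRange {b : ℕ} :
    ∀ {n : ℕ} {g : Fin n → List ℕ}, (∀ i, (g i).length = b) → ∀ (i : Fin n) {j : ℕ}, j < b →
      ((List.finRange n).flatMap g).getD (i * b + j) 0 = (g i).getD j 0
  | 0, _, _, i, _, _ => i.elim0
  | n + 1, g, hg, i, j, hj => by
      rw [List.finRange_succ, List.flatMap_cons, List.flatMap_map]
      refine Fin.cases ?_ (fun i => ?_) i
      · rw [List.getD_append _ _ _ _ (by simpa [hg] using hj)]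
        simp
      · have h : ((i.succ : Fin (n + 1)) : ℕ) * b + j = b + (i * b + j) := by
          rw [Fin.val_succ]; ring
        rw [h, List.getD_append_right _ _ _ _ (by simp [hg]), hg, Nat.add_sub_cancel_left]
        exact getD_flatMap_finRange (g := g ∘ Fin.succ) (fun i => hg _) i hj

variable (P : UFWS)

/-- The part of the encoding that belongs to a satellite. -/
def satBlock (i : Fin P.numSat) : List ℕ :=
  if i ∈ P.clients then 1 :: encodeRat (P.weight i) else [0, 0, 0]

/-- The part of the encoding that belongs to a pair of satellites in a snapshot. -/
def capBlock (k : Fin P.numSnap) (i j : Fin P.numSat) : List ℕ :=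
  match P.cap k i j with
  | some x => encodeRat x
  | none => [0, 0]

theorem length_satBlock (i : Fin P.numSat) : (P.satBlock i).length = 3 := by
  unfold satBlock; split_ifs <;> simp [encodeRat]

theorem length_capBlock (k : Fin P.numSnap) (i j : Fin P.numSat) :
    (P.capBlock k i j).length = 2 := by
  unfold capBlock; split <;> simp [encodeRat]

theorem encode_eq : P.encode = [P.numSat, P.numSnap, (P.server : ℕ), P.size.num, P.size.den] ++
    ((List.finRange P.numSat).flatMap P.satBlock ++
      (List.finRange P.numSnap).flatMap fun k => (List.finRange P.numSat).flatMap fun i =>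
        (List.finRange P.numSat).flatMap (P.capBlock k i)) := by
  simp only [encode, encodeRat, List.cons_append, List.nil_append]
  rfl

theorem length_encode :
    P.encode.length = 5 + (P.numSat * 3 + P.numSnap * (P.numSat * (P.numSat * 2))) := by
  rw [encode_eq, List.length_append, List.length_append,
    length_flatMap_finRange P.length_satBlock, length_flatMap_finRange fun k =>
      length_flatMap_finRange fun i => length_flatMap_finRange (P.length_capBlock k i)]
  rfl

theorem inp_nat (j : ℕ) : P.inp j = (P.encode.getD j 0 : ℕ) := by
  simp [inp, RAM.input]

theorem inp_nonneg (x : ℤ) : 0 ≤ P.inp x := by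
  simp only [inp, RAM.input]
  split_ifs <;> simp

theorem inp_zero : P.inp 0 = P.numSat := P.inp_nat 0
theorem inp_one : P.inp 1 = P.numSnap := P.inp_nat 1
theorem inp_two : P.inp 2 = (P.server : ℕ) := P.inp_nat 2
theorem inp_three : P.inp 3 = P.size.num := P.inp_nat 3
theorem inp_four : P.inp 4 = P.size.den := P.inp_nat 4

theorem inp_sat (i : Fin P.numSat) {j : ℕ} (hj : j < 3) :
    P.inp (5 + j + 3 * (i : ℕ)) = ((P.satBlock i).getD j 0 : ℕ) := by
  have h : (5 + j + 3 * (i : ℕ) : ℤ) = ((5 + (i * 3 + j) : ℕ) : ℤ) := by push_cast; ring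
  have hlt : (i : ℕ) * 3 + j < P.numSat * 3 := by have := i.2; omega
  rw [h, inp_nat, encode_eq, List.getD_append_right _ _ _ _ (by simp),
    show [P.numSat, P.numSnap, (P.server : ℕ), P.size.num, P.size.den].length = 5 from rfl,
    Nat.add_sub_cancel_left, List.getD_append _ _ _ _
      (by rwa [length_flatMap_finRange P.length_satBlock]),
    getD_flatMap_finRange P.length_satBlock i hj]

theorem inp_cap (k : Fin P.numSnap) (i i' : Fin P.numSat) {j : ℕ} (hj : j < 2) :
    P.inp (5 + j + P.numSat * 3 + (((k : ℕ) * P.numSat + (i : ℕ)) * P.numSat + (i' : ℕ)) * 2) =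
      ((P.capBlock k i i').getD j 0 : ℕ) := by
  have h : (5 + j + P.numSat * 3
        + (((k : ℕ) * P.numSat + (i : ℕ)) * P.numSat + (i' : ℕ)) * 2 : ℤ) =
      ((5 + (P.numSat * 3 + (k * (P.numSat * (P.numSat * 2)) + (i * (P.numSat * 2)
        + (i' * 2 + j)))) : ℕ) : ℤ) := by push_cast; ring
  have h1 : (i' : ℕ) * 2 + j < P.numSat * 2 := by have := i'.2; omega
  have h2 : (i : ℕ) * (P.numSat * 2) + ((i' : ℕ) * 2 + j) < P.numSat * (P.numSat * 2) := by
    calc _ < (i : ℕ) * (P.numSat * 2) + P.numSat * 2 := by omega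
      _ = ((i : ℕ) + 1) * (P.numSat * 2) := by ring
      _ ≤ _ := Nat.mul_le_mul_right _ i.2
  rw [h, inp_nat, encode_eq, List.getD_append_right _ _ _ _ (by simp),
    show [P.numSat, P.numSnap, (P.server : ℕ), P.size.num, P.size.den].length = 5 from rfl,
    Nat.add_sub_cancel_left, List.getD_append_right _ _ _ _
      (by rw [length_flatMap_finRange P.length_satBlock]; omega),
    length_flatMap_finRange P.length_satBlock, Nat.add_sub_cancel_left,
    getD_flatMap_finRange (fun k => length_flatMap_finRange fun i =>
      length_flatMap_finRange (P.length_capBlock k i)) k h2,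
    getD_flatMap_finRange (fun i => length_flatMap_finRange (P.length_capBlock k i)) i h1,
    getD_flatMap_finRange (P.length_capBlock k i) i' hj]

theorem inp_cap_eq_zero {x : ℤ} (hx : (P.numSnap : ℤ) * P.numSat * P.numSat ≤ x) :
    P.inp (5 + P.numSat * 3 + x * 2) = 0 := by
  have h0 : (0 : ℤ) ≤ (P.numSnap : ℤ) * P.numSat * P.numSat := by positivity
  lift x to ℕ using h0.trans hx
  have h : (5 + P.numSat * 3 + x * 2 : ℤ) = ((5 + P.numSat * 3 + x * 2 : ℕ) : ℤ) := by push_cast; rfl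
  have hx' : P.numSnap * P.numSat * P.numSat ≤ x := by exact_mod_cast hx
  rw [h, inp_nat, List.getD_eq_default]
  · rfl
  · rw [length_encode]
    have : P.numSnap * (P.numSat * (P.numSat * 2)) = P.numSnap * P.numSat * P.numSat * 2 := by ring
    omega

theorem numSat_pos : 0 < P.numSat := P.server.pos

theorem inp_isClient (i : Fin P.numSat) : P.inp (5 + 3 * (i : ℕ)) ≠ 0 ↔ i ∈ P.clients := by
  have := P.inp_sat i (j := 0) (by omega)
  simp only [Nat.cast_zero, add_zero] at this
  rw [this, satBlock]
  split_ifs with h <;> simp [h]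

theorem inp_weight_num {i : Fin P.numSat} (hi : i ∈ P.clients) :
    P.inp (6 + 3 * (i : ℕ)) = (P.weight i).num := by
  have := P.inp_sat i (j := 1) (by omega)
  norm_num at this
  rw [this, satBlock, if_pos hi]
  rfl

theorem inp_weight_den {i : Fin P.numSat} (hi : i ∈ P.clients) :
    P.inp (7 + 3 * (i : ℕ)) = (P.weight i).den := by
  have := P.inp_sat i (j := 2) (by omega)
  norm_num at this
  rw [this, satBlock, if_pos hi]
  rfl

end UFWS

/-! ### The flow network of an instance -/

namespace UFWS

open RAM

variable (P : UFWS)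

/-- The super source of the flow network. -/
def super : ℤ := (P.numSnap + 1) * P.numSat

/-- The number of nodes of the flow network. -/
def netSize : ℕ := (P.numSnap + 1) * P.numSat + 1

/-- The sink that collects the unit of flow for a client. -/
def sink (c : Fin P.numSat) : ℤ := P.numSnap * P.numSat + (c : ℕ)

/-- The node of the flow network for a node of the time-varying graph. -/
def index (v : P.Node) : ℤ := (v.1 : ℕ) * P.numSat + (v.2 : ℕ)

/-- The weight of a client in units of the inverse of the common denominator. -/
def intWeight (i : ℤ) : ℤ := scaledWeight P.inp (commonDenom P.inp P.numSat) i

/-- The cost of the artificial arcs from the super source; it exceeds the cost of every routing. -/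
def bigCost : ℤ := 1 + P.numSnap * ∑ i ∈ Finset.range P.numSat, P.intWeight i

/-- The capacities of the flow network. -/
def netU : ℤ → ℤ → ℤ := netCap P.inp (sinks P.inp P.numSat).card

/-- The costs of the flow network. -/
def netH : ℤ → ℤ → ℤ := netCost P.inp P.bigCost
  (weightArray P.numSat P.intWeight (P.numSnap * P.numSat))

theorem super_eq : P.super = (P.inp 1 + 1) * P.inp 0 := by rw [super, inp_one, inp_zero]

theorem super_lt : P.super < P.netSize := by simp [super, netSize]

theorem super_nonneg : 0 ≤ P.super := by unfold super; positivity

theorem lt_netSize_iff {x : ℤ} : x < P.netSize ↔ x ≤ P.super := by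
  simp only [netSize, super]; push_cast; omega

theorem numSat_pos' : (0 : ℤ) < P.numSat := by exact_mod_cast P.numSat_pos

theorem numSnap_pos' : (0 : ℤ) < P.numSnap := by exact_mod_cast P.numSnap_pos

theorem sinks_eq : sinks P.inp P.numSat = P.clients.image P.sink := by
  ext x
  simp only [sinks, Finset.mem_image, Finset.mem_filter, Finset.mem_range]
  constructor
  · rintro ⟨c, ⟨hc, h⟩, rfl⟩
    exact ⟨⟨c, hc⟩, (P.inp_isClient ⟨c, hc⟩).1 h, by rw [sink, inp_one, inp_zero]⟩
  · rintro ⟨c, hc, rfl⟩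
    exact ⟨c, ⟨c.2, (P.inp_isClient c).2 hc⟩, by rw [sink, inp_one, inp_zero]⟩

theorem sink_injective : Function.Injective P.sink := by
  intro a b h
  simp only [sink] at h
  exact Fin.ext (by omega)

theorem card_sinks_eq : (sinks P.inp P.numSat).card = P.clients.card := by
  rw [sinks_eq, Finset.card_image_of_injective _ P.sink_injective]

theorem sink_nonneg (c : Fin P.numSat) : 0 ≤ P.sink c := by unfold sink; positivity

theorem sink_lt (c : Fin P.numSat) : P.sink c < P.super := by
  have := c.2
  rw [sink, super, add_mul, one_mul]; omega

theorem le_sink (c : Fin P.numSat) : (P.numSnap : ℤ) * P.numSat ≤ P.sink c := by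
  rw [sink]; omega

theorem index_nonneg (v : P.Node) : 0 ≤ P.index v := by unfold index; positivity

theorem index_lt (v : P.Node) : P.index v < P.numSnap * P.numSat := by
  have h1 := v.2.2
  have h2 : ((v.1 : ℕ) : ℤ) + 1 ≤ P.numSnap := by have := v.1.2; omega
  calc P.index v < ((v.1 : ℕ) + 1) * P.numSat := by rw [index, add_mul, one_mul]; omega
    _ ≤ _ := by gcongr

theorem index_lt_super (v : P.Node) : P.index v < P.super := by
  have := P.index_lt v
  have := P.numSat_pos'
  rw [super, add_mul, one_mul]; omega

theorem add_ediv {k i n : ℤ} (h0 : 0 ≤ i) (h1 : i < n) : (k * n + i) / n = k := by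
  rw [add_comm, Int.add_mul_ediv_right _ _ (by omega), Int.ediv_eq_zero_of_lt h0 h1, zero_add]

theorem add_emod {k i n : ℤ} (h0 : 0 ≤ i) (h1 : i < n) : (k * n + i) % n = i := by
  rw [add_comm, Int.add_mul_emod_self_right, Int.emod_eq_of_lt h0 h1]

theorem index_div (v : P.Node) : P.index v / P.numSat = (v.1 : ℕ) :=
  add_ediv (by omega) (by have := v.2.2; omega)

theorem index_mod (v : P.Node) : P.index v % P.numSat = (v.2 : ℕ) :=
  add_emod (by omega) (by have := v.2.2; omega)

theorem sink_div (c : Fin P.numSat) : P.sink c / P.numSat = P.numSnap :=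
  add_ediv (by omega) (by have := c.2; omega)

theorem sink_mod (c : Fin P.numSat) : P.sink c % P.numSat = (c : ℕ) :=
  add_emod (by omega) (by have := c.2; omega)

theorem index_injective : Function.Injective P.index := by
  intro u v h
  have h1 := P.index_div u
  have h2 := P.index_mod u
  rw [h, index_div] at h1
  rw [h, index_mod] at h2
  exact Prod.ext (Fin.ext (by omega)) (Fin.ext (by omega))

theorem index_source : P.index P.source = P.inp 2 := by
  simp [index, source, inp_two]

theorem exists_index {x : ℤ} (h0 : 0 ≤ x) (h1 : x < P.numSnap * P.numSat) :
    ∃ v : P.Node, P.index v = x := by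
  have hn := P.numSat_pos'
  have h2 : x / P.numSat < P.numSnap := Int.ediv_lt_of_lt_mul hn h1
  have h3 := Int.ediv_nonneg h0 hn.le
  have h4 := Int.emod_nonneg x hn.ne'
  have h5 := Int.emod_lt_of_pos x hn
  refine ⟨(⟨(x / P.numSat).toNat, by omega⟩, ⟨(x % P.numSat).toNat, by omega⟩), ?_⟩
  rw [index]
  simp only
  rw [Int.toNat_of_nonneg h3, Int.toNat_of_nonneg h4, mul_comm]
  exact Int.mul_ediv_add_emod _ _

/-! ### Capacities and costs of the network -/

theorem netU_super {v : ℤ} (hv : v ≠ P.super) : P.netU P.super v = P.clients.card := by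
  rw [netU, netCap, ← super_eq, if_pos rfl, if_neg hv, card_sinks_eq]

theorem netU_to_super (u : ℤ) : P.netU u P.super = 0 := by
  rw [netU, netCap, ← super_eq, if_pos rfl, if_pos rfl]
  simp

theorem netU_of_ne {u v : ℤ} (hu : u ≠ P.super) (hv : v ≠ P.super) : P.netU u v =
    if u / P.numSat = v / P.numSat then
      P.inp (5 + P.numSat * 3 + (u * P.numSat + v % P.numSat) * 2) * P.size.den
        / (P.inp (6 + P.numSat * 3 + (u * P.numSat + v % P.numSat) * 2) * P.size.num)
    else if u % P.numSat = v % P.numSat then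
      if v / P.numSat = P.numSnap then (P.clients.card : ℤ)
      else if u / P.numSat + 1 = v / P.numSat then P.clients.card else 0
    else 0 := by
  rw [netU, netCap, ← super_eq, if_neg hu, if_neg hv, card_sinks_eq, inp_zero, inp_one, inp_three,
    inp_four]

theorem netH_super {v : ℤ} (hv : v ≠ P.super) :
    P.netH P.super v = if v = P.inp 2 then 0 else P.bigCost := by
  rw [netH, netCost, ← super_eq, if_pos rfl, if_neg hv]

theorem netH_to_super (u : ℤ) : P.netH u P.super = 0 := by
  rw [netH, netCost, ← super_eq, if_pos rfl, if_pos rfl]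
  simp

theorem netH_of_ne {u v : ℤ} (hu : u ≠ P.super) (hv : v ≠ P.super) : P.netH u v =
    if u / P.numSat = v / P.numSat then 0
    else if u % P.numSat = v % P.numSat then
      if v / P.numSat = P.numSnap then
        weightArray P.numSat P.intWeight (P.numSnap * P.numSat) u else 0
    else 0 := by
  rw [netH, netCost, ← super_eq, if_neg hu, if_neg hv, inp_zero, inp_one]

theorem commonDenom_nonneg : 0 ≤ commonDenom P.inp P.numSat :=
  Finset.prod_nonneg fun _ _ => P.inp_nonneg _

theorem intWeight_nonneg (i : ℤ) : 0 ≤ P.intWeight i :=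
  Int.ediv_nonneg (mul_nonneg P.commonDenom_nonneg (P.inp_nonneg _)) (P.inp_nonneg _)

theorem sum_intWeight_nonneg : 0 ≤ ∑ i ∈ Finset.range P.numSat, P.intWeight i :=
  Finset.sum_nonneg fun _ _ => P.intWeight_nonneg _

theorem bigCost_pos : 0 < P.bigCost := by
  have := mul_nonneg P.numSnap_pos'.le P.sum_intWeight_nonneg
  rw [bigCost]; omega

theorem weightArray_nonneg (b x : ℤ) : 0 ≤ weightArray P.numSat P.intWeight b x := by
  unfold weightArray
  split_ifs with h
  · have := Int.ediv_nonneg h.1 P.numSat_pos'.le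
    exact mul_nonneg (by omega) (P.intWeight_nonneg _)
  · exact le_rfl

theorem netU_nonneg (u v : ℤ) : 0 ≤ P.netU u v := by
  by_cases hv : v = P.super
  · rw [hv, netU_to_super]
  · by_cases hu : u = P.super
    · rw [hu, netU_super _ hv]; positivity
    · rw [netU_of_ne _ hu hv]
      split_ifs
      · exact Int.ediv_nonneg (mul_nonneg (P.inp_nonneg _) (by positivity))
          (mul_nonneg (P.inp_nonneg _) (by positivity))
      all_goals positivity

theorem netH_nonneg (u v : ℤ) : 0 ≤ P.netH u v := by
  have := P.bigCost_pos
  by_cases hv : v = P.super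
  · rw [hv, netH_to_super]
  · by_cases hu : u = P.super
    · rw [hu, netH_super _ hv]; split_ifs <;> omega
    · rw [netH_of_ne _ hu hv]
      split_ifs
      · exact le_rfl
      · exact P.weightArray_nonneg _ _
      all_goals exact le_rfl

theorem netH_opposite {u v : ℤ} (hu1 : u ≤ P.super) (h : 0 < P.netH u v) :
    P.netU v u = 0 := by
  by_cases hv : v = P.super
  · rw [hv, netH_to_super] at h; omega
  · by_cases hu : u = P.super
    · rw [hu, netU_to_super]
    · rw [netH_of_ne _ hu hv] at h
      split_ifs at h with h1 h2 h3
      · omega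
      · have h4 : u / P.numSat < P.numSnap + 1 :=
          Int.ediv_lt_of_lt_mul P.numSat_pos' (by rw [super] at hu hu1; omega)
        rw [netU_of_ne _ hv hu, if_neg (Ne.symm h1), if_pos h2.symm, if_neg (by omega),
          if_neg (by omega)]
      all_goals omega

theorem isNetwork : IsNetwork P.netSize P.netU P.netH P.super P.clients.card P.bigCost where
  super_nonneg := P.super_nonneg
  super_lt := P.super_lt
  cap_nonneg u v _ _ _ _ := P.netU_nonneg u v
  cost_nonneg u v _ _ _ _ := P.netH_nonneg u v
  cap_opposite u v _ h1 _ _ h := P.netH_opposite ((P.lt_netSize_iff).1 h1) h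
  cap_super v _ _ h := P.netU_super h
  cost_super v _ _ := by
    have := P.bigCost_pos
    by_cases hv : v = P.super
    · rw [hv, netH_to_super]; omega
    · rw [netH_super _ hv]; split_ifs <;> omega
  big_nonneg := P.bigCost_pos.le

/-- Nodes in the layer of the sinks have no outgoing arcs. -/
theorem lt_of_netU_pos {u v : ℤ} (hu : u ≤ P.super) (huz : u ≠ P.super)
    (hv : v ≤ P.super) (h : 0 < P.netU u v) : u < P.numSnap * P.numSat := by
  by_contra! hlt
  have hn := P.numSat_pos'
  by_cases hvz : v = P.super
  · rw [hvz, netU_to_super] at h; omega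
  · have hd : ∀ x : ℤ, x ≤ P.super → x ≠ P.super → x / P.numSat < P.numSnap + 1 := fun x h1 h2 =>
      Int.ediv_lt_of_lt_mul hn (by rw [super] at h1 h2; omega)
    have h1 := hd u hu huz
    have h2 := hd v hv hvz
    have h3 : (P.numSnap : ℤ) ≤ u / P.numSat := (Int.le_ediv_iff_mul_le hn).2 hlt
    rw [netU_of_ne _ huz hvz] at h
    split_ifs at h with h4 h5 h6
    · rw [P.inp_cap_eq_zero (x := u * P.numSat + v % P.numSat)] at h
      · simp at h
      · have := Int.emod_nonneg v hn.ne'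
        nlinarith
    all_goals omega

theorem netU_index_sink (u : P.Node) (c : Fin P.numSat) :
    P.netU (P.index u) (P.sink c) = if u.2 = c then (P.clients.card : ℤ) else 0 := by
  have h1 : ((u.1 : ℕ) : ℤ) ≠ P.numSnap := by have := u.1.2; omega
  rw [netU_of_ne _ (P.index_lt_super u).ne (P.sink_lt c).ne, index_div, sink_div, index_mod,
    sink_mod, if_neg h1, if_pos rfl]
  refine if_congr ?_ rfl rfl
  rw [Fin.ext_iff]; omega

theorem le_floor_iff (m : ℕ) (p q : NNRat) (hq : 0 < q) :
    (m : ℤ) ≤ (p.num : ℤ) * q.den / (p.den * q.num) ↔ q * m ≤ p := by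
  have hpd : 0 < p.den := p.den_pos
  have hqn : 0 < q.num := NNRat.num_pos.2 hq
  rw [Int.le_ediv_iff_mul_le (by positivity)]
  have hp := NNRat.num_div_den p
  have hq' := NNRat.num_div_den q
  have hqd : 0 < q.den := q.den_pos
  have h1 : (0 : NNRat) < p.den := by exact_mod_cast hpd
  have h2 : (0 : NNRat) < q.den := by exact_mod_cast hqd
  rw [← NNRat.num_div_den p, ← NNRat.num_div_den q, div_mul_eq_mul_div, div_le_div_iff₀ h2 h1]
  rw [NNRat.num_div_den p, NNRat.num_div_den q]
  rw [show (m : ℤ) * (p.den * q.num) = ((q.num * m * p.den : ℕ) : ℤ) by push_cast; ring,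
    show (p.num : ℤ) * q.den = ((p.num * q.den : ℕ) : ℤ) by push_cast; rfl, Nat.cast_le]
  exact_mod_cast Iff.rfl

/-- The capacities of the network count how often the model fits through an arc. -/
theorem le_netU_index_iff (u v : P.Node) {m : ℕ} (hm : m ≤ P.clients.card) :
    (m : ℤ) ≤ P.netU (P.index u) (P.index v) ↔
      m = 0 ∨ ∃ p, P.arcCap u v = some p ∧ P.size * m ≤ p := by
  rw [netU_of_ne _ (P.index_lt_super u).ne (P.index_lt_super v).ne, index_div, index_div, index_mod,
    index_mod, arcCap]
  have h3 : ((v.1 : ℕ) : ℤ) ≠ P.numSnap := by have := v.1.2; omega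
  by_cases h1 : u.1 = v.1
  · have h0 := P.inp_cap u.1 u.2 v.2 (j := 0) (by omega)
    have h1' := P.inp_cap u.1 u.2 v.2 (j := 1) (by omega)
    norm_num at h0 h1'
    rw [if_pos (by rw [h1]), if_pos h1, index, h0, h1', capBlock]
    cases hc : P.cap u.1 u.2 v.2 with
    | none => simp
    | some p =>
        have := le_floor_iff m p P.size P.size_pos
        simp only [encodeRat, Option.some.injEq, exists_eq_left']
        refine Iff.trans this ?_
        constructor
        · exact .inr
        · rintro (rfl | h)
          · simp
          · exact h
  · have h1' : ¬((u.1 : ℕ) : ℤ) = (v.1 : ℕ) := fun h => h1 (Fin.ext (by omega))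
    rw [if_neg h1', if_neg h1]
    by_cases h2 : u.2 = v.2
    · rw [if_pos (by rw [h2]), if_neg h3]
      by_cases h4 : (u.1 : ℕ) + 1 = v.1
      · rw [if_pos (by omega), if_pos ⟨h2, h4⟩]
        simp only [Nat.cast_le, hm, Option.some.injEq, exists_eq_left', true_iff]
        right; gcongr
      · rw [if_neg (by omega), if_neg (by tauto)]
        simp
    · have h2' : ¬((u.2 : ℕ) : ℤ) = (v.2 : ℕ) := fun h => h2 (Fin.ext (by omega))
      rw [if_neg h2', if_neg (by tauto)]
      simp

theorem netH_index (u v : P.Node) : P.netH (P.index u) (P.index v) = 0 := by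
  have h3 : ((v.1 : ℕ) : ℤ) ≠ P.numSnap := by have := v.1.2; omega
  rw [netH_of_ne _ (P.index_lt_super u).ne (P.index_lt_super v).ne, index_div, index_div, if_neg h3]
  split_ifs <;> rfl

theorem netH_index_sink (k : Fin P.numSnap) (c : Fin P.numSat) :
    P.netH (P.index (k, c)) (P.sink c) = ((k : ℕ) + 1) * P.intWeight (c : ℕ) := by
  have h1 : ((k : ℕ) : ℤ) ≠ P.numSnap := by have := k.2; omega
  rw [netH_of_ne _ (P.index_lt_super _).ne (P.sink_lt c).ne, index_div, sink_div, index_mod,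
    sink_mod, if_neg h1, if_pos rfl, if_pos rfl, weightArray,
    if_pos ⟨P.index_nonneg _, P.index_lt _⟩, index_div, index_mod]

theorem netH_sink_index (v : P.Node) (c : Fin P.numSat) :
    P.netH (P.sink c) (P.index v) = 0 := by
  have h3 : ((v.1 : ℕ) : ℤ) ≠ P.numSnap := by have := v.1.2; omega
  rw [netH_of_ne _ (P.sink_lt c).ne (P.index_lt_super _).ne, index_div, sink_div, if_neg h3]
  split_ifs <;> rfl

/-- The integer weights are the weights of the clients multiplied by the common denominator. -/
theorem intWeight_eq {c : Fin P.numSat} (hc : c ∈ P.clients) :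
    (P.intWeight (c : ℕ) : ℚ) = commonDenom P.inp P.numSat * P.weight c := by
  have hden : ((P.weight c).den : ℤ) ∣ commonDenom P.inp P.numSat := by
    rw [← P.inp_weight_den hc]
    exact Finset.dvd_prod_of_mem (fun i : ℕ => P.inp (7 + 3 * i))
      (by simp [c.2, (P.inp_isClient c).2 hc])
  obtain ⟨e, he⟩ := hden
  have hpos : ((P.weight c).den : ℤ) ≠ 0 := by exact_mod_cast (P.weight c).den_ne_zero
  rw [intWeight, scaledWeight, P.inp_weight_num hc, P.inp_weight_den hc, he, mul_assoc,
    Int.mul_ediv_cancel_left _ hpos]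
  have h := NNRat.num_div_den (P.weight c)
  have h' : (P.weight c : ℚ) = (P.weight c).num / (P.weight c).den := by
    conv_lhs => rw [← h]
    push_cast; rfl
  rw [h']
  have hposq : ((P.weight c).den : ℚ) ≠ 0 := by exact_mod_cast (P.weight c).den_ne_zero
  push_cast
  field_simp

theorem commonDenom_pos : 0 < commonDenom P.inp P.numSat := by
  refine Finset.prod_pos fun c hc => ?_
  obtain ⟨h1, h2⟩ := Finset.mem_filter.1 hc
  have h1 := Finset.mem_range.1 h1
  have h3 := (P.inp_isClient ⟨c, h1⟩).1 h2
  have := P.inp_weight_den h3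
  simp only at this
  rw [this]
  exact_mod_cast (P.weight _).den_pos

end UFWS

/-! ### The program -/

namespace RAM

/-- The program for 1-UF-WS: build the flow network, compute a flow of minimum cost, and decompose
it into routes, unless it uses an artificial arc. -/
def solve : Prog :=
  countClients ⨾ accumulateWeights ⨾ fillNetwork ⨾ phaseOne ⨾
    .ite (.eq (entry aRes (.get 0 (.const 2)) superE) (.reg rCount)) phaseTwo
      (.store aOut (.const 0) (.const 0) ⨾ .assign 0 (.const 1))

/-- A step bound for the program, for `n` satellites, `K` snapshots and `N` nodes. -/
def solveSteps (n K N : ℕ) : ℕ :=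
  (n * (3 + 2) + 2 + 1 + 1) + ((K * (n * (2 + 2) + 2 + 2) + 2 + 1) +
    ((N * (N * (12 + 2) + 2 + 2) + 2) + ((n * (augmentSteps N + 1 + 2) + 2) +
      (N * (N * (1 + 2) + 2 + 2) + 2 + (n * (routeSteps N + 1 + 2) + 2 + 1 + 1 + 1) + 1))))

theorem tame_solve : solve.Tame = true := by decide

end RAM

namespace UFWS

open RAM

variable (P : UFWS)

theorem nodes_eq {m : Memory} (h : m.arr 0 = P.inp) : m.nodes = P.netSize := by
  simp [Memory.nodes, h, inp_zero, inp_one, netSize]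

theorem wp_solve : Wp solve (solveSteps P.numSat P.numSnap P.netSize) (input P.encode) fun m =>
    ∃ R p, ResidualInv P.netSize P.netU P.netH P.super P.clients.card (sinks P.inp P.numSat) R p ∧
      (R (P.inp 2) P.super = P.clients.card → ∃ G L,
        DecompInv P.netSize P.super (sinks P.inp P.numSat) (fun u v => P.netU u v - R u v)
          (sinks P.inp P.numSat) G L ∧
        m.reg 0 = (1 :: routeOutput P.inp L P.numSat).length ∧
        Holds (m.arr aOut) 0 (1 :: routeOutput P.inp L P.numSat)) ∧
      (R (P.inp 2) P.super ≠ P.clients.card → m.reg 0 = 1 ∧ m.arr aOut 0 = 0) := by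
  have hf0 : (input P.encode).arr 0 = P.inp := rfl
  have hz := P.super_eq
  refine Wp.seq ((wp_countClients (n := P.numSat) hf0 P.inp_zero).mono le_rfl ?_)
  intro m1 ha1 ⟨hcount1, hdenom1⟩ _
  have hf1 : m1.arr 0 = P.inp := (ha1.arr _ (by decide)).trans hf0
  refine Wp.seq ((wp_accumulateWeights (n := P.numSat) (K := P.numSnap) hf1 P.inp_zero P.inp_one
    ?_ hdenom1).mono le_rfl ?_)
  · rw [ha1.arr _ (by decide)]
    funext x
    simp [input]
  intro m2 ha2 ⟨hweight2, hbig2⟩ _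
  have hf2 : m2.arr 0 = P.inp := (ha2.arr _ (by decide)).trans hf1
  have hcount2 : m2.reg rCount = (sinks P.inp P.numSat).card :=
    (ha2.reg _ (by decide)).trans hcount1
  refine Wp.seq ((wp_fillNetwork hf2 (P.nodes_eq hf2)).mono le_rfl ?_)
  intro m3 ha3 ⟨hnet3, hres3⟩ _
  rw [hcount2, hbig2, hweight2] at hnet3
  rw [hcount2] at hres3
  change HoldsNetwork P.netSize P.netU P.netH P.bigCost P.inp m3 at hnet3
  have hcount3 : m3.reg rCount = (sinks P.inp P.numSat).card :=
    (ha3.reg _ (by decide)).trans hcount2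
  have hnet : IsNetwork P.netSize P.netU P.netH ((P.inp 1 + 1) * P.inp 0)
      (sinks P.inp P.numSat).card P.bigCost := by
    rw [← hz, card_sinks_eq]; exact P.isNetwork
  have hpot3 : m3.arr aPot = 0 := by
    rw [ha3.arr _ (by decide), ha2.arr _ (by decide), ha1.arr _ (by decide)]
    funext x
    simp [input]
  refine Wp.seq ((wp_phaseOne hnet3 P.inp_zero P.inp_one hnet hres3 hpot3).mono le_rfl ?_)
  intro m4 ha4 ⟨p, hI⟩ _
  rw [← hz, card_sinks_eq] at hI
  have hf4 : m4.arr 0 = P.inp := (ha4.arr _ (by decide)).trans hnet3.inp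
  have hcount4 : m4.reg rCount = P.clients.card := by
    rw [ha4.reg _ (by decide), hcount3, card_sinks_eq]
  have hN4 := P.nodes_eq hf4
  have hcap4 : ∀ u v : ℤ, 0 ≤ u → u < P.netSize → 0 ≤ v → v < P.netSize →
      mat P.netSize (m4.arr aCap) u v = P.netU u v := by
    rw [ha4.arr _ (by decide)]; exact hnet3.cap
  have htest : (entry aRes (.get 0 (.const 2)) superE).eval m4 =
      mat P.netSize (m4.arr aRes) (P.inp 2) P.super := by
    simp [entry, mat, hf4, hN4, hz]
  refine Wp.ite (fun h => ?_) (fun h => ?_)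
  · rw [Expr.eval_eq_ne_zero, htest, Expr.eval_reg, hcount4] at h
    refine (wp_phaseTwo (n := P.numSat) (K := P.numSnap) (z := P.super) (U := P.netU) hf4 hN4
      P.inp_zero P.inp_one hz P.super_lt hcap4 ?_ hI.net).mono le_rfl ?_
    · intro u v a b c d
      have := hI.add_opposite u v a b c d
      omega
    · intro m5 _ h5
      exact ⟨_, p, hI, fun _ => h5, fun h' => (h' h).elim⟩
  · rw [Expr.eval_eq_eq_zero, htest, Expr.eval_reg, hcount4] at h
    refine (Wp.store_seq (Wp.assign ⟨_, p, hI, fun h' => (h h').elim, fun _ => ?_⟩)).mono ?_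
      fun _ _ h => h
    · omega
    · simp

end UFWS

/-! ### Routings as flows -/

namespace UFWS

open RAM

theorem zip_tail_append_singleton {α : Type*} (b : α) : ∀ (v : α) (l : List α),
    ((v :: l) ++ [b]).zip ((v :: l) ++ [b]).tail =
      (v :: l).zip (v :: l).tail ++ [((v :: l).getLast (by simp), b)]
  | v, [] => rfl
  | v, u :: l => by
      have := zip_tail_append_singleton b u l
      simp only [List.cons_append, List.tail_cons, List.zip_cons_cons] at this ⊢
      rw [this]
      rfl

theorem isChain_iff_forall_mem_zip {α : Type*} {r : α → α → Prop} : ∀ {l : List α},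
    l.IsChain r ↔ ∀ u v, (u, v) ∈ l.zip l.tail → r u v
  | [] => by simp
  | [v] => by simp
  | v :: u :: l => by
      rw [List.isChain_cons_cons, isChain_iff_forall_mem_zip (l := u :: l)]
      simp only [List.tail_cons, List.zip_cons_cons, List.mem_cons, Prod.mk.injEq]
      constructor
      · rintro ⟨h1, h2⟩ a b (⟨rfl, rfl⟩ | h)
        exacts [h1, h2 a b h]
      · exact fun h => ⟨h v u (.inl ⟨rfl, rfl⟩), fun a b hab => h a b (.inr hab)⟩

theorem mem_zip_tail_append {α : Type*} (x y : α) (b : List α) : ∀ a : List α,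
    (x, y) ∈ (a ++ x :: y :: b).zip (a ++ x :: y :: b).tail
  | [] => by simp
  | [v] => by simp
  | v :: u :: a => by
      have := mem_zip_tail_append x y b (u :: a)
      simp only [List.cons_append, List.tail_cons, List.zip_cons_cons] at this ⊢
      exact List.mem_cons_of_mem _ this

theorem pathCost_eq_sum (d : ℤ → ℤ → ℤ) : ∀ l : List ℤ,
    pathCost d l = ((l.zip l.tail).map fun p => d p.1 p.2).sum
  | [] => rfl
  | [_] => rfl
  | v :: u :: l => by
      rw [pathCost, pathCost_eq_sum d (u :: l)]
      rfl

/-- Pricing every arc with the cost of its reverse subtracted doubles the cost of an antisymmetric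
flow. -/
theorem sum_mul_sub_eq {s : Finset ℤ} {E H : ℤ → ℤ → ℤ} (hE : ∀ u ∈ s, ∀ v ∈ s, E v u = -E u v) :
    ∑ u ∈ s, ∑ v ∈ s, E u v * (H u v - H v u) = 2 * ∑ u ∈ s, ∑ v ∈ s, E u v * H u v := by
  have h : ∑ u ∈ s, ∑ v ∈ s, E u v * H v u = -∑ u ∈ s, ∑ v ∈ s, E u v * H u v := by
    rw [Finset.sum_comm, ← Finset.sum_neg_distrib]
    refine Finset.sum_congr rfl fun u hu => ?_
    rw [← Finset.sum_neg_distrib]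
    refine Finset.sum_congr rfl fun v hv => ?_
    rw [hE u hu v hv, neg_mul]
  simp only [mul_sub, Finset.sum_sub_distrib]
  rw [h]; ring

variable (P : UFWS)

/-- The cost of a unit of flow on an arc of the residual network. -/
def arcCost (u v : ℤ) : ℤ := P.netH u v - P.netH v u

theorem arcCost_antisymm (u v : ℤ) : P.arcCost v u = -P.arcCost u v := by
  simp [arcCost]

/-- The nodes of the network. -/
noncomputable def nodeSet : Finset ℤ := Finset.Ico 0 (P.netSize : ℤ)

theorem mem_nodeSet {x : ℤ} : x ∈ P.nodeSet ↔ 0 ≤ x ∧ x < P.netSize := Finset.mem_Ico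

theorem super_mem : P.super ∈ P.nodeSet := P.mem_nodeSet.2 ⟨P.super_nonneg, P.super_lt⟩

theorem index_mem (v : P.Node) : P.index v ∈ P.nodeSet :=
  P.mem_nodeSet.2 ⟨P.index_nonneg v, (P.index_lt_super v).trans P.super_lt⟩

theorem sink_mem (c : Fin P.numSat) : P.sink c ∈ P.nodeSet :=
  P.mem_nodeSet.2 ⟨P.sink_nonneg c, (P.sink_lt c).trans P.super_lt⟩

/-- The path in the network, from the super source to the sink of the client `c`, for a path in the
time-varying graph. -/
def fullPath (c : Fin P.numSat) (l : List P.Node) : List ℤ :=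
  P.super :: (l.map P.index ++ [P.sink c])

variable {P} {c : Fin P.numSat} {l : List P.Node}

theorem zip_tail_fullPath {v w : P.Node} (hv : l.head? = some v) (hw : l.getLast? = some w) :
    (P.fullPath c l).zip (P.fullPath c l).tail = (P.super, P.index v) ::
      ((l.zip l.tail).map (Prod.map P.index P.index) ++ [(P.index w, P.sink c)]) := by
  obtain ⟨l, rfl⟩ : ∃ l', l = v :: l' := by
    cases l with
    | nil => simp at hv
    | cons a l => exact ⟨l, by simpa using hv⟩
  have h1 := zip_tail_append_singleton (P.sink c) (P.index v) (l.map P.index)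
  have h2 : (P.index v :: l.map P.index).getLast (by simp) = P.index w := by
    have := List.getLast?_map (f := P.index) (l := v :: l)
    rw [hw, List.map_cons, List.getLast?_eq_some_getLast (by simp)] at this
    simpa using this
  rw [h2] at h1
  rw [fullPath, List.tail_cons, List.map_cons, List.cons_append, List.zip_cons_cons,
    ← List.zip_map]
  simpa using h1

theorem fullPath_subset : ∀ x ∈ P.fullPath c l, x ∈ P.nodeSet := by
  intro x hx
  simp only [fullPath, List.mem_cons, List.mem_append, List.mem_map, List.not_mem_nil,
    or_false] at hx
  rcases hx with rfl | ⟨v, _, rfl⟩ | rfl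
  exacts [P.super_mem, P.index_mem v, P.sink_mem c]

theorem index_ne_sink (v : P.Node) (c : Fin P.numSat) : P.index v ≠ P.sink c :=
  ((P.index_lt v).trans_le (P.le_sink c)).ne

theorem nodup_fullPath (h : l.Nodup) : (P.fullPath c l).Nodup := by
  rw [fullPath, List.nodup_cons, List.nodup_append]
  refine ⟨?_, h.map P.index_injective, by simp, ?_⟩
  · simp only [List.mem_append, List.mem_map, List.mem_singleton, not_or, not_exists, not_and]
    exact ⟨fun v _ => (P.index_lt_super v).ne, (P.sink_lt c).ne'⟩
  · simp only [List.mem_map, List.mem_singleton]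
    rintro _ ⟨v, _, rfl⟩ _ rfl
    exact P.index_ne_sink v c

theorem arcCost_index (u v : P.Node) : P.arcCost (P.index u) (P.index v) = 0 := by
  rw [arcCost, netH_index, netH_index, sub_zero]

theorem pathCost_fullPath (h : P.IsRoute c l) :
    pathCost P.arcCost (P.fullPath c l) = P.arrival l * P.intWeight (c : ℕ) := by
  obtain ⟨hhead, ⟨k, hk⟩, -, -⟩ := h
  have h1 : P.arcCost P.super (P.index P.source) = 0 := by
    rw [arcCost, netH_to_super, netH_super _ (P.index_lt_super _).ne, if_pos P.index_source,
      sub_zero]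
  have h2 : P.arcCost (P.index (k, c)) (P.sink c) = ((k : ℕ) + 1) * P.intWeight (c : ℕ) := by
    rw [arcCost, netH_index_sink, netH_sink_index, sub_zero]
  rw [pathCost_eq_sum, zip_tail_fullPath hhead hk]
  have h3 : (fun p : ℤ × ℤ => P.arcCost p.1 p.2) ∘ Prod.map P.index P.index = fun _ => 0 := by
    funext p
    exact arcCost_index p.1 p.2
  simp [h1, h2, h3, arrival, hk]

theorem mem_zip_fullPath (h : P.IsRoute c l) {u v : ℤ}
    (huv : (u, v) ∈ (P.fullPath c l).zip (P.fullPath c l).tail) :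
    (u = P.super ∧ v = P.index P.source) ∨
      (∃ u' v', (u', v') ∈ l.zip l.tail ∧ u = P.index u' ∧ v = P.index v') ∨
      ∃ k, u = P.index (k, c) ∧ v = P.sink c := by
  obtain ⟨hhead, ⟨k, hk⟩, -, -⟩ := h
  rw [zip_tail_fullPath hhead hk] at huv
  simp only [List.mem_cons, List.mem_append, List.mem_map, Prod.mk.injEq, List.not_mem_nil,
    or_false] at huv
  rcases huv with h | ⟨⟨u', v'⟩, h1, h2⟩ | h
  · exact .inl h
  · rw [Prod.map, Prod.mk.injEq] at h2
    exact .inr (.inl ⟨u', v', h1, h2.1.symm, h2.2.symm⟩)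
  · exact .inr (.inr ⟨k, h⟩)

theorem index_mem_zip_fullPath (h : P.IsRoute c l) {u v : P.Node} :
    (P.index u, P.index v) ∈ (P.fullPath c l).zip (P.fullPath c l).tail ↔
      (u, v) ∈ l.zip l.tail := by
  constructor
  · intro huv
    rcases mem_zip_fullPath h huv with ⟨h1, -⟩ | ⟨u', v', h1, h2, h3⟩ | ⟨k, -, h1⟩
    · exact ((P.index_lt_super u).ne h1).elim
    · rwa [P.index_injective h2, P.index_injective h3]
    · exact (P.index_ne_sink v c h1).elim
  · intro huv
    obtain ⟨hhead, ⟨k, hk⟩, -, -⟩ := h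
    rw [zip_tail_fullPath hhead hk]
    exact List.mem_cons_of_mem _ (List.mem_append_left _ (List.mem_map_of_mem huv))

variable {r : P.Routing}

/-- The flow of a routing. -/
def routingFlow (P : UFWS) (r : P.Routing) (u v : ℤ) : ℤ :=
  ∑ c ∈ P.clients, pathFlow (P.fullPath c (r c)) u v

theorem routingFlow_antisymm (u v : ℤ) : P.routingFlow r v u = -P.routingFlow r u v := by
  simp only [routingFlow, ← Finset.sum_neg_distrib]
  exact Finset.sum_congr rfl fun c _ => pathFlow_antisymm _ _ _

theorem sum_routingFlow (u : ℤ) : ∑ v ∈ P.nodeSet, P.routingFlow r u v =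
    demand P.super (sinks P.inp P.numSat) u := by
  simp only [routingFlow]
  rw [Finset.sum_comm]
  have h : ∀ c ∈ P.clients, ∑ v ∈ P.nodeSet, pathFlow (P.fullPath c (r c)) u v =
      (if u = P.super then 1 else 0) - if u = P.sink c then 1 else 0 := by
    intro c _
    rw [fullPath, sum_pathFlow _ _ fullPath_subset]
    simp
  rw [Finset.sum_congr rfl h, Finset.sum_sub_distrib, demand, card_sinks_eq]
  by_cases hu : u = P.super
  · rw [if_pos hu, Finset.sum_eq_zero (s := P.clients) (f := fun c => if u = P.sink c then 1 else 0)
      fun c _ => if_neg (by rw [hu]; exact (P.sink_lt c).ne')]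
    simp [hu]
  · rw [if_neg hu]
    simp only [if_neg hu, Finset.sum_const_zero, zero_sub]
    rw [sinks_eq]
    split_ifs with h
    · obtain ⟨c, hc, rfl⟩ := Finset.mem_image.1 h
      rw [Finset.sum_eq_single_of_mem c hc fun b _ hb =>
        if_neg fun h' => hb (P.sink_injective h').symm]
      simp
    · rw [Finset.sum_eq_zero fun c hc => if_neg fun h' => h (Finset.mem_image.2 ⟨c, hc, h'.symm⟩)]
      simp

theorem routingFlow_le (h : P.IsFeasible r) (u v : ℤ) : P.routingFlow r u v ≤ P.netU u v := by
  obtain ⟨hroute, -, hload⟩ := h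
  set A := P.clients.filter fun c => (u, v) ∈ (P.fullPath c (r c)).zip (P.fullPath c (r c)).tail
    with hA
  have hle : P.routingFlow r u v ≤ A.card := by
    rw [routingFlow, hA, Finset.card_filter]
    push_cast
    refine Finset.sum_le_sum fun c hc => ?_
    rcases pathFlow_cases (nodup_fullPath (c := c) (hroute c hc).2.2.1) u v with
      ⟨h1, h2⟩ | ⟨h1, -, h2⟩ | ⟨h1, -, h2⟩ <;> simp [h1, h2]
  refine hle.trans ?_
  have hcard : A.card ≤ P.clients.card := Finset.card_filter_le _ _
  rcases Finset.eq_empty_or_nonempty A with h0 | ⟨c, hc⟩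
  · rw [h0]; simpa using P.netU_nonneg u v
  obtain ⟨hcC, hc⟩ := Finset.mem_filter.1 hc
  rcases mem_zip_fullPath (hroute c hcC) hc with ⟨rfl, rfl⟩ | ⟨u', v', h1, rfl, rfl⟩ | ⟨k, rfl, rfl⟩
  · rw [netU_super _ (P.index_lt_super _).ne]
    exact_mod_cast hcard
  · obtain ⟨p, hp⟩ := Option.isSome_iff_exists.1
      (isChain_iff_forall_mem_zip.1 (hroute c hcC).2.2.2 _ _ h1)
    refine (P.le_netU_index_iff u' v' hcard).2 (.inr ⟨p, hp, ?_⟩)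
    have := hload u' v' p hp
    rw [load] at this
    convert this using 4
    rw [hA]
    exact Finset.filter_congr fun c hc => index_mem_zip_fullPath (hroute c hc)
  · rw [netU_index_sink, if_pos rfl]
    exact_mod_cast hcard

theorem cost_routingFlow (h : ∀ c ∈ P.clients, P.IsRoute c (r c)) :
    ∑ u ∈ P.nodeSet, ∑ v ∈ P.nodeSet, P.routingFlow r u v * P.arcCost u v =
      2 * ∑ c ∈ P.clients, P.arrival (r c) * P.intWeight (c : ℕ) := by
  simp only [routingFlow, Finset.sum_mul]
  rw [Finset.sum_congr rfl fun u _ => Finset.sum_comm, Finset.sum_comm, Finset.mul_sum]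
  refine Finset.sum_congr rfl fun c hc => ?_
  rw [sum_pathFlow_mul P.arcCost_antisymm _ fullPath_subset, pathCost_fullPath (h c hc)]

/-- The objective in units of the inverse of the common denominator. -/
theorem objective_eq (r : P.Routing) : (commonDenom P.inp P.numSat : ℚ) * (P.objective r : ℚ) =
    ((∑ c ∈ P.clients, P.arrival (r c) * P.intWeight (c : ℕ) : ℤ) : ℚ) := by
  rw [objective]
  push_cast
  rw [Finset.mul_sum]
  refine Finset.sum_congr rfl fun c hc => ?_
  rw [P.intWeight_eq hc]
  ring

theorem arrival_le (l : List P.Node) : P.arrival l ≤ P.numSnap := by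
  unfold arrival
  split
  · exact Fin.is_lt _
  · exact Nat.zero_le _

theorem sum_arrival_lt_bigCost (r : P.Routing) :
    ∑ c ∈ P.clients, (P.arrival (r c) : ℤ) * P.intWeight (c : ℕ) < P.bigCost := by
  have h1 : ∑ c ∈ P.clients, (P.arrival (r c) : ℤ) * P.intWeight (c : ℕ) ≤
      ∑ c : Fin P.numSat, (P.numSnap : ℤ) * P.intWeight (c : ℕ) := by
    refine (Finset.sum_le_sum fun c _ => ?_).trans (Finset.sum_le_sum_of_subset_of_nonneg
      (Finset.subset_univ _) fun c _ _ => mul_nonneg (by positivity) (P.intWeight_nonneg _))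
    have := P.arrival_le (r c)
    have := P.intWeight_nonneg (c : ℕ)
    gcongr
  rw [← Finset.mul_sum, Fin.sum_univ_eq_sum_range (fun i : ℕ => P.intWeight (i : ℤ))] at h1
  rw [bigCost]; omega

end UFWS

/-! ### Optimal routings from flows of minimum cost -/

namespace UFWS

open RAM

variable {P : UFWS} {R : ℤ → ℤ → ℤ} {p : ℤ → ℤ} {G : ℤ → ℤ → ℤ} {L : ℤ → List ℤ}

/-- A flow of minimum cost, given by its residual capacities. -/
abbrev IsOptimalResidual (P : UFWS) (R : ℤ → ℤ → ℤ) (p : ℤ → ℤ) : Prop :=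
  ResidualInv P.netSize P.netU P.netH P.super P.clients.card (sinks P.inp P.numSat) R p

/-- A decomposition of the flow with the residual capacities `R` into one path for every client. -/
abbrev IsDecomposition (P : UFWS) (R G : ℤ → ℤ → ℤ) (L : ℤ → List ℤ) : Prop :=
  DecompInv P.netSize P.super (sinks P.inp P.numSat) (fun u v => P.netU u v - R u v)
    (sinks P.inp P.numSat) G L

namespace IsOptimalResidual

theorem flow_antisymm (hR : P.IsOptimalResidual R p) {u v : ℤ} (hu : u ∈ P.nodeSet)
    (hv : v ∈ P.nodeSet) : P.netU v u - R v u = -(P.netU u v - R u v) := by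
  rw [mem_nodeSet] at hu hv
  have := hR.add_opposite u v hu.1 hu.2 hv.1 hv.2
  omega

theorem flow_le (hR : P.IsOptimalResidual R p) {u v : ℤ} (hu : u ∈ P.nodeSet)
    (hv : v ∈ P.nodeSet) : P.netU u v - R u v ≤ P.netU u v := by
  rw [mem_nodeSet] at hu hv
  have := hR.nonneg u v hu.1 hu.2 hv.1 hv.2
  omega

theorem flow_super_nonneg (hR : P.IsOptimalResidual R p) {v : ℤ} (hv : v ∈ P.nodeSet) :
    0 ≤ P.netU P.super v - R P.super v := by
  have h1 := hR.flow_antisymm hv P.super_mem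
  have h2 := hR.flow_le hv P.super_mem
  rw [netU_to_super] at h1 h2
  omega

theorem sum_flow_super (hR : P.IsOptimalResidual R p) :
    ∑ v ∈ P.nodeSet, (P.netU P.super v - R P.super v) = P.clients.card := by
  rw [nodeSet, hR.net _ P.super_nonneg P.super_lt, demand, if_pos rfl, card_sinks_eq]

theorem flow_source (hR : P.IsOptimalResidual R p) :
    P.netU P.super (P.index P.source) - R P.super (P.index P.source) = R (P.inp 2) P.super := by
  rw [hR.flow_antisymm (P.index_mem _) P.super_mem, netU_to_super, index_source]
  ring

/-- If the arc from the super source to the server carries one unit for every client, as its residual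
reverse capacity tells, then no artificial arc carries flow. -/
theorem flow_super_le_zero (hR : P.IsOptimalResidual R p)
    (hs : R (P.inp 2) P.super = P.clients.card) {v : ℤ} (hv : v ∈ P.nodeSet)
    (hne : v ≠ P.index P.source) : P.netU P.super v - R P.super v ≤ 0 := by
  have h1 := hR.sum_flow_super
  rw [← Finset.add_sum_erase _ _ (P.index_mem P.source), hR.flow_source, hs] at h1
  have h2 := Finset.single_le_sum (s := P.nodeSet.erase (P.index P.source))
    (f := fun v => P.netU P.super v - R P.super v)
    (fun x hx => hR.flow_super_nonneg (Finset.mem_of_mem_erase hx)) (Finset.mem_erase.2 ⟨hne, hv⟩)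
  omega

theorem cost_le (hR : P.IsOptimalResidual R p) {r : P.Routing} (hr : P.IsFeasible r) :
    ∑ u ∈ P.nodeSet, ∑ v ∈ P.nodeSet, (P.netU u v - R u v) * P.arcCost u v ≤
      2 * ∑ c ∈ P.clients, P.arrival (r c) * P.intWeight (c : ℕ) := by
  rw [← cost_routingFlow hr.1]
  exact ResidualInv.cost_le hR routingFlow_antisymm (fun u v _ _ _ _ => routingFlow_le hr u v)
    fun u _ _ => sum_routingFlow u

/-- An antisymmetric flow has non-negative cost on every arc: an arc of positive cost has no reverse
arc, so the flow along it cannot be negative. -/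
theorem mul_netH_nonneg {E : ℤ → ℤ → ℤ} (hanti : ∀ u ∈ P.nodeSet, ∀ v ∈ P.nodeSet, E v u = -E u v)
    (hle : ∀ u ∈ P.nodeSet, ∀ v ∈ P.nodeSet, P.netU u v = 0 → E u v ≤ 0) {u v : ℤ}
    (hu : u ∈ P.nodeSet) (hv : v ∈ P.nodeSet) : 0 ≤ E u v * P.netH u v := by
  rcases (P.netH_nonneg u v).eq_or_lt with h | h
  · rw [← h, mul_zero]
  · have h1 := P.netH_opposite (P.lt_netSize_iff.1 (P.mem_nodeSet.1 hu).2) h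
    have h2 := hle v hv u hu h1
    rw [hanti u hu v hv] at h2
    exact mul_nonneg (by omega) h.le

/-- If a cheapest flow uses an artificial arc, then its cost is too high for a routing. -/
theorem not_isFeasible (hR : P.IsOptimalResidual R p)
    (hs : R (P.inp 2) P.super ≠ P.clients.card) (r : P.Routing) : ¬P.IsFeasible r := by
  intro hr
  have hle := hR.flow_le P.super_mem (P.index_mem P.source)
  rw [hR.flow_source, netU_super _ (P.index_lt_super _).ne] at hle
  have h1 := hR.sum_flow_super
  rw [← Finset.add_sum_erase _ _ (P.index_mem P.source), hR.flow_source] at h1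
  obtain ⟨v, hv, hpos⟩ := Finset.exists_lt_of_sum_lt (s := P.nodeSet.erase (P.index P.source))
    (f := 0) (g := fun v => P.netU P.super v - R P.super v)
    (by simp only [Pi.zero_apply, Finset.sum_const_zero]; omega)
  rw [Pi.zero_apply] at hpos
  obtain ⟨hne, hv⟩ := Finset.mem_erase.1 hv
  have hvz : v ≠ P.super := by
    rintro rfl
    have := hR.flow_antisymm P.super_mem P.super_mem
    omega
  have h2 := hR.cost_le hr
  have h3 : ∑ u ∈ P.nodeSet, ∑ v ∈ P.nodeSet, (P.netU u v - R u v) * P.arcCost u v = _ :=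
    sum_mul_sub_eq (E := fun u v => P.netU u v - R u v) fun u hu v hv => hR.flow_antisymm hu hv
  have hnn : ∀ u ∈ P.nodeSet, ∀ v ∈ P.nodeSet, 0 ≤ (P.netU u v - R u v) * P.netH u v :=
    fun u hu v hv => mul_netH_nonneg (E := fun u v => P.netU u v - R u v)
      (fun u hu v hv => hR.flow_antisymm hu hv)
      (fun u hu v hv h => h ▸ hR.flow_le hu hv) hu hv
  have h4 : (P.netU P.super v - R P.super v) * P.netH P.super v ≤
      ∑ u ∈ P.nodeSet, ∑ v ∈ P.nodeSet, (P.netU u v - R u v) * P.netH u v :=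
    (Finset.single_le_sum (f := fun v => (P.netU P.super v - R P.super v) * P.netH P.super v)
      (fun v hv => hnn _ P.super_mem v hv) hv).trans
    (Finset.single_le_sum (f := fun u => ∑ v ∈ P.nodeSet, (P.netU u v - R u v) * P.netH u v)
      (fun u hu => Finset.sum_nonneg fun v hv => hnn u hu v hv) P.super_mem)
  rw [netH_super _ hvz, if_neg (by rwa [← index_source])] at h4
  have h5 := sum_arrival_lt_bigCost r
  have h6 := P.bigCost_pos
  nlinarith

end IsOptimalResidual

namespace IsDecomposition

theorem arc_pos (hR : P.IsOptimalResidual R p) (hD : P.IsDecomposition R G L) {c : Fin P.numSat}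
    (hc : c ∈ P.clients) {u v : ℤ} (h : (u, v) ∈ (L (P.sink c)).zip (L (P.sink c)).tail) :
    u ∈ P.nodeSet ∧ v ∈ P.nodeSet ∧ 0 < P.netU u v - R u v ∧ 0 < P.netU u v := by
  have hcS : P.sink c ∈ sinks P.inp P.numSat := by
    rw [sinks_eq]; exact Finset.mem_image_of_mem _ hc
  have hu := P.mem_nodeSet.2 (hD.range _ hcS u (mem_of_mem_zip_tail h).1)
  have hv := P.mem_nodeSet.2 (hD.range _ hcS v (List.mem_of_mem_tail (mem_of_mem_zip_tail h).2))
  have h1 := hD.pos _ hcS u v h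
  exact ⟨hu, hv, h1, h1.trans_le (hR.flow_le hu hv)⟩

/-- The paths of the decomposition come from routes in the time-varying graph. -/
theorem exists_isRoute (hR : P.IsOptimalResidual R p) (hD : P.IsDecomposition R G L)
    (hs : R (P.inp 2) P.super = P.clients.card) {c : Fin P.numSat} (hc : c ∈ P.clients) :
    ∃ l, L (P.sink c) = P.fullPath c l ∧ P.IsRoute c l := by
  have hcS : P.sink c ∈ sinks P.inp P.numSat := by
    rw [sinks_eq]; exact Finset.mem_image_of_mem _ hc
  have harc := fun u v => arc_pos hR hD hc (u := u) (v := v)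
  have hnodup := hD.nodup _ hcS
  obtain ⟨xs, hxs⟩ : ∃ xs, L (P.sink c) = P.super :: (xs ++ [P.sink c]) := by
    have h1 := hD.head _ hcS
    have h2 := hD.last _ hcS
    obtain ⟨l, hl⟩ : ∃ l, L (P.sink c) = P.super :: l := by
      cases hL : L (P.sink c) with
      | nil => simp [hL] at h1
      | cons a l => exact ⟨l, by rw [hL] at h1; simpa using h1⟩
    rw [hl] at h2
    rcases List.eq_nil_or_concat' l with rfl | ⟨xs, y, rfl⟩
    · simp only [List.getLast?_singleton, Option.some.injEq] at h2
      exact ((P.sink_lt c).ne h2.symm).elim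
    · rw [← List.cons_append, List.getLast?_append_of_ne_nil _ (by simp)] at h2
      simp only [List.getLast?_singleton, Option.some.injEq] at h2
      exact ⟨xs, by rw [hl, h2]⟩
  rw [hxs] at harc hnodup
  -- every inner node of the path has an outgoing arc, so it is not a sink
  have hinner : ∀ x ∈ xs, x ∈ Set.range P.index := by
    intro x hx
    obtain ⟨a, b, rfl⟩ := List.append_of_mem hx
    obtain ⟨y, b', hb⟩ := List.exists_cons_of_ne_nil (l := b ++ [P.sink c]) (by simp)
    rw [List.append_assoc, List.cons_append, hb, ← List.cons_append] at harc hnodup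
    obtain ⟨h1, h2, -, h3⟩ := harc x y (mem_zip_tail_append x y b' (P.super :: a))
    rw [mem_nodeSet, lt_netSize_iff] at h1 h2
    have hxz : x ≠ P.super := by
      rintro rfl
      simp at hnodup
    exact P.exists_index h1.1 (P.lt_of_netU_pos h1.2 hxz h2.2 h3)
  obtain ⟨l, rfl⟩ : xs ∈ Set.range (List.map P.index) := by
    rw [Set.range_list_map]; exact hinner
  refine ⟨l, hxs, ?_⟩
  have hl : l ≠ [] := by
    rintro rfl
    obtain ⟨-, hv, h1, -⟩ := harc P.super (P.sink c) (by simp)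
    have := hR.flow_super_le_zero hs hv (P.index_ne_sink _ c).symm
    omega
  obtain ⟨v, l', rfl⟩ := List.exists_cons_of_ne_nil hl
  obtain ⟨w, hw⟩ : ∃ w, (v :: l').getLast? = some w := ⟨_, List.getLast?_eq_some_getLast (by simp)⟩
  have hz := zip_tail_fullPath (c := c) (v := v) rfl hw
  rw [fullPath] at hz
  rw [hz] at harc
  obtain rfl : v = P.source := by
    obtain ⟨-, hv, h1, -⟩ := harc P.super (P.index v) (by simp)
    by_contra hne
    have := hR.flow_super_le_zero hs hv fun h => hne (P.index_injective h)
    omega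
  obtain ⟨-, -, -, h1⟩ := harc (P.index w) (P.sink c) (by simp)
  rw [netU_index_sink] at h1
  have hwc : w.2 = c := by
    by_contra hne
    rw [if_neg hne] at h1
    omega
  refine ⟨rfl, ⟨w.1, by rw [hw, ← hwc]⟩, ?_, ?_⟩
  · rw [List.nodup_cons, List.nodup_append] at hnodup
    exact hnodup.2.1.of_map
  · rw [isChain_iff_forall_mem_zip]
    intro a b hab
    obtain ⟨-, -, -, h2⟩ := harc (P.index a) (P.index b)
      (List.mem_cons_of_mem _ (List.mem_append_left _ (List.mem_map_of_mem hab)))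
    have hcard : 1 ≤ P.clients.card := Finset.card_pos.2 ⟨c, hc⟩
    rcases (P.le_netU_index_iff a b hcard).1 (by push_cast; omega) with h3 | ⟨q, hq, -⟩
    · omega
    · rw [hq]; rfl

/-- The routing that the decomposition yields is optimal. -/
theorem exists_isOptimal (hR : P.IsOptimalResidual R p) (hD : P.IsDecomposition R G L)
    (hs : R (P.inp 2) P.super = P.clients.card) :
    ∃ r, P.IsOptimal r ∧ ∀ c ∈ P.clients, L (P.sink c) = P.fullPath c (r c) := by
  choose! r0 hr0 using fun c (hc : c ∈ P.clients) => exists_isRoute hR hD hs hc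
  set r : P.Routing := fun c => if c ∈ P.clients then r0 c else [] with hr
  have hrL : ∀ c ∈ P.clients, L (P.sink c) = P.fullPath c (r c) ∧ P.IsRoute c (r c) := by
    intro c hc
    simp only [hr, if_pos hc]
    exact hr0 c hc
  refine ⟨r, ⟨⟨fun c hc => (hrL c hc).2, fun c hc => by simp [hr, hc], ?_⟩, ?_⟩,
    fun c hc => (hrL c hc).1⟩
  · intro u v q hq
    set m := (P.clients.filter fun c => (u, v) ∈ (r c).zip (r c).tail).card with hm
    have hmC : m ≤ P.clients.card := Finset.card_filter_le _ _
    have huN := P.mem_nodeSet.1 (P.index_mem u)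
    have hvN := P.mem_nodeSet.1 (P.index_mem v)
    have huses := hD.uses _ _ huN.1 huN.2 hvN.1 hvN.2
    have hcard : ((sinks P.inp P.numSat).filter fun t =>
        (P.index u, P.index v) ∈ (L t).zip (L t).tail).card = m := by
      rw [sinks_eq, Finset.filter_image, Finset.card_image_of_injective _ P.sink_injective, hm]
      refine congrArg Finset.card (Finset.filter_congr fun c hc => ?_)
      rw [(hrL c hc).1]
      exact index_mem_zip_fullPath (hrL c hc).2
    rw [hcard] at huses
    have hle := hR.flow_le (P.index_mem u) (P.index_mem v)
    have hU := P.netU_nonneg (P.index u) (P.index v)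
    have hmU : (m : ℤ) ≤ P.netU (P.index u) (P.index v) := by omega
    rw [load, ← hm]
    rcases (P.le_netU_index_iff u v hmC).1 hmU with h0 | ⟨q', hq', h⟩
    · simp [h0]
    · rw [hq, Option.some.injEq] at hq'
      rwa [hq']
  · intro r' hr'
    have h1 := hR.cost_le hr'
    have h2 : 2 * ∑ c ∈ P.clients, (P.arrival (r c) : ℤ) * P.intWeight (c : ℕ) ≤
        ∑ u ∈ P.nodeSet, ∑ v ∈ P.nodeSet, (P.netU u v - R u v) * P.arcCost u v := by
      rw [← cost_routingFlow fun c hc => (hrL c hc).2]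
      have hsum : ∀ u ∈ P.nodeSet, ∀ v ∈ P.nodeSet,
          P.netU u v - R u v = -G u v + P.routingFlow r u v := by
        intro u hu v hv
        rw [mem_nodeSet] at hu hv
        rw [hD.sum u v hu.1 hu.2 hv.1 hv.2, sinks_eq,
          Finset.sum_image fun _ _ _ _ h => P.sink_injective h, routingFlow]
        congr 1
        exact Finset.sum_congr rfl fun c hc => by rw [(hrL c hc).1]
      -- what remains besides the paths is a circulation along arcs of non-negative cost
      have hG : 0 ≤ ∑ u ∈ P.nodeSet, ∑ v ∈ P.nodeSet, -G u v * P.arcCost u v := by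
        have hanti : ∀ u ∈ P.nodeSet, ∀ v ∈ P.nodeSet, -G v u = -(-G u v) := by
          intro u hu v hv
          rw [mem_nodeSet] at hu hv
          rw [hD.anti u v hu.1 hu.2 hv.1 hv.2]
        have h3 := sum_mul_sub_eq (H := P.netH) hanti
        refine (mul_nonneg zero_le_two (Finset.sum_nonneg fun u hu => Finset.sum_nonneg fun v hv =>
          IsOptimalResidual.mul_netH_nonneg (E := fun u v => -G u v) hanti ?_ hu hv)).trans_eq h3.symm
        intro u hu v hv h0
        have hle := hR.flow_le hu hv
        rw [mem_nodeSet] at hu hv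
        have huses := hD.uses u v hu.1 hu.2 hv.1 hv.2
        omega
      have hcost : ∑ u ∈ P.nodeSet, ∑ v ∈ P.nodeSet, (P.netU u v - R u v) * P.arcCost u v =
          ∑ u ∈ P.nodeSet, ∑ v ∈ P.nodeSet, -G u v * P.arcCost u v +
            ∑ u ∈ P.nodeSet, ∑ v ∈ P.nodeSet, P.routingFlow r u v * P.arcCost u v := by
        simp only [← Finset.sum_add_distrib, ← add_mul]
        exact Finset.sum_congr rfl fun u hu => Finset.sum_congr rfl fun v hv => by
          rw [hsum u hu v hv]
      omega
    have h3 : (commonDenom P.inp P.numSat : ℚ) * (P.objective r : ℚ) ≤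
        (commonDenom P.inp P.numSat : ℚ) * (P.objective r' : ℚ) := by
      rw [objective_eq, objective_eq]
      exact_mod_cast (by omega : ∑ c ∈ P.clients, (P.arrival (r c) : ℤ) * P.intWeight (c : ℕ) ≤
        ∑ c ∈ P.clients, (P.arrival (r' c) : ℤ) * P.intWeight (c : ℕ))
    exact_mod_cast le_of_mul_le_mul_left h3 (by exact_mod_cast P.commonDenom_pos)

end IsDecomposition

end UFWS

/-! ### The output, and the polynomial bound -/

namespace UFWS

open RAM

variable {P : UFWS}

theorem inner_fullPath (c : Fin P.numSat) (l : List P.Node) :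
    RAM.inner (P.fullPath c l) = l.map P.index := by
  simp [RAM.inner, fullPath]

theorem coords_map_index (l : List P.Node) : coords P.numSat (l.map P.index) =
    (l.flatMap fun v => [(v.1 : ℕ), (v.2 : ℕ)]).map Nat.cast := by
  rw [coords, List.flatMap_map, List.map_flatMap]
  refine List.flatMap_congr fun v _ => ?_
  rw [index_div, index_mod]
  rfl

theorem encodeAnswer_some_eq {r : P.Routing} {L : ℤ → List ℤ} (hr : ∀ c ∉ P.clients, r c = [])
    (hL : ∀ c ∈ P.clients, L (P.sink c) = P.fullPath c (r c)) :
    (P.encodeAnswer (some r)).map Nat.cast = 1 :: routeOutput P.inp L P.numSat := by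
  rw [encodeAnswer, List.map_cons, routeOutput, ← List.map_coe_finRange_eq_range, List.flatMap_map,
    List.map_flatMap]
  refine congrArg₂ _ rfl (List.flatMap_congr fun c _ => ?_)
  have hc := P.inp_isClient c
  have hsink : P.inp 1 * P.inp 0 + (c : ℕ) = P.sink c := by rw [sink, inp_one, inp_zero]
  simp only [hsink]
  by_cases h : c ∈ P.clients
  · rw [if_pos (hc.2 h), hL c h, inner_fullPath, inp_zero, coords_map_index]
    simp
  · rw [if_neg fun h' => h (hc.1 h'), hr c h]
    rfl

theorem hasOutput_of_holds {m : Memory} {l : List ℕ} {l' : List ℤ} (hl : l.map Nat.cast = l')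
    (h0 : m.reg 0 = l'.length) (h1 : Holds (m.arr 1) 0 l') : HasOutput m l := by
  subst hl
  refine ⟨by simpa using h0, fun j hj => ?_⟩
  have := h1.getElem j (by simpa using hj)
  simpa using this

/-- The program outputs a correct answer. -/
theorem wp_solve_answer (P : UFWS) :
    Wp solve (solveSteps P.numSat P.numSnap P.netSize) (input P.encode) fun m =>
      ∃ b, P.IsAnswer b ∧ HasOutput m (P.encodeAnswer b) := by
  refine P.wp_solve.mono le_rfl ?_
  rintro m - ⟨R, p, hR, h1, h2⟩
  by_cases hs : R (P.inp 2) P.super = P.clients.card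
  · obtain ⟨G, L, hD, h3, h4⟩ := h1 hs
    obtain ⟨r, hr, hL⟩ := IsDecomposition.exists_isOptimal hR hD hs
    exact ⟨some r, hr, hasOutput_of_holds (encodeAnswer_some_eq hr.1.2.1 hL) h3 h4⟩
  · obtain ⟨h3, h4⟩ := h2 hs
    refine ⟨none, IsOptimalResidual.not_isFeasible hR hs, ?_⟩
    exact hasOutput_of_holds (l := [0]) (l' := [0]) (by simp) (by simpa using h3)
      ⟨by simpa using h4, trivial⟩

/-- The answer consists of polynomially many numbers, since simple paths are short. -/
theorem length_encodeAnswer_le {b : Option P.Routing} (hb : P.IsAnswer b) :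
    (P.encodeAnswer b).length ≤ 1 + P.numSat * (1 + P.numSnap * P.numSat * 2) := by
  cases b with
  | none => simp [encodeAnswer]
  | some r =>
      have hlen : ∀ c, (r c).length ≤ P.numSnap * P.numSat := by
        intro c
        by_cases hc : c ∈ P.clients
        · have := (hb.1.1 c hc).2.2.1.length_le_card
          simpa using this
        · simp [hb.1.2.1 c hc]
      rw [encodeAnswer, List.length_cons, List.length_flatMap, add_comm]
      refine Nat.add_le_add_left ((List.sum_le_card_nsmul _ (1 + P.numSnap * P.numSat * 2) ?_).trans
        (by simp)) 1
      simp only [List.mem_map, List.mem_finRange, true_and]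
      rintro _ ⟨c, rfl⟩
      have := hlen c
      simp [List.length_flatMap]
      omega

theorem length_le_bitLength (l : List ℕ) : l.length ≤ bitLength l := by
  simp [bitLength]

theorem size_getD_le_bitLength (l : List ℕ) (j : ℕ) : Nat.size (l.getD j 0) ≤ bitLength l := by
  by_cases hj : j < l.length
  · rw [List.getD_eq_getElem _ _ hj]
    have := List.single_le_sum (l := l.map fun n => Nat.size n + 1) (by simp) (Nat.size l[j] + 1)
      (List.mem_map.2 ⟨_, List.getElem_mem hj, rfl⟩)
    rw [bitLength]; omega
  · rw [List.getD_eq_default _ _ (by omega)]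
    simp

theorem bitBounded_input (l : List ℕ) : (input l).BitBounded (bitLength l) (bitLength l) := by
  have harr : ∀ a i, bits ((input l).arr a i) ≤ bitLength l := by
    intro a i
    simp only [input]
    split_ifs
    · simpa [bits] using size_getD_le_bitLength l i.toNat
    · simp [bits]
  refine ⟨fun x => ?_, harr, harr 0⟩
  simp only [input]
  split_ifs
  · simp only [bits, Int.natAbs_natCast]
    refine le_trans ?_ (length_le_bitLength l)
    exact Nat.size_le.2 Nat.lt_two_pow_self
  · simp [bits]

theorem bitLength_le_of_hasOutput {m : Memory} {l : List ℕ} {b B : ℕ} (h : HasOutput m l)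
    (hm : m.BitBounded b B) : bitLength l ≤ l.length * (B + 1) := by
  refine (List.sum_le_card_nsmul _ (B + 1) ?_).trans (by simp)
  simp only [List.mem_map]
  rintro _ ⟨x, hx, rfl⟩
  obtain ⟨j, hj, rfl⟩ := List.getElem_of_mem hx
  have h1 := hm.arr 1 j
  rw [h.2 j hj] at h1
  simpa [bits] using h1

theorem numSat_le_bitLength (P : UFWS) : P.numSat ≤ bitLength P.encode := by
  refine le_trans ?_ (length_le_bitLength _)
  rw [length_encode]; omega

theorem numSnap_le_bitLength (P : UFWS) : P.numSnap ≤ bitLength P.encode := by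
  refine le_trans ?_ (length_le_bitLength _)
  have h : P.numSnap * 1 ≤ P.numSnap * (P.numSat * (P.numSat * 2)) :=
    Nat.mul_le_mul_left _ (Nat.mul_pos P.numSat_pos (Nat.mul_pos P.numSat_pos two_pos))
  rw [length_encode]; omega

/-- A bound for the number of steps in terms of the bit length of the instance. -/
def stepBound (x : ℕ) : ℕ := solveSteps x x ((x + 1) * x + 1)

theorem solveSteps_le_stepBound (P : UFWS) :
    solveSteps P.numSat P.numSnap P.netSize ≤ stepBound (bitLength P.encode) := by
  have h1 := P.numSat_le_bitLength
  have h2 := P.numSnap_le_bitLength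
  have h3 : P.netSize ≤ (bitLength P.encode + 1) * bitLength P.encode + 1 := by
    unfold netSize; gcongr
  simp only [stepBound, solveSteps, augmentSteps, routeSteps, dijkstraSteps]
  gcongr

/-- A bound for the bit lengths of all numbers that occur. -/
def bitBound (x : ℕ) : ℕ := x + stepBound x * (solve.weight * (x + 1))

/-- A bound for the cost of the run and the bit length of the answer. -/
def totalBound (x : ℕ) : ℕ :=
  stepBound x * (solve.weight * (bitBound x + solve.weight * (x + 1) + 2)) +
    (1 + x * (1 + x * x * 2)) * (bitBound x + 1)

/-- The function is given by a polynomial with coefficients in the natural numbers. -/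
def IsPolynomial (f : ℕ → ℕ) : Prop := ∃ p : Polynomial ℕ, ∀ x, p.eval x = f x

namespace IsPolynomial

variable {f g : ℕ → ℕ}

theorem const (c : ℕ) : IsPolynomial fun _ => c := ⟨.C c, fun _ => Polynomial.eval_C⟩

theorem id : IsPolynomial fun x => x := ⟨.X, fun _ => Polynomial.eval_X⟩

theorem add : IsPolynomial f → IsPolynomial g → IsPolynomial fun x => f x + g x
  | ⟨p, hp⟩, ⟨q, hq⟩ => ⟨p + q, fun x => by rw [Polynomial.eval_add, hp, hq]⟩

theorem mul : IsPolynomial f → IsPolynomial g → IsPolynomial fun x => f x * g x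
  | ⟨p, hp⟩, ⟨q, hq⟩ => ⟨p * q, fun x => by rw [Polynomial.eval_mul, hp, hq]⟩

end IsPolynomial

theorem isPolynomial_stepBound : IsPolynomial stepBound := by
  unfold stepBound solveSteps augmentSteps routeSteps dijkstraSteps
  repeat' first | exact .const _ | exact .id | apply IsPolynomial.add | apply IsPolynomial.mul

theorem isPolynomial_totalBound : IsPolynomial totalBound := by
  have := isPolynomial_stepBound
  unfold totalBound bitBound
  generalize solve.weight = w
  repeat' first | exact .const _ | exact .id | assumption | apply IsPolynomial.add |
    apply IsPolynomial.mul

end UFWS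

theorem mainTheorem1 :
    RAM.PolyTimeSolvable UFWS.encode UFWS.encodeAnswer UFWS.IsAnswer := by
  obtain ⟨q, hq⟩ := UFWS.isPolynomial_totalBound
  refine ⟨RAM.solve, q, fun P => ?_⟩
  obtain ⟨s, m, hs, hsT, b, hb, hout⟩ := P.wp_solve_answer
  set x := RAM.bitLength P.encode with hx
  have hsS : s ≤ UFWS.stepBound x := hsT.trans P.solveSteps_le_stepBound
  have hB : x + s * (RAM.solve.weight * (x + 1)) ≤ UFWS.bitBound x := by
    unfold UFWS.bitBound; gcongr
  obtain ⟨hm, hrun⟩ := hs.runs RAM.tame_solve le_rfl (UFWS.bitBounded_input P.encode)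
  obtain ⟨t, ht, htle⟩ := hrun _ hB
  refine ⟨b, t, m, hb, ht, hout, ?_⟩
  rw [hq, UFWS.totalBound]
  refine Nat.add_le_add (htle.trans (by gcongr))
    ((UFWS.bitLength_le_of_hasOutput hout (hm.mono hB)).trans ?_)
  have h1 := P.numSat_le_bitLength
  have h2 := P.numSnap_le_bitLength
  exact Nat.mul_le_mul_right _ ((UFWS.length_encodeAnswer_le hb).trans (by rw [← hx] at h1 h2; gcongr))
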